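/- Euclidean Capacitated Sum of Radii with uniform capacities is the following problem. Given a set $P$ of $n\ge 1$ distinct points in $\mathbb{R}^d$ ($d\ge 1$), an integer $k\ge 1$ and a capacity $U\in\mathbb{Z}_{\ge 0}$, find $k$ distinct centres $c_1,\dots,c_k\in\mathbb{R}^d$, real radii $r_1,\dots,r_k\ge 0$ and an assignment $\mu:P\to\{1,\dots,k\}$ such that $\|p-c_{\mu(p)}\|_2\le r_{\mu(p)}$ for every $p\in P$ and $|\mu^{-1}(i)|\le U$ for every $i$, so that $\sum_{i=1}^k r_i$ is minimized. Theorem. There are a constant $C$ and a deterministic algorithm on the unit-cost real RAM (arithmetic operations $+,-,\times,\div$ and comparisons on real numbers; addition, truncated subtraction and comparison of natural numbers, conversion of natural numbers to reals, and indirect addressing) that, for every $\epsilon>0$ and every such instance, both given as input, halts after at most $$2^{\,C\,k\,d\,\log_2(\max\{2,\,k/\epsilon\})}\cdot n^3$$ steps (that is, $2^{\mathcal{O}(kd\log(k/\epsilon))}\cdot n^3$ whenever $k/\epsilon\ge 2$), and either outputs a feasible solution (centres, radii and assignment) whose value is at most $(1+\epsilon)$ times the value of every feasible solution, or, if and only if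 the instance has no feasible solution, reports this. -/

import Mathlib

/-! ### The unit-cost real RAM

Memory consists of arrays of natural numbers and arrays of real numbers.  A program refers to
finitely many arrays by fixed names (numerals); indices are computed.  A scalar variable is cell `0`
of an array.  Natural numbers support addition, truncated subtraction and comparison; real numbers
support the four field operations and comparison; a natural number may be converted to a real
number, but there is no rounding, no root and no real constant. -/

namespace RealRAM

/-- The contents of the memory: `s.nat a i` and `s.real a i` are the cells with index `i` of the
integer array and of the real array with name `a`. -/
structure State where
  nat : ℕ → ℕ → ℕ
  real : ℕ → ℕ → ℝ

/-- Integer expressions. -/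
inductive NExp where
  | lit (c : ℕ)
  | get (a : ℕ) (i : NExp)
  | add (e f : NExp)
  | sub (e f : NExp)

/-- Real expressions. -/
inductive RExp where
  | cast (e : NExp)
  | get (a : ℕ) (i : NExp)
  | add (e f : RExp)
  | sub (e f : RExp)
  | mul (e f : RExp)
  | div (e f : RExp)

/-- Tests. -/
inductive Test where
  | nle (e f : NExp)
  | rle (e f : RExp)
  | not (b : Test)
  | and (b c : Test)

/-- Programs. -/
inductive Cmd where
  | skip
  | setNat (a : ℕ) (i : NExp) (e : NExp)
  | setReal (a : ℕ) (i : NExp) (e : RExp)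
  | seq (p q : Cmd)
  | ite (b : Test) (p q : Cmd)
  | loop (b : Test) (p : Cmd)

/-- The value of an integer expression. -/
def NExp.eval (s : State) : NExp → ℕ
  | .lit c => c
  | .get a i => s.nat a (i.eval s)
  | .add e f => e.eval s + f.eval s
  | .sub e f => e.eval s - f.eval s

/-- The number of operations in an integer expression. -/
def NExp.cost : NExp → ℕ
  | .lit _ => 1
  | .get _ i => i.cost + 1
  | .add e f => e.cost + f.cost + 1
  | .sub e f => e.cost + f.cost + 1

/-- The value of a real expression (a quotient by `0` has the value `0`). -/
noncomputable def RExp.eval (s : State) : RExp → ℝ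
  | .cast e => (e.eval s : ℝ)
  | .get a i => s.real a (i.eval s)
  | .add e f => e.eval s + f.eval s
  | .sub e f => e.eval s - f.eval s
  | .mul e f => e.eval s * f.eval s
  | .div e f => e.eval s / f.eval s

/-- The number of operations in a real expression. -/
def RExp.cost : RExp → ℕ
  | .cast e => e.cost + 1
  | .get _ i => i.cost + 1
  | .add e f => e.cost + f.cost + 1
  | .sub e f => e.cost + f.cost + 1
  | .mul e f => e.cost + f.cost + 1
  | .div e f => e.cost + f.cost + 1

/-- The truth value of a test. -/
def Test.eval (s : State) : Test → Prop
  | .nle e f => e.eval s ≤ f.eval s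
  | .rle e f => e.eval s ≤ f.eval s
  | .not b => ¬ b.eval s
  | .and b c => b.eval s ∧ c.eval s

/-- The number of operations in a test. -/
def Test.cost : Test → ℕ
  | .nle e f => e.cost + f.cost + 1
  | .rle e f => e.cost + f.cost + 1
  | .not b => b.cost + 1
  | .and b c => b.cost + c.cost + 1

/-- Write `v` into the integer cell `a[i]`. -/
def State.setNat (s : State) (a i v : ℕ) : State :=
  { s with nat := Function.update s.nat a (Function.update (s.nat a) i v) }

/-- Write `v` into the real cell `a[i]`. -/
noncomputable def State.setReal (s : State) (a i : ℕ) (v : ℝ) : State :=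
  { s with real := Function.update s.real a (Function.update (s.real a) i v) }

/-- `Run p s t s'`: started in the state `s`, the program `p` halts in the state `s'` after exactly
`t` elementary steps.  Every operation, memory access, assignment and branching is one step. -/
inductive Run : Cmd → State → ℕ → State → Prop
  | skip (s : State) : Run .skip s 1 s
  | setNat (s : State) (a : ℕ) (i e : NExp) :
      Run (.setNat a i e) s (i.cost + e.cost + 1) (s.setNat a (i.eval s) (e.eval s))
  | setReal (s : State) (a : ℕ) (i : NExp) (e : RExp) :
      Run (.setReal a i e) s (i.cost + e.cost + 1) (s.setReal a (i.eval s) (e.eval s))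
  | seq {p q : Cmd} {s s₁ s₂ : State} {t₁ t₂ : ℕ} :
      Run p s t₁ s₁ → Run q s₁ t₂ s₂ → Run (.seq p q) s (t₁ + t₂) s₂
  | iteTrue {b : Test} {p q : Cmd} {s s₁ : State} {t : ℕ} :
      b.eval s → Run p s t s₁ → Run (.ite b p q) s (b.cost + 1 + t) s₁
  | iteFalse {b : Test} {p q : Cmd} {s s₁ : State} {t : ℕ} :
      ¬ b.eval s → Run q s t s₁ → Run (.ite b p q) s (b.cost + 1 + t) s₁
  | loopDone {b : Test} {p : Cmd} {s : State} :
      ¬ b.eval s → Run (.loop b p) s (b.cost + 1) s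
  | loopStep {b : Test} {p : Cmd} {s s₁ s₂ : State} {t₁ t₂ : ℕ} :
      b.eval s → Run p s t₁ s₁ → Run (.loop b p) s₁ t₂ s₂ →
      Run (.loop b p) s (b.cost + 1 + t₁ + t₂) s₂

/-- Programs are deterministic: the running time and the final state are unique. -/
theorem Run.unique {p : Cmd} {s s₁ s₂ : State} {t₁ t₂ : ℕ}
    (h₁ : Run p s t₁ s₁) (h₂ : Run p s t₂ s₂) : t₁ = t₂ ∧ s₁ = s₂ := by
  induction h₁ generalizing t₂ s₂ with
  | skip => cases h₂; exact ⟨rfl, rfl⟩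
  | setNat => cases h₂; exact ⟨rfl, rfl⟩
  | setReal => cases h₂; exact ⟨rfl, rfl⟩
  | seq _ _ ih ih' =>
    cases h₂ with
    | seq k k' =>
      obtain ⟨rfl, rfl⟩ := ih k
      obtain ⟨rfl, rfl⟩ := ih' k'
      exact ⟨rfl, rfl⟩
  | iteTrue hb _ ih =>
    cases h₂ with
    | iteTrue _ k => obtain ⟨rfl, rfl⟩ := ih k; exact ⟨rfl, rfl⟩
    | iteFalse hb' _ => exact absurd hb hb'
  | iteFalse hb _ ih =>
    cases h₂ with
    | iteTrue hb' _ => exact absurd hb' hb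
    | iteFalse _ k => obtain ⟨rfl, rfl⟩ := ih k; exact ⟨rfl, rfl⟩
  | loopDone hb =>
    cases h₂ with
    | loopDone _ => exact ⟨rfl, rfl⟩
    | loopStep hb' _ _ => exact absurd hb' hb
  | loopStep hb _ _ ih ih' =>
    cases h₂ with
    | loopDone hb' => exact absurd hb hb'
    | loopStep _ k k' =>
      obtain ⟨rfl, rfl⟩ := ih k
      obtain ⟨rfl, rfl⟩ := ih' k'
      exact ⟨rfl, rfl⟩

end RealRAM

/-! ### Euclidean Capacitated Sum of Radii with uniform capacities -/

namespace SumOfRadii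

/-- A candidate solution for `n` points in `ℝ^d` and `k` clusters: centres anywhere in `ℝ^d`,
radii, and an assignment of the points to the centres. -/
structure Solution (n d k : ℕ) where
  centre : Fin k → EuclideanSpace ℝ (Fin d)
  radius : Fin k → ℝ
  assign : Fin n → Fin k

/-- The objective: the sum of the radii. -/
noncomputable def Solution.value {n d k : ℕ} (S : Solution n d k) : ℝ := ∑ c, S.radius c

/-- Validity of a solution: the `k` centres are distinct (hard capacities), the radii are
nonnegative, every point lies in the ball of the centre it is assigned to, and no centre is assigned
more than `U` points. -/
structure Solution.Valid {n d k : ℕ} (U : ℕ) (P : Fin n → EuclideanSpace ℝ (Fin d))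
    (S : Solution n d k) : Prop where
  centre_injective : Function.Injective S.centre
  radius_nonneg : ∀ c, 0 ≤ S.radius c
  dist_le : ∀ i, dist (P i) (S.centre (S.assign i)) ≤ S.radius (S.assign i)
  card_le : ∀ c, (Finset.univ.filter fun i => S.assign i = c).card ≤ U

/-- The memory at the start: the integer array `0` holds `n, d, k, U`, cell `0` of the real array
`0` holds `ε`, and the real array `1` holds the coordinates of the points, row by row (coordinate
`j` of point `i` in cell `i * d + j`); everything else is `0`. -/
noncomputable def inputState {n d : ℕ} (k U : ℕ) (ε : ℝ) (P : Fin n → EuclideanSpace ℝ (Fin d)) :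
    RealRAM.State where
  nat a i :=
    match a, i with
    | 0, 0 => n
    | 0, 1 => d
    | 0, 2 => k
    | 0, 3 => U
    | _, _ => 0
  real a i :=
    match a, i with
    | 0, 0 => ε
    | 1, m => if h : m < n * d then
        P (finProdFinEquiv.symm ⟨m, h⟩).1 (finProdFinEquiv.symm ⟨m, h⟩).2 else 0
    | _, _ => 0

/-- `Holds s S`: the state `s` holds the solution `S` as its output, the centres row by row in the
real array `2`, the radii in the real array `3`, the assignment in the integer array `2`. -/
def Holds {n d k : ℕ} (s : RealRAM.State) (S : Solution n d k) : Prop :=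
  (∀ (c : Fin k) (j : Fin d), s.real 2 (c * d + j) = S.centre c j) ∧
  (∀ c : Fin k, s.real 3 c = S.radius c) ∧
  (∀ i : Fin n, s.nat 2 i = S.assign i)

/-- The output in the state `s` is an `α`-approximation: either the answer cell (cell `0` of the
integer array `1`) is `1` and `s` holds a valid solution whose value is at most `α` times the value
of every valid solution, or the answer cell is `0` and the instance has no valid solution. -/
def IsApproxOutput {n d : ℕ} (α : ℝ) (k U : ℕ) (P : Fin n → EuclideanSpace ℝ (Fin d))
    (s : RealRAM.State) : Prop :=
  (s.nat 1 0 = 1 ∧ ∃ S : Solution n d k, Holds s S ∧ S.Valid U P ∧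
    ∀ T : Solution n d k, T.Valid U P → S.value ≤ α * T.value) ∨
  (s.nat 1 0 = 0 ∧ ∀ T : Solution n d k, ¬ T.Valid U P)

end SumOfRadii

/-! ### Program logic: triples with running times and frame conditions. -/

namespace RealRAM

/-! ### Total correctness with a time bound -/

/-! Write `K = max 2 (k / ε)`. The algorithm exhaustively tries a unit of length `δ` together with a
word of `L = O(k d log K)` instructions, each of three bits. Every pair is interpreted as a list of
balls, tested for feasibility, and kept if it beats the best solution so far. An arbitrary guess can
therefore do no harm, and it remains to show that every feasible solution is nearly matched by some
guess.

The unit. Shrinking balls makes each radius zero or comparable to a distance of two input points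
(`Clustering.exists_tight`). The largest radius is then within a factor depending on `d` of a
coordinate difference, so for some pair of points, some coordinate and one of `d + k + 1` doublings,
the value lies between `4Kδ` and `8Kδ` (`Clustering.Tight.exists_unit`). Additive errors totalling
`3kδ` are then affordable.

The word. No centre is described by naming an input point, which would cost a factor `n` per
cluster. A cluster whose ball nearly touches an already placed one is located relative to that
ball's centre; once no such cluster remains, the next one is located relative to an input point that
the machine itself finds uncovered. In both cases the displacement is at most `11Kδ`. If no point is
uncovered, all nonempty clusters have been placed (`Tracks.complete`). Centres are rounded to a grid
of mesh about `δ / √d`. By Cauchy–Schwarz the coefficients have average size `O(K)`, and a number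
`z` is encoded in `a + |z| / 2 ^ a` signed digits, where `2 ^ a ≥ K`; hence a centre needs only `O(d
log K)` digits (`exists_rounding`, `exists_digits'`).

Feasibility. Radii are enlarged by between `2δ` and `3δ`: one `δ` pays for rounding the centre,
another for moving it so that all centres become distinct (`exists_not_clash`, `Deduped`). A
capacitated assignment exists iff Hall's condition holds for each of the `2 ^ k` sets of balls
(`feasible_iff_hall`); an actual assignment is extracted at the end by deleting incidences while
feasibility persists (`assignCmd_spec`).

All this is carried out on the RAM through triples with explicit time bounds. The two loops over
points in the choice of the unit and the linear scans for one guess account for `n ^ 3`. -/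

@[simp] theorem State.setNat_nat (s : State) (a i v b : ℕ) :
    (s.setNat a i v).nat b = if b = a then Function.update (s.nat b) i v else s.nat b := by
  by_cases h : b = a
  · subst h; simp [State.setNat]
  · simp [State.setNat, h]

@[simp] theorem State.setNat_real (s : State) (a i v : ℕ) : (s.setNat a i v).real = s.real := rfl

@[simp] theorem State.setReal_nat (s : State) (a i : ℕ) (v : ℝ) :
    (s.setReal a i v).nat = s.nat := rfl

@[simp] theorem State.setReal_real (s : State) (a i : ℕ) (v : ℝ) (b : ℕ) :
    (s.setReal a i v).real b = if b = a then Function.update (s.real b) i v else s.real b := by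
  by_cases h : b = a
  · subst h; simp [State.setReal]
  · simp [State.setReal, h]

attribute [simp] NExp.eval RExp.eval Test.eval

/-- Started in `s`, the program `p` halts within `T` steps in a state satisfying `Q`. -/
def Spec (p : Cmd) (s : State) (T : ℕ) (Q : State → Prop) : Prop :=
  ∃ t s', Run p s t s' ∧ t ≤ T ∧ Q s'

/-- Does the program contain an assignment to the integer array `a`? -/
def Cmd.writesNat : Cmd → ℕ → Bool
  | .skip, _ => false
  | .setNat b _ _, a => b == a
  | .setReal _ _ _, _ => false
  | .seq p q, a => p.writesNat a || q.writesNat a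
  | .ite _ p q, a => p.writesNat a || q.writesNat a
  | .loop _ p, a => p.writesNat a

/-- Does the program contain an assignment to the real array `a`? -/
def Cmd.writesReal : Cmd → ℕ → Bool
  | .skip, _ => false
  | .setNat _ _ _, _ => false
  | .setReal b _ _, a => b == a
  | .seq p q, a => p.writesReal a || q.writesReal a
  | .ite _ p q, a => p.writesReal a || q.writesReal a
  | .loop _ p, a => p.writesReal a

/-- `s'` differs from `s` only in arrays that `p` may write. -/
structure Frame (p : Cmd) (s s' : State) : Prop where
  nat : ∀ a, p.writesNat a = false → s'.nat a = s.nat a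
  real : ∀ a, p.writesReal a = false → s'.real a = s.real a

theorem Frame.refl (p : Cmd) (s : State) : Frame p s s := ⟨fun _ _ => rfl, fun _ _ => rfl⟩

theorem Frame.trans {p : Cmd} {s s₁ s₂ : State} (h : Frame p s s₁) (h' : Frame p s₁ s₂) :
    Frame p s s₂ :=
  ⟨fun a ha => (h'.nat a ha).trans (h.nat a ha), fun a ha => (h'.real a ha).trans (h.real a ha)⟩

theorem Frame.weaken {p q : Cmd} {s s' : State} (h : Frame p s s')
    (hn : ∀ a, q.writesNat a = false → p.writesNat a = false)
    (hr : ∀ a, q.writesReal a = false → p.writesReal a = false) : Frame q s s' :=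
  ⟨fun a ha => h.nat a (hn a ha), fun a ha => h.real a (hr a ha)⟩

/-- Array names are numerals, only indices are computed, so the syntax of a program shows which
arrays it can change. For concrete programs the check is closed by `rfl`, and specifications need to
mention only what changes. -/
theorem Run.frame {p : Cmd} {s s' : State} {t : ℕ} (h : Run p s t s') : Frame p s s' := by
  induction h with
  | skip s => exact Frame.refl _ s
  | setNat s a i e =>
    refine ⟨fun b hb => ?_, fun _ _ => rfl⟩
    have : b ≠ a := by rintro rfl; simp [Cmd.writesNat] at hb
    simp [this]
  | setReal s a i e =>
    refine ⟨fun _ _ => rfl, fun b hb => ?_⟩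
    have : b ≠ a := by rintro rfl; simp [Cmd.writesReal] at hb
    simp [this]
  | seq _ _ ih ih' =>
    exact (ih.weaken (fun a ha => by simp_all [Cmd.writesNat])
      (fun a ha => by simp_all [Cmd.writesReal])).trans
      (ih'.weaken (fun a ha => by simp_all [Cmd.writesNat])
      (fun a ha => by simp_all [Cmd.writesReal]))
  | iteTrue _ _ ih =>
    exact ih.weaken (fun a ha => by simp_all [Cmd.writesNat])
      (fun a ha => by simp_all [Cmd.writesReal])
  | iteFalse _ _ ih =>
    exact ih.weaken (fun a ha => by simp_all [Cmd.writesNat])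
      (fun a ha => by simp_all [Cmd.writesReal])
  | loopDone _ => exact Frame.refl _ _
  | loopStep _ _ _ ih ih' =>
    exact (ih.weaken (fun a ha => by simp_all [Cmd.writesNat])
      (fun a ha => by simp_all [Cmd.writesReal])).trans ih'

theorem Spec.imp {p : Cmd} {s : State} {T T' : ℕ} {Q Q' : State → Prop} (h : Spec p s T Q)
    (hQ : ∀ s', Q s' → Frame p s s' → Q' s') (hT : T ≤ T') : Spec p s T' Q' := by
  obtain ⟨t, s', hr, ht, hq⟩ := h
  exact ⟨t, s', hr, ht.trans hT, hQ s' hq hr.frame⟩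

theorem Spec.seq {p q : Cmd} {s : State} {T₁ T₂ T : ℕ} {R Q : State → Prop}
    (h₁ : Spec p s T₁ R) (h₂ : ∀ s₁, R s₁ → Frame p s s₁ → Spec q s₁ T₂ Q) (hT : T₁ + T₂ ≤ T) :
    Spec (.seq p q) s T Q := by
  obtain ⟨t, s', hr, ht, hq⟩ := h₁
  obtain ⟨t', s'', hr', ht', hq'⟩ := h₂ s' hq hr.frame
  exact ⟨t + t', s'', .seq hr hr', by omega, hq'⟩

theorem Spec.ite {b : Test} {p q : Cmd} {s : State} {T T' : ℕ} {Q : State → Prop}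
    (h₁ : b.eval s → Spec p s T' Q) (h₂ : ¬ b.eval s → Spec q s T' Q) (hT : b.cost + 1 + T' ≤ T) :
    Spec (.ite b p q) s T Q := by
  by_cases hb : b.eval s
  · obtain ⟨t, s', hr, ht, hq⟩ := h₁ hb
    exact ⟨_, s', .iteTrue hb hr, by omega, hq⟩
  · obtain ⟨t, s', hr, ht, hq⟩ := h₂ hb
    exact ⟨_, s', .iteFalse hb hr, by omega, hq⟩

/-- The number `N` of rounds is known in advance: the invariant, indexed by the round, must imply
the test before round `N` and refute it at `N`. This yields termination and the time bound together.
-/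
theorem Spec.loop {b : Test} {p : Cmd} {s : State} {T N : ℕ} (I : ℕ → State → Prop)
    (h0 : I 0 s)
    (hstep : ∀ i s', i < N → Frame p s s' → I i s' → b.eval s' ∧ Spec p s' T (I (i + 1)))
    (hN : ∀ s', Frame p s s' → I N s' → ¬ b.eval s') :
    Spec (.loop b p) s (N * (T + b.cost + 1) + b.cost + 1) (I N) := by
  suffices H : ∀ m i s', i + m = N → Frame p s s' → I i s' →
      Spec (.loop b p) s' (m * (T + b.cost + 1) + b.cost + 1) (I N) from
    H N 0 s (by omega) (Frame.refl _ _) h0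
  intro m
  induction m with
  | zero =>
    intro i s' hi hf hI
    obtain rfl : i = N := by omega
    exact ⟨_, s', .loopDone (hN s' hf hI), by omega, hI⟩
  | succ m ih =>
    intro i s' hi hf hI
    obtain ⟨hb, t, s'', hr, ht, hI'⟩ := hstep i s' (by omega) hf hI
    obtain ⟨t', s₃, hr', ht', hq⟩ := ih (i + 1) s'' (by omega) (hf.trans hr.frame) hI'
    exact ⟨_, s₃, .loopStep hb hr hr', by rw [Nat.succ_mul]; omega, hq⟩

/-- The scalar integer variable `a`. -/
abbrev var (a : ℕ) : NExp := .get a (.lit 0)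

/-- The scalar real variable `a`. -/
abbrev rvar (a : ℕ) : RExp := .get a (.lit 0)

/-- `for v = 0, …, b - 1 do p`. -/
def forTo (v : ℕ) (b : NExp) (p : Cmd) : Cmd :=
  .seq (.setNat v (.lit 0) (.lit 0)) (.loop (.nle (.add (var v) (.lit 1)) b)
    (.seq p (.setNat v (.lit 0) (.add (var v) (.lit 1)))))

/-- The bound `b` is evaluated again in every round, hence it must keep its value under the frame of
the whole loop. The body has to establish the invariant for the state after the counter has been
increased. The 30 extra steps per round absorb the test and the increment. -/
theorem Spec.forTo {v : ℕ} {b : NExp} {p : Cmd} {s : State} {T T' : ℕ} (N : ℕ)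
    (I : ℕ → State → Prop)
    (hv : p.writesNat v = false)
    (hb : ∀ s', Frame (forTo v b p) s s' → b.eval s' = N)
    (hc : b.cost ≤ 10)
    (h0 : I 0 (s.setNat v 0 0))
    (hstep : ∀ i s', i < N → s'.nat v 0 = i → Frame (RealRAM.forTo v b p) s s' → I i s' →
      Spec p s' T (fun s'' => I (i + 1) (s''.setNat v 0 (i + 1))))
    (hT : N * (T + 30) + 30 ≤ T') :
    Spec (RealRAM.forTo v b p) s T' (I N) := by
  have hW : Frame (RealRAM.forTo v b p) s (s.setNat v 0 0) := by
    refine ⟨fun a ha => ?_, fun _ _ => rfl⟩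
    have : a ≠ v := by rintro rfl; simp [RealRAM.forTo, Cmd.writesNat] at ha
    simp [this]
  have key := Spec.loop (b := .nle (.add (var v) (.lit 1)) b)
    (p := .seq p (.setNat v (.lit 0) (.add (var v) (.lit 1)))) (s := s.setNat v 0 0) (T := T + 6)
    (N := N) (fun i s' => s'.nat v 0 = i ∧ I i s') ⟨by simp, h0⟩ ?_ ?_
  · refine Spec.seq (T₁ := 3) (R := fun s' => s' = s.setNat v 0 0)
      ⟨_, _, .setNat _ _ _ _, by simp [NExp.cost], rfl⟩ ?_ (T₂ := N * (T + 30) + 20)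
      (by omega)
    rintro _ rfl _
    refine key.imp (fun s' h _ => h.2) ?_
    simp only [Test.cost, NExp.cost]
    have : N * (T + 6 + (1 + 1 + 1 + 1 + b.cost + 1) + 1) ≤ N * (T + 30) :=
      Nat.mul_le_mul_left _ (by omega)
    omega
  · rintro i s' hi hf ⟨hvi, hI⟩
    have hF : Frame (RealRAM.forTo v b p) s s' := hW.trans (hf.weaken
      (fun a ha => by simp_all [RealRAM.forTo, Cmd.writesNat])
      (fun a ha => by simp_all [RealRAM.forTo, Cmd.writesReal]))
    refine ⟨?_, ?_⟩
    · simp only [Test.eval, NExp.eval, hb s' hF, hvi]; omega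
    · refine Spec.seq (hstep i s' hi hvi hF hI) (T₂ := 6) (fun s₁ h₁ hf₁ => ?_) le_rfl
      have h : s₁.nat v 0 = i := by rw [hf₁.nat v hv, hvi]
      refine ⟨_, _, .setNat _ _ _ _, by simp [NExp.cost], ?_⟩
      simp only [NExp.eval, h]
      exact ⟨by simp, h₁⟩
  · rintro s' hf ⟨hvi, hI⟩
    have hF : Frame (RealRAM.forTo v b p) s s' := hW.trans (hf.weaken
      (fun a ha => by simp_all [RealRAM.forTo, Cmd.writesNat])
      (fun a ha => by simp_all [RealRAM.forTo, Cmd.writesReal]))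
    simp only [Test.eval, NExp.eval, hb s' hF, hvi]; omega

/-! ### Loop-free programs -/

/-- Does the program contain no loop? -/
def Cmd.loopFree : Cmd → Bool
  | .seq p q => p.loopFree && q.loopFree
  | .ite _ p q => p.loopFree && q.loopFree
  | .loop _ _ => false
  | _ => true

/-- The final state of a loop-free program. -/
@[simp] noncomputable def Cmd.exec : Cmd → State → State
  | .skip, s => s
  | .setNat a i e, s => s.setNat a (i.eval s) (e.eval s)
  | .setReal a i e, s => s.setReal a (i.eval s) (e.eval s)
  | .seq p q, s => q.exec (p.exec s)
  | .ite b p q, s => open Classical in if b.eval s then p.exec s else q.exec s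
  | .loop _ _, s => s

/-- An upper bound for the running time of a loop-free program. -/
@[simp] def Cmd.maxCost : Cmd → ℕ
  | .skip => 1
  | .setNat _ i e => i.cost + e.cost + 1
  | .setReal _ i e => i.cost + e.cost + 1
  | .seq p q => p.maxCost + q.maxCost
  | .ite b p q => b.cost + 1 + (p.maxCost + q.maxCost)
  | .loop _ _ => 0

/-- Straight-line code is simply executed by `simp`. The cost of a conditional is bounded by the sum
of both branches, which keeps the bound independent of the state. -/
theorem Spec.block {p : Cmd} {s : State} {T : ℕ} {Q : State → Prop} (hp : p.loopFree = true)
    (hT : p.maxCost ≤ T) (hQ : Q (p.exec s)) : Spec p s T Q := by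
  suffices H : ∃ t, Run p s t (p.exec s) ∧ t ≤ p.maxCost by
    obtain ⟨t, h, ht⟩ := H
    exact ⟨t, _, h, ht.trans hT, hQ⟩
  clear hT hQ
  induction p generalizing s with
  | skip => exact ⟨_, .skip s, by simp⟩
  | setNat a i e => exact ⟨_, .setNat s a i e, by simp⟩
  | setReal a i e => exact ⟨_, .setReal s a i e, by simp⟩
  | seq p q ih ih' =>
    simp only [Cmd.loopFree, Bool.and_eq_true] at hp
    obtain ⟨t, h, ht⟩ := ih (s := s) hp.1
    obtain ⟨t', h', ht'⟩ := ih' (s := p.exec s) hp.2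
    exact ⟨_, .seq h h', by simp; omega⟩
  | ite b p q ih ih' =>
    simp only [Cmd.loopFree, Bool.and_eq_true] at hp
    obtain ⟨t, h, ht⟩ := ih (s := s) hp.1
    obtain ⟨t', h', ht'⟩ := ih' (s := s) hp.2
    by_cases hb : b.eval s
    · refine ⟨_, by simpa [hb] using Run.iteTrue hb h, by simp; omega⟩
    · refine ⟨_, by simpa [hb] using Run.iteFalse hb h', by simp; omega⟩
  | loop b p _ => simp [Cmd.loopFree] at hp

attribute [simp] NExp.cost RExp.cost Test.cost

end RealRAM

/-! ### The subroutines of the algorithm and their specifications. -/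

namespace SumOfRadii

open RealRAM

/-! ### The constants of a run -/

/-- The numbers that are fixed once the input has been read: `L` is the length of a guess, `root`
the least integer with `d ≤ root ^ 2`, `K` is `max 2 (k / ε)`, and `pt` holds the coordinates of
the points, row by row. -/
structure Params where
  n : ℕ
  d : ℕ
  k : ℕ
  U : ℕ
  L : ℕ
  root : ℕ
  K : ℝ
  pt : ℕ → ℝ

/-- The part of the memory that is written only before the search starts. -/
structure Env (X : Params) (s : State) : Prop where
  n_eq : s.nat 0 0 = X.n
  d_eq : s.nat 0 1 = X.d
  k_eq : s.nat 0 2 = X.k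
  U_eq : s.nat 0 3 = X.U
  rowD : ∀ i < X.n + X.k, s.nat 3 i = i * X.d
  rowK : ∀ i < X.n, s.nat 4 i = i * X.k
  pow : ∀ i ≤ 3 * X.L, s.nat 5 i = 2 ^ i
  L_eq : s.nat 6 0 = X.L
  L3_eq : s.nat 6 1 = 3 * X.L
  root_eq : s.nat 6 2 = X.root
  e_eq : s.nat 6 5 = X.d + X.k + 1
  pt_eq : s.real 1 = X.pt
  K_eq : s.real 4 0 = X.K

/-- Does the program leave the constants alone? -/
def _root_.RealRAM.Cmd.keepsEnv (p : Cmd) : Bool :=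
  !p.writesNat 0 && !p.writesNat 3 && !p.writesNat 4 && !p.writesNat 5 && !p.writesNat 6 &&
    !p.writesReal 1 && !p.writesReal 4

theorem Env.frame {X : Params} {p : Cmd} {s s' : State} (h : Env X s) (hf : Frame p s s')
    (hp : p.keepsEnv = true) : Env X s' := by
  simp only [Cmd.keepsEnv, Bool.and_eq_true, Bool.not_eq_true'] at hp
  obtain ⟨⟨⟨⟨⟨⟨h0, h3⟩, h4⟩, h5⟩, h6⟩, h1⟩, h4'⟩ := hp
  replace h0 := hf.nat _ h0
  replace h3 := hf.nat _ h3
  replace h4 := hf.nat _ h4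
  replace h5 := hf.nat _ h5
  replace h6 := hf.nat _ h6
  replace h1 := hf.real _ h1
  replace h4' := hf.real _ h4'
  constructor <;> simp only [h0, h3, h4, h5, h6, h1, h4']
  exacts [h.n_eq, h.d_eq, h.k_eq, h.U_eq, h.rowD, h.rowK, h.pow, h.L_eq, h.L3_eq, h.root_eq,
    h.e_eq, h.pt_eq, h.K_eq]

/-! ### Squared distances and the table of covered points -/

/-- Put the squared distance of the vector at position `oa` of the real array `A` and the vector at
position `ob` of the real array `B` into the real variable `12`. -/
def distSqCmd (A B : ℕ) (oa ob : NExp) : Cmd :=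
  .seq (.setReal 12 (.lit 0) (.cast (.lit 0)))
    (forTo 28 (.get 0 (.lit 1)) (.setReal 12 (.lit 0) (.add (rvar 12)
      (.mul (.sub (.get A (.add oa (var 28))) (.get B (.add ob (var 28))))
        (.sub (.get A (.add oa (var 28))) (.get B (.add ob (var 28))))))))

/-- The square of the distance of two vectors of length `d` stored in arrays. -/
def sqDist (d : ℕ) (A : ℕ → ℝ) (i : ℕ) (B : ℕ → ℝ) (j : ℕ) : ℝ :=
  ∑ c ∈ Finset.range d, (A (i + c) - B (j + c)) * (A (i + c) - B (j + c))

/-- The offsets are expressions evaluated anew in each round, so their values must not depend on the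
loop counter, variable 28. -/
theorem distSqCmd_spec {X : Params} {s : State} (hE : Env X s) {A B : ℕ} {oa ob : NExp}
    (hA : A ≠ 12) (hB : B ≠ 12)
    (hoa : ∀ s' : State, (∀ a, a ≠ 28 → s'.nat a = s.nat a) → oa.eval s' = oa.eval s)
    (hob : ∀ s' : State, (∀ a, a ≠ 28 → s'.nat a = s.nat a) → ob.eval s' = ob.eval s)
    (ha : oa.cost ≤ 6) (hb : ob.cost ≤ 6) :
    Spec (distSqCmd A B oa ob) s (X.d * 90 + 40) fun s' =>
      s'.real 12 0 = sqDist X.d (s.real A) (oa.eval s) (s.real B) (ob.eval s) := by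
  refine Spec.seq (T₁ := 4) (R := fun s' => s' = s.setReal 12 0 0)
    (.block rfl (by simp) (by simp)) (T₂ := X.d * 90 + 30) ?_ (by omega)
  rintro s₁ rfl -
  refine (Spec.forTo (T := 60) X.d
    (fun i s' => s'.real 12 0 = sqDist i (s.real A) (oa.eval s) (s.real B) (ob.eval s))
    rfl ?_ (by simp) ?_ ?_ le_rfl)
  · intro s' hf
    simp only [NExp.eval, hf.nat 0 rfl]
    exact hE.d_eq
  · simp [sqDist]
  · intro i s' hi hv hf hI
    refine .block rfl (by simp; omega) ?_
    have hn : ∀ a, a ≠ 28 → s'.nat a = s.nat a := fun a ha =>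
      hf.nat a (by simp [forTo, Cmd.writesNat]; tauto)
    have hr : ∀ a, a ≠ 12 → s'.real a = s.real a := fun a ha => by
      rw [hf.real a (by simp [forTo, Cmd.writesReal]; tauto)]; simp [ha]
    simp [hI, hv, hoa s' hn, hob s' hn, hr A hA, hr B hB, sqDist, Finset.sum_range_succ]

/-- Point `p` lies in ball `i`, for centres `C` and radii `ρ` stored in arrays. -/
def Covers (X : Params) (C ρ : ℕ → ℝ) (p i : ℕ) : Prop :=
  sqDist X.d X.pt (p * X.d) C (i * X.d) ≤ ρ i * ρ i

/-- Write the table of covered points to the integer array `25`. -/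
def coverCmd (A B : ℕ) : Cmd :=
  forTo 26 (.get 0 (.lit 0)) (forTo 27 (.get 0 (.lit 2))
    (.seq (distSqCmd 1 A (.get 3 (var 26)) (.get 3 (var 27)))
      (.ite (.rle (rvar 12) (.mul (.get B (var 27)) (.get B (var 27))))
        (.setNat 25 (.add (.get 4 (var 26)) (var 27)) (.lit 1))
        (.setNat 25 (.add (.get 4 (var 26)) (var 27)) (.lit 0)))))

/-- The table `f` (row length `k`) is the characteristic function of `G`. -/
def IsTable (n k : ℕ) (f : ℕ → ℕ) (G : ℕ → ℕ → Prop) : Prop :=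
  ∀ p < n, ∀ i < k, f (p * k + i) ≤ 1 ∧ (f (p * k + i) = 1 ↔ G p i)

theorem index_inj {k p i p' i' : ℕ} (hi : i < k) (hi' : i' < k) :
    p' * k + i' = p * k + i ↔ p' = p ∧ i' = i := by
  constructor
  · intro h
    have h1 : (p' * k + i') / k = p' := by
      rw [mul_comm, Nat.mul_add_div (by omega), Nat.div_eq_of_lt hi', add_zero]
    have h2 : (p * k + i) / k = p := by
      rw [mul_comm, Nat.mul_add_div (by omega), Nat.div_eq_of_lt hi, add_zero]
    have : p' = p := by rw [← h1, ← h2, h]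
    subst this
    exact ⟨rfl, by omega⟩
  · rintro ⟨rfl, rfl⟩; rfl

/-- The number of steps of `coverCmd`. -/
def coverTime (n d k : ℕ) : ℕ := n * (k * (d * 90 + 130) + 60) + 30

theorem coverCmd_spec {X : Params} {s : State} (hE : Env X s) {A B : ℕ} (hA : A ≠ 12)
    (hB : B ≠ 12) :
    Spec (coverCmd A B) s (coverTime X.n X.d X.k) fun s' =>
      IsTable X.n X.k (s'.nat 25) (Covers X (s.real A) (s.real B)) := by
  set G := Covers X (s.real A) (s.real B) with hG
  refine (Spec.forTo (T := X.k * (X.d * 90 + 130) + 30) X.n (fun p s' => ∀ p' < p, ∀ i < X.k,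
    s'.nat 25 (p' * X.k + i) ≤ 1 ∧ (s'.nat 25 (p' * X.k + i) = 1 ↔ G p' i))
    rfl ?_ (by simp) (by simp) ?_ (by rw [coverTime]))
  · intro s' hf
    simp only [NExp.eval, hf.nat 0 rfl]
    exact hE.n_eq
  · intro p s₁ hp hv hf hI
    have hE₁ := hE.frame hf rfl
    refine (Spec.forTo (T := X.d * 90 + 100) X.k (fun i s' => ∀ p' ≤ p, ∀ i' < X.k,
      (p' < p ∨ i' < i) →
      s'.nat 25 (p' * X.k + i') ≤ 1 ∧ (s'.nat 25 (p' * X.k + i') = 1 ↔ G p' i'))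
      rfl ?_ (by simp) ?_ ?_ le_rfl).imp ?_ le_rfl
    · intro s' hf
      simp only [NExp.eval, hf.nat 0 rfl]
      exact hE₁.k_eq
    · intro p' hp' i' hi' h
      simpa using hI p' (by omega) i' hi'
    · intro i s₂ hi hv₂ hf₂ hI₂
      have hE₂ := hE₁.frame hf₂ rfl
      have hv26 : s₂.nat 26 0 = p := by rw [hf₂.nat 26 rfl, hv]
      have hd₁ := hE₂.rowD p (by omega)
      have hd₂ := hE₂.rowD i (by omega)
      have hk := hE₂.rowK p hp
      refine Spec.seq (distSqCmd_spec hE₂ (by decide) hA ?_ ?_ (by simp) (by simp)) (T₂ := 50) ?_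
        (by omega)
      · intro s' h
        simp [h]
      · intro s' h
        simp [h]
      · intro s₃ h₃ hf₃
        have h25 : s₃.nat 25 = s₂.nat 25 := hf₃.nat 25 rfl
        have h26 : s₃.nat 26 = s₂.nat 26 := hf₃.nat 26 rfl
        have h27 : s₃.nat 27 = s₂.nat 27 := hf₃.nat 27 rfl
        have h4 : s₃.nat 4 = s₂.nat 4 := hf₃.nat 4 rfl
        have hrA : s₂.real A = s.real A := by
          rw [hf₂.real A, hf.real A] <;>
            simp [forTo, distSqCmd, Cmd.writesReal] <;> tauto
        have hrB : s₃.real B = s.real B := by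
          rw [hf₃.real B, hf₂.real B, hf.real B] <;>
            simp [forTo, distSqCmd, Cmd.writesReal] <;> tauto
        have hg : s₃.real 12 0 ≤ s₃.real B i * s₃.real B i ↔ G p i := by
          rw [h₃, hG, Covers, hrA, hrB]
          simp [hv26, hv₂, hd₁, hd₂, hE₂.pt_eq]
        -- Writing one entry extends the completed part of the table by one position; `index_inj`
        -- ensures that no other entry is overwritten.
        have key : ∀ (b : ℕ), b ≤ 1 → (b = 1 ↔ G p i) → ∀ p' ≤ p, ∀ i' < X.k,
            (p' < p ∨ i' ≤ i) →
            Function.update (s₂.nat 25) (p * X.k + i) b (p' * X.k + i') ≤ 1 ∧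
            (Function.update (s₂.nat 25) (p * X.k + i) b (p' * X.k + i') = 1 ↔ G p' i') := by
          intro b hb hbG p' hp' i' hi' h
          rw [Function.update_apply]
          simp only [index_inj hi hi']
          split_ifs with hc
          · obtain ⟨rfl, rfl⟩ := hc
            exact ⟨hb, hbG⟩
          · exact hI₂ p' hp' i' hi' (by omega)
        refine .block rfl (by simp) ?_
        have hx : s₃.nat 4 (s₃.nat 26 0) + s₃.nat 27 0 = p * X.k + i := by
          rw [h4, h26, h27, hv26, hv₂, hk]
        by_cases hb : G p i
        · have := hg.2 hb
          rw [show i = s₃.nat 27 0 by rw [h27, hv₂]] at this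
          simp [this, hx, h25]
          exact key 1 le_rfl (by simpa)
        · have := mt hg.1 hb
          rw [show i = s₃.nat 27 0 by rw [h27, hv₂]] at this
          simp [this, hx, h25]
          exact key 0 (by omega) (by simpa)
    · intro s' h _ p' hp' i hi
      simpa using h p' (by omega) i hi (by omega)
  
/-! ### Binary digits -/

/-- Write the `len` lowest binary digits of the value of `x` to the integer array `17`. -/
def bitsCmd (len x : NExp) : Cmd :=
  .seq (.setNat 15 (.lit 0) x) (forTo 16 len
    (.ite (.nle (.get 5 (.sub len (.add (var 16) (.lit 1)))) (var 15))
      (.seq (.setNat 15 (.lit 0) (.sub (var 15) (.get 5 (.sub len (.add (var 16) (.lit 1))))))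
        (.setNat 17 (.sub len (.add (var 16) (.lit 1))) (.lit 1)))
      (.setNat 17 (.sub len (.add (var 16) (.lit 1))) (.lit 0))))

/-- The number of steps of `bitsCmd`. -/
def bitsTime (l : ℕ) : ℕ := l * 130 + 50

/-- The machine cannot divide natural numbers, so digits are peeled off from the top with stored
powers of two: after `i` rounds variable 15 holds the value modulo `2 ^ (l - i)`. -/
theorem bitsCmd_spec {X : Params} {s : State} (hE : Env X s) {len x : NExp} {l : ℕ}
    (hlen : ∀ s' : State, s'.nat 0 = s.nat 0 → s'.nat 6 = s.nat 6 → len.eval s' = l)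
    (hl : l ≤ 3 * X.L) (hx : x.eval s < 2 ^ l) (hc : len.cost ≤ 4) (hc' : x.cost ≤ 4) :
    Spec (bitsCmd len x) s (bitsTime l) fun s' =>
      ∀ t < l, s'.nat 17 t = x.eval s / 2 ^ t % 2 := by
  refine Spec.seq (T₁ := 10) (R := fun s' => s' = s.setNat 15 0 (x.eval s))
    (.block rfl (by simp; omega) (by simp)) (T₂ := l * 130 + 30) ?_ (by rw [bitsTime]; omega)
  rintro s₁ rfl -
  set N := x.eval s
  refine (Spec.forTo (T := 100) l (fun i s' => s'.nat 15 0 = N % 2 ^ (l - i) ∧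
    ∀ t < l, l - i ≤ t → s'.nat 17 t = N / 2 ^ t % 2) rfl ?_ (by omega) ?_ ?_ le_rfl).imp ?_ le_rfl
  · intro s' hf
    exact hlen s' (by rw [hf.nat 0 rfl]; rfl) (by rw [hf.nat 6 rfl]; rfl)
  · refine ⟨?_, fun t ht h => by omega⟩
    simp [Nat.mod_eq_of_lt hx]
  · rintro i s' hi hv hf ⟨h15, h17⟩
    have hle : len.eval s' = l := hlen s' (by rw [hf.nat 0 rfl]; rfl) (by rw [hf.nat 6 rfl]; rfl)
    have h5 : s'.nat 5 (l - (i + 1)) = 2 ^ (l - (i + 1)) := by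
      rw [hf.nat 5 rfl]
      exact hE.pow _ (by omega)
    obtain ⟨j, rfl⟩ : ∃ j, l = j + (i + 1) := ⟨l - (i + 1), by omega⟩
    have e1 : j + (i + 1) - i = j + 1 := by omega
    simp only [Nat.add_sub_cancel, e1] at h5 h15 h17 ⊢
    -- Since the last summand is below `2 ^ j`, comparing the remainder with `2 ^ j` reveals digit
    -- `j`.
    have hdig : N % 2 ^ (j + 1) = 2 ^ j * (N / 2 ^ j % 2) + N % 2 ^ j := by
      rw [pow_succ, Nat.mod_mul]; omega
    have hlt : N % 2 ^ j < 2 ^ j := Nat.mod_lt _ (by positivity)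
    refine .block rfl (by simp; omega) ?_
    rcases Nat.mod_two_eq_zero_or_one (N / 2 ^ j) with h0 | h1
    · rw [h0] at hdig
      have : ¬ 2 ^ j ≤ s'.nat 15 0 := by omega
      simp [hle, hv, h5, this]
      refine ⟨by omega, fun t ht h => ?_⟩
      rw [Function.update_apply]
      split_ifs with ht'
      · rw [ht', h0]
      · exact h17 t ht (by omega)
    · rw [h1] at hdig
      have : 2 ^ j ≤ s'.nat 15 0 := by omega
      have hle' := hlen (s'.setNat 15 0 (s'.nat 15 0 - 2 ^ j))
        (by simp [hf.nat 0 rfl]) (by simp [hf.nat 6 rfl])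
      simp [hle, hle', hv, h5, this]
      refine ⟨by omega, fun t ht h => ?_⟩
      rw [Function.update_apply]
      split_ifs with ht'
      · rw [ht', h1]
      · exact h17 t ht (by omega)
  · rintro s' ⟨-, h⟩ _ t ht
    exact h t ht (by omega)

end SumOfRadii

namespace SumOfRadii

open RealRAM

/-! ### Hall's condition for capacitated assignments -/

/-- Some assignment of `n` points to `k` balls respects `G` and the capacity `U`. -/
def Feasible (n k U : ℕ) (G : ℕ → ℕ → Prop) : Prop :=
  ∃ f : ℕ → ℕ, (∀ p < n, f p < k ∧ G p (f p)) ∧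
    ∀ i < k, ((Finset.range n).filter fun p => f p = i).card ≤ U

theorem exists_binary (k : ℕ) (b : ℕ → Bool) :
    ∃ x < 2 ^ k, ∀ t < k, x / 2 ^ t % 2 = if b t then 1 else 0 := by
  induction k with
  | zero => exact ⟨0, by simp, by simp⟩
  | succ k ih =>
    obtain ⟨x, hx, h⟩ := ih
    refine ⟨x + 2 ^ k * (if b k then 1 else 0), ?_, fun t ht => ?_⟩
    · rw [pow_succ]; split_ifs <;> omega
    · rcases Nat.lt_succ_iff_lt_or_eq.1 ht with ht | rfl
      · obtain ⟨m, rfl⟩ : ∃ m, k = t + (m + 1) := ⟨k - t - 1, by omega⟩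
        rw [← h t ht, pow_add, mul_assoc, Nat.add_mul_div_left _ _ (by positivity), pow_succ,
          mul_comm _ 2, mul_assoc, Nat.add_mul_mod_self_left]
      · rw [Nat.add_mul_div_left _ _ (by positivity), Nat.div_eq_of_lt hx]
        split_ifs <;> simp

/-- Necessity is counting. For sufficiency, replace each ball by `U` slots and apply the marriage
theorem to the points; only those sets of balls matter that arise as the neighbourhood of a set of
points. -/
theorem feasible_iff_hall (n k U : ℕ) (G : ℕ → ℕ → Prop) :
    Feasible n k U G ↔ ∀ S ⊆ Finset.range k, open Classical in
      ((Finset.range n).filter fun p => ∀ i < k, G p i → i ∈ S).card ≤ U * S.card := by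
  classical
  constructor
  · rintro ⟨f, hf, hU⟩ S hS
    refine Finset.card_le_mul_card_image_of_maps_to (f := f) (fun p hp => ?_) U (fun i hi => ?_)
    · simp only [Finset.mem_filter, Finset.mem_range] at hp
      exact hp.2 _ (hf p hp.1).1 (hf p hp.1).2
    · refine (Finset.card_le_card ?_).trans (hU i (Finset.mem_range.1 (hS hi)))
      intro p hp
      simp only [Finset.mem_filter] at hp ⊢
      exact ⟨hp.1.1, hp.2⟩
  · intro h
    let t : Fin n → Finset (ℕ × ℕ) := fun p =>
      ((Finset.range k).filter fun i => G p i) ×ˢ Finset.range U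
    have hall : ∀ A : Finset (Fin n), A.card ≤ (A.biUnion t).card := by
      intro A
      let S : Finset ℕ := A.biUnion fun p => (Finset.range k).filter fun i => G p i
      have hS : S ⊆ Finset.range k := by
        intro i hi
        simp only [S, Finset.mem_biUnion, Finset.mem_filter] at hi
        obtain ⟨p, -, hi, -⟩ := hi
        exact hi
      have e : A.biUnion t = S ×ˢ Finset.range U := by
        ext ⟨i, j⟩
        simp only [t, S, Finset.mem_biUnion, Finset.mem_product, Finset.mem_filter]
        constructor
        · rintro ⟨p, hp, hi, hj⟩; exact ⟨⟨p, hp, hi⟩, hj⟩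
        · rintro ⟨⟨p, hp, hi⟩, hj⟩; exact ⟨p, hp, hi, hj⟩
      rw [e, Finset.card_product, Finset.card_range, mul_comm]
      refine le_trans ?_ (h S hS)
      rw [← Finset.card_map Fin.valEmbedding]
      refine Finset.card_le_card fun p hp => ?_
      simp only [Finset.mem_map, Fin.valEmbedding_apply] at hp
      obtain ⟨p, hp, rfl⟩ := hp
      simp only [Finset.mem_filter, Finset.mem_range, p.2, true_and, S, Finset.mem_biUnion]
      exact fun i hi hG => ⟨p, hp, hi, hG⟩
    obtain ⟨g, hg, hgt⟩ := (Finset.all_card_le_biUnion_card_iff_exists_injective t).1 hall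
    have hgt' : ∀ p, ((g p).1 < k ∧ G p (g p).1) ∧ (g p).2 < U := fun p => by
      simpa [t, Finset.mem_product] using hgt p
    refine ⟨fun p => if hp : p < n then (g ⟨p, hp⟩).1 else 0, fun p hp => ?_, fun i _ => ?_⟩
    · simp only [hp, dif_pos]
      exact (hgt' ⟨p, hp⟩).1
    · rw [← Finset.card_range U]
      -- Points given to the same ball occupy different slots, so the slot number embeds them into
      -- `range U`.
      refine Finset.card_le_card_of_injOn (fun p => if hp : p < n then (g ⟨p, hp⟩).2 else 0) ?_ ?_
      · intro p hp
        simp only [Finset.coe_filter, Finset.mem_range, Set.mem_ofPred_eq] at hp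
        simp only [hp.1, dif_pos, Finset.coe_range, Set.mem_Iio]
        exact (hgt' ⟨p, hp.1⟩).2
      · intro p hp p' hp' e
        simp only [Finset.coe_filter, Finset.mem_range, Set.mem_ofPred_eq] at hp hp'
        obtain ⟨h1, h2⟩ := hp
        obtain ⟨h1', h2'⟩ := hp'
        simp only [h1, h1', dif_pos] at h2 h2' e
        have := hg (Prod.ext (h2.trans h2'.symm) e)
        simpa using this

/-- Hall's condition for the set of balls encoded by the binary digits of `x`. -/
def HallAt (n k U : ℕ) (G : ℕ → ℕ → Prop) (x : ℕ) : Prop := open Classical in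
  (∑ p ∈ Finset.range n, if ∀ i < k, G p i → x / 2 ^ i % 2 = 1 then 1 else 0) ≤
    ∑ i ∈ Finset.range k, if x / 2 ^ i % 2 = 1 then U else 0

/-- Subsets of the balls become numbers below `2 ^ k`, and cardinalities become the sums that the
loops accumulate; on the machine `U * S.card` is formed by repeated addition. -/
theorem feasible_iff_hallAt (n k U : ℕ) (G : ℕ → ℕ → Prop) :
    Feasible n k U G ↔ ∀ x < 2 ^ k, HallAt n k U G x := by
  classical
  rw [feasible_iff_hall]
  have key : ∀ x : ℕ, ∀ S ⊆ Finset.range k, (∀ i < k, x / 2 ^ i % 2 = 1 ↔ i ∈ S) →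
      (((Finset.range n).filter fun p => ∀ i < k, G p i → i ∈ S).card ≤ U * S.card ↔
        HallAt n k U G x) := by
    intro x S hS h
    have h1 : ∀ p, (∀ i < k, G p i → x / 2 ^ i % 2 = 1) ↔ ∀ i < k, G p i → i ∈ S := fun p =>
      ⟨fun H i hi hG => (h i hi).1 (H i hi hG), fun H i hi hG => (h i hi).2 (H i hi hG)⟩
    have h2 : (Finset.range k).filter (fun i => x / 2 ^ i % 2 = 1) = S := by
      ext i
      simp only [Finset.mem_filter, Finset.mem_range]
      exact ⟨fun H => (h i H.1).1 H.2, fun H =>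
        ⟨Finset.mem_range.1 (hS H), (h i (Finset.mem_range.1 (hS H))).2 H⟩⟩
    rw [HallAt, ← Finset.sum_filter, ← Finset.sum_filter, h2, Finset.sum_const, Finset.sum_const,
      smul_eq_mul, smul_eq_mul, mul_one, mul_comm U]
    simp only [h1]
  constructor
  · intro H x _
    refine (key x ((Finset.range k).filter fun i => x / 2 ^ i % 2 = 1)
      (Finset.filter_subset _ _) (fun i hi => ?_)).1 (H _ (Finset.filter_subset _ _))
    simp [hi]
  · intro H S hS
    obtain ⟨x, hx, h⟩ := exists_binary k (fun i => decide (i ∈ S))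
    refine (key x S hS (fun i hi => ?_)).2 (H x hx)
    rw [h i hi]
    by_cases hS : i ∈ S <;> simp [hS]

/-- Set the integer variable `42` to `1` if the table in array `25` admits an assignment, and to
`0` otherwise. -/
def hallCmd : Cmd :=
  .seq (.setNat 42 (.lit 0) (.lit 1)) (forTo 36 (.get 5 (.get 0 (.lit 2)))
    (.seq (bitsCmd (.get 0 (.lit 2)) (var 36)) <|
    .seq (.setNat 37 (.lit 0) (.lit 0)) <|
    .seq (forTo 40 (.get 0 (.lit 2)) (.ite (.nle (.lit 1) (.get 17 (var 40)))
      (.setNat 37 (.lit 0) (.add (var 37) (.get 0 (.lit 3)))) .skip)) <|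
    .seq (.setNat 38 (.lit 0) (.lit 0)) <|
    .seq (forTo 39 (.get 0 (.lit 0))
      (.seq (.setNat 41 (.lit 0) (.lit 1)) <|
      .seq (forTo 40 (.get 0 (.lit 2))
        (.ite (.and (.nle (.lit 1) (.get 25 (.add (.get 4 (var 39)) (var 40))))
          (.nle (.get 17 (var 40)) (.lit 0))) (.setNat 41 (.lit 0) (.lit 0)) .skip)) <|
      .setNat 38 (.lit 0) (.add (var 38) (var 41)))) <|
    .ite (.nle (var 38) (var 37)) .skip (.setNat 42 (.lit 0) (.lit 0))))

/-- The number of steps of `hallCmd`. -/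
def hallTime (n k : ℕ) : ℕ :=
  2 ^ k * (k * 130 + 50 + (k * 70 + 30) + (n * (k * 80 + 80 + 30) + 30) + 100) + 50

theorem hallCmd_spec {X : Params} {s : State} (hE : Env X s) (hk : X.k ≤ 3 * X.L)
    {G : ℕ → ℕ → Prop} (hG : IsTable X.n X.k (s.nat 25) G) :
    Spec hallCmd s (hallTime X.n X.k) fun s' =>
      s'.nat 42 0 ≤ 1 ∧ (s'.nat 42 0 = 1 ↔ Feasible X.n X.k X.U G) := by
  classical
  have hlen : ∀ s' : State, s'.nat 0 = s.nat 0 → (NExp.get 0 (.lit 2)).eval s' = X.k := by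
    intro s' h
    simp only [NExp.eval, h]
    exact hE.k_eq
  refine Spec.seq (T₁ := 3) (R := fun s' => s' = s.setNat 42 0 1)
    (.block rfl (by simp) (by simp)) (T₂ := 2 ^ X.k * (X.k * 130 + 50 + (X.k * 70 + 30) +
      (X.n * (X.k * 80 + 80 + 30) + 30) + 100) + 30) ?_ (by rw [hallTime]; omega)
  rintro s₁ rfl -
  refine (Spec.forTo (T := X.k * 130 + 50 + (X.k * 70 + 30) +
      (X.n * (X.k * 80 + 80 + 30) + 30) + 70) (2 ^ X.k) (fun x s' => s'.nat 42 0 =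
      if ∀ x' < x, HallAt X.n X.k X.U G x' then 1 else 0) rfl ?_ (by simp) (by simp) ?_
      le_rfl).imp ?_ le_rfl
  · intro s' hf
    have h0 : s'.nat 0 = s.nat 0 := by rw [hf.nat 0 rfl]; rfl
    have h5 : s'.nat 5 = s.nat 5 := by rw [hf.nat 5 rfl]; rfl
    have := hlen s' h0
    simp only [NExp.eval] at this ⊢
    rw [this, h5, hE.pow _ hk]
  · intro x s₂ hx hv hf₂ hI
    have h0₂ : s₂.nat 0 = s.nat 0 := by rw [hf₂.nat 0 rfl]; rfl
    have h25₂ : s₂.nat 25 = s.nat 25 := by rw [hf₂.nat 25 rfl]; rfl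
    have hE₂ : Env X s₂ := (hE.frame (p := hallCmd) (s' := s₂)
      ⟨fun a ha => by
        have h42 : a ≠ 42 := by rintro rfl; simp [hallCmd, Cmd.writesNat] at ha
        rw [hf₂.nat a (by simp_all [hallCmd, Cmd.writesNat])]; simp [h42],
       fun a ha => hf₂.real a (by simp_all [hallCmd, Cmd.writesReal])⟩ rfl)
    refine Spec.seq (bitsCmd_spec hE₂ (len := .get 0 (.lit 2)) (x := var 36) (l := X.k)
      (fun s' h _ => hlen s' (h.trans h0₂)) hk (by simpa [hv] using hx) (by simp) (by simp))
      ?_ (T₂ := (X.k * 70 + 30) + (X.n * (X.k * 80 + 80 + 30) + 30) + 70) (by rw [bitsTime]; omega)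
    intro s₃ hb hf₃
    simp only [NExp.eval, hv] at hb
    have hE₃ := hE₂.frame hf₃ rfl
    have h42₃ : s₃.nat 42 = s₂.nat 42 := hf₃.nat 42 rfl
    have h25₃ : s₃.nat 25 = s.nat 25 := by rw [hf₃.nat 25 rfl, h25₂]
    refine Spec.seq (T₁ := 3) (R := fun s' => s' = s₃.setNat 37 0 0)
      (.block rfl (by simp) (by simp))
      (T₂ := (X.k * 70 + 30) + (X.n * (X.k * 80 + 80 + 30) + 30) + 60) ?_ (by omega)
    rintro s₄ rfl -
    refine Spec.seq (R := fun s' => s'.nat 37 0 =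
        ∑ i ∈ Finset.range X.k, if x / 2 ^ i % 2 = 1 then X.U else 0)
      (Spec.forTo (T := 40) X.k (fun i s' => s'.nat 37 0 =
        ∑ i ∈ Finset.range i, if x / 2 ^ i % 2 = 1 then X.U else 0) rfl ?_ (by simp) (by simp) ?_
        le_rfl) ?_ (T₂ := (X.n * (X.k * 80 + 80 + 30) + 30) + 60) (by omega)
    · intro s' hf
      simp only [NExp.eval, hf.nat 0 rfl]
      exact hE₃.k_eq
    · intro i s' hi hv' hf hI'
      refine .block rfl (by simp) ?_
      have h17 : s'.nat 17 i = x / 2 ^ i % 2 := by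
        rw [hf.nat 17 rfl, ← hb i hi]; rfl
      have hU : s'.nat 0 3 = X.U := by rw [hf.nat 0 rfl]; exact hE₃.U_eq
      rcases Nat.mod_two_eq_zero_or_one (x / 2 ^ i) with h | h <;>
        simp [hv', h17, h, hI', hU, Finset.sum_range_succ]
    intro s₅ h37 hf₅
    have h17₅ : ∀ t < X.k, s₅.nat 17 t = x / 2 ^ t % 2 := fun t ht => by
      rw [hf₅.nat 17 rfl, ← hb t ht]; rfl
    have h42₅ : s₅.nat 42 = s₂.nat 42 := by rw [hf₅.nat 42 rfl, ← h42₃]; rfl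
    have h25₅ : s₅.nat 25 = s.nat 25 := by rw [hf₅.nat 25 rfl, ← h25₃]; rfl
    have h0₅ : s₅.nat 0 = s₃.nat 0 := by rw [hf₅.nat 0 rfl]; rfl
    have h4₅ : s₅.nat 4 = s₃.nat 4 := by rw [hf₅.nat 4 rfl]; rfl
    clear hf₅ hf₃
    refine Spec.seq (T₁ := 3) (R := fun s' => s' = s₅.setNat 38 0 0)
      (.block rfl (by simp) (by simp)) (T₂ := (X.n * (X.k * 80 + 80 + 30) + 30) + 50) ?_ (by omega)
    rintro s₆ rfl -
    refine Spec.seq (R := fun s' => s'.nat 38 0 = ∑ p ∈ Finset.range X.n,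
        if ∀ i < X.k, G p i → x / 2 ^ i % 2 = 1 then 1 else 0)
      (Spec.forTo (T := X.k * 80 + 80) X.n (fun p s' => s'.nat 38 0 = ∑ p ∈ Finset.range p,
        if ∀ i < X.k, G p i → x / 2 ^ i % 2 = 1 then 1 else 0) rfl ?_ (by simp) (by simp) ?_
        le_rfl) ?_ (T₂ := 50) (by omega)
    · intro s' hf
      simp only [NExp.eval, hf.nat 0 rfl]
      exact (congrFun h0₅ 0).trans hE₃.n_eq
    · intro p s₇ hp hv₇ hf₇ hI₇
      refine Spec.seq (T₁ := 3) (R := fun s' => s' = s₇.setNat 41 0 1)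
        (.block rfl (by simp) (by simp)) (T₂ := X.k * 80 + 70) ?_ (by omega)
      rintro s₈ rfl -
      refine Spec.seq (R := fun s' => s'.nat 41 0 =
          if ∀ i < X.k, G p i → x / 2 ^ i % 2 = 1 then 1 else 0)
        (Spec.forTo (T := 50) X.k (fun j s' => s'.nat 41 0 =
          if ∀ i < j, G p i → x / 2 ^ i % 2 = 1 then 1 else 0) rfl ?_ (by simp) (by simp) ?_
          le_rfl) ?_ (T₂ := 20) (by omega)
      · intro s' hf
        simp only [NExp.eval, hf.nat 0 rfl]
        exact (congrFun ((hf₇.nat 0 rfl).trans h0₅) 2).trans hE₃.k_eq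
      · intro i s' hi hv' hf hI'
        refine .block rfl (by simp) ?_
        have h17 : s'.nat 17 i = x / 2 ^ i % 2 := by
          rw [hf.nat 17 rfl, ← h17₅ i hi, State.setNat_nat, if_neg (by decide), hf₇.nat 17 rfl]
          rfl
        have h4 : s'.nat 4 p = p * X.k := by
          rw [hf.nat 4 rfl, State.setNat_nat, if_neg (by decide), hf₇.nat 4 rfl]
          exact (congrFun h4₅ p).trans (hE₃.rowK p hp)
        have h39 : s'.nat 39 0 = p := by
          rw [hf.nat 39 rfl, State.setNat_nat, if_neg (by decide), hv₇]
        have h25 : s'.nat 25 = s.nat 25 := by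
          rw [hf.nat 25 rfl, State.setNat_nat, if_neg (by decide), hf₇.nat 25 rfl]
          exact h25₅
        obtain ⟨hle, hiff⟩ := hG p hp i hi
        have hiff' : 1 ≤ s.nat 25 (p * X.k + i) ↔ G p i := by rw [← hiff]; omega
        have hs : ∀ P : ℕ → Prop, (∀ j < i + 1, P j) ↔ (∀ j < i, P j) ∧ P i := fun P =>
          ⟨fun h => ⟨fun j hj => h j (by omega), h i (by omega)⟩, fun h j hj =>
            (Nat.lt_succ_iff_lt_or_eq.1 hj).elim (h.1 j) (fun e => e ▸ h.2)⟩
        simp only [hs]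
        by_cases hGi : G p i
        · rcases Nat.mod_two_eq_zero_or_one (x / 2 ^ i) with h | h
          · simp [hv', h39, h4, h25, h17, h, hiff', hGi]
          · simp [hv', h39, h4, h25, h17, h, hiff', hGi, hI']
        · simp [hv', h39, h4, h25, h17, hiff', hGi, hI']
      · intro s₉ h₉ hf₉
        refine .block rfl (by simp) ?_
        have h38 : s₉.nat 38 = s₇.nat 38 := by rw [hf₉.nat 38 rfl]; rfl
        rw [Finset.sum_range_succ, ← hI₇]
        simp [h₉, h38]
    · intro s₇ h₇ hf₇
      refine .block rfl (by simp) ?_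
      have h37₇ : s₇.nat 37 0 = _ := (congrFun ((hf₇.nat 37 rfl).trans (by rfl)) 0).trans h37
      have h42₇ : s₇.nat 42 0 = _ :=
        (congrFun ((hf₇.nat 42 rfl).trans (show _ = s₂.nat 42 from h42₅)) 0).trans hI
      have hs : (∀ j < x + 1, HallAt X.n X.k X.U G j) ↔
          (∀ j < x, HallAt X.n X.k X.U G j) ∧ HallAt X.n X.k X.U G x :=
        ⟨fun h => ⟨fun j hj => h j (by omega), h x (by omega)⟩, fun h j hj =>
            (Nat.lt_succ_iff_lt_or_eq.1 hj).elim (h.1 j) (fun e => e ▸ h.2)⟩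
      have hH : HallAt X.n X.k X.U G x ↔ s₇.nat 38 0 ≤ s₇.nat 37 0 := by
        rw [h₇, h37₇, HallAt]
      simp only [hs]
      by_cases hx' : s₇.nat 38 0 ≤ s₇.nat 37 0
      · simp [hx', hH, h42₇]
      · simp [hx', hH]
  · intro s' h _
    rw [feasible_iff_hallAt]
    rw [h]
    split_ifs with hc
    · exact ⟨le_rfl, fun _ => hc, fun _ => rfl⟩
    · exact ⟨by omega, fun h => absurd h (by decide), fun h => absurd h hc⟩

end SumOfRadii

namespace SumOfRadii

open RealRAM

/-! ### The machine that turns a guess into balls -/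

/-- The state of the machine: `m` balls have been placed, the next ball is located relative to the
centre of ball `q` or, if `q = m`, relative to the point `f`; the coordinates `< j` of its centre
have been determined, and `a` is an accumulator. -/
structure Machine where
  m : ℕ
  q : ℕ
  f : ℕ
  j : ℕ
  a : ℝ
  C : ℕ → ℝ
  ρ : ℕ → ℝ

/-- The last point `< p` that lies in none of the first `m` balls, or `f` if there is none. -/
noncomputable def lastUncovered (X : Params) (C ρ : ℕ → ℝ) (m f : ℕ) : ℕ → ℕ
  | 0 => f
  | p + 1 => open Classical in
    if ∃ i < m, Covers X C ρ p i then lastUncovered X C ρ m f p else p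

/-- One step of the machine, for the unit of length `u` of positions and the unit of length `δ` of
radii.  The instructions `0, 1, 2` append a digit to the accumulator, `3` stores a coordinate or a
radius, and `4` advances `q`. -/
noncomputable def Machine.step (X : Params) (δ u : ℝ) (v : Machine) (g : ℕ) : Machine :=
  if g ≤ 2 then { v with a := v.a + v.a + g - 1 }
  else if g = 3 then
    if v.m < X.k then
      if v.j < X.d then
        { v with
          C := Function.update v.C (v.m * X.d + v.j)
            ((if v.q < v.m then v.C (v.q * X.d + v.j) else X.pt (v.f * X.d + v.j)) + v.a * u)
          j := v.j + 1
          a := 0 }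
      else { v with ρ := Function.update v.ρ v.m (max (v.a * δ) 0), m := v.m + 1, j := 0, a := 0 }
    else v
  else if v.q < v.m then
    { v with q := v.q + 1, f := lastUncovered X v.C v.ρ v.m v.f X.n }
  else v

/-- The memory represents the machine `v`. -/
structure Sim (X : Params) (s : State) (v : Machine) : Prop where
  m_eq : s.nat 21 0 = v.m
  q_eq : s.nat 22 0 = v.q
  f_eq : s.nat 23 0 = v.f
  j_eq : s.nat 24 0 = v.j
  a_eq : s.real 9 0 = v.a
  C_eq : ∀ x < X.k * X.d, s.real 10 x = v.C x
  ρ_eq : ∀ i < X.k, s.real 11 i = v.ρ i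
  m_le : v.m ≤ X.k
  f_lt : v.f < X.n

theorem index_lt {k d i c : ℕ} (hi : i < k) (hc : c < d) : i * d + c < k * d :=
  calc i * d + c < (i + 1) * d := by rw [Nat.succ_mul]; omega
    _ ≤ k * d := Nat.mul_le_mul_right _ hi

/-- Memory and machine agree only on the cells that belong to one of the `k` rows, and coverage
reads no others. -/
theorem Covers.congr {X : Params} {C C' ρ ρ' : ℕ → ℝ} (hC : ∀ x < X.k * X.d, C x = C' x)
    (hρ : ∀ i < X.k, ρ i = ρ' i) {p i : ℕ} (hi : i < X.k) :
    Covers X C ρ p i ↔ Covers X C' ρ' p i := by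
  have : sqDist X.d X.pt (p * X.d) C (i * X.d) = sqDist X.d X.pt (p * X.d) C' (i * X.d) := by
    refine Finset.sum_congr rfl fun c hc => ?_
    rw [hC _ (index_lt hi (Finset.mem_range.1 hc))]
  rw [Covers, Covers, this, hρ i hi]

/-- Advance `q` and look for an uncovered point. -/
def advanceCmd : Cmd :=
  .seq (.setNat 22 (.lit 0) (.add (var 22) (.lit 1))) <|
  .seq (coverCmd 10 11) <|
  forTo 29 (.get 0 (.lit 0)) <|
    .seq (.setNat 31 (.lit 0) (.lit 0)) <|
    .seq (forTo 30 (var 21) (.ite (.nle (.lit 1) (.get 25 (.add (.get 4 (var 29)) (var 30))))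
      (.setNat 31 (.lit 0) (.lit 1)) .skip)) <|
    .ite (.nle (var 31) (.lit 0)) (.setNat 23 (.lit 0) (var 29)) .skip

/-- The number of steps of `advanceCmd`. -/
def advanceTime (n d k : ℕ) : ℕ := coverTime n d k + (n * (k * 60 + 100) + 50)

theorem lastUncovered_lt {X : Params} {C ρ : ℕ → ℝ} {m f : ℕ} (hf : f < X.n) (p : ℕ)
    (hp : p ≤ X.n) : lastUncovered X C ρ m f p < X.n := by
  induction p with
  | zero => exact hf
  | succ p ih =>
    rw [lastUncovered]
    split_ifs
    · exact ih (by omega)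
    · omega

theorem advanceCmd_spec {X : Params} {s : State} {v : Machine} (hE : Env X s) (hS : Sim X s v) :
    Spec advanceCmd s (advanceTime X.n X.d X.k) fun s' =>
      Sim X s' { v with q := v.q + 1, f := lastUncovered X v.C v.ρ v.m v.f X.n } := by
  classical
  refine Spec.seq (T₁ := 6) (R := fun s' => s' = s.setNat 22 0 (v.q + 1))
    (.block rfl (by simp) (by simp [hS.q_eq]))
    (T₂ := coverTime X.n X.d X.k + (X.n * (X.k * 60 + 100) + 30)) ?_
    (by rw [advanceTime]; omega)
  rintro s₁ rfl hf₁
  refine Spec.seq (coverCmd_spec (hE.frame hf₁ rfl) (by decide) (by decide))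
    (T₂ := X.n * (X.k * 60 + 100) + 30) ?_ le_rfl
  intro s₂ hT hf₂
  have hE₂ := (hE.frame hf₁ rfl).frame hf₂ rfl
  have h22 : s₂.nat 22 0 = v.q + 1 := by rw [hf₂.nat 22 rfl]; simp
  have h21 : s₂.nat 21 0 = v.m := by rw [hf₂.nat 21 rfl]; simpa using hS.m_eq
  have h23 : s₂.nat 23 0 = v.f := by rw [hf₂.nat 23 rfl]; simpa using hS.f_eq
  have h24 : s₂.nat 24 0 = v.j := by rw [hf₂.nat 24 rfl]; simpa using hS.j_eq
  have h9 : s₂.real 9 = s.real 9 := by rw [hf₂.real 9 rfl]; rfl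
  have h10 : s₂.real 10 = s.real 10 := by rw [hf₂.real 10 rfl]; rfl
  have h11 : s₂.real 11 = s.real 11 := by rw [hf₂.real 11 rfl]; rfl
  have hcov : ∀ p < X.n, ∀ i < X.k, 1 ≤ s₂.nat 25 (p * X.k + i) ↔ Covers X v.C v.ρ p i := by
    intro p hp i hi
    obtain ⟨h1, h2⟩ := hT p hp i hi
    rw [← Covers.congr hS.C_eq hS.ρ_eq hi]
    exact ⟨fun h => h2.1 (by omega), fun h => (h2.2 h).ge⟩
  clear hf₁ hT
  refine (Spec.forTo (T := X.k * 60 + 70) X.n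
    (fun p s' => s'.nat 23 0 = lastUncovered X v.C v.ρ v.m v.f p) rfl ?_ (by simp) ?_ ?_
    le_rfl).imp ?_ le_rfl
  · intro s' hf
    simp only [NExp.eval, hf.nat 0 rfl]
    exact hE₂.n_eq
  · simpa [lastUncovered] using h23
  · intro p s₃ hp hv₃ hf₃ hI₃
    refine Spec.seq (T₁ := 3) (R := fun s' => s' = s₃.setNat 31 0 0)
      (.block rfl (by simp) (by simp)) (T₂ := X.k * 60 + 60) ?_ (by omega)
    rintro s₄ rfl -
    refine Spec.seq (R := fun s' => s'.nat 31 0 =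
        if ∃ i < v.m, Covers X v.C v.ρ p i then 1 else 0)
      (Spec.forTo (T := 30) (T' := X.k * 60 + 30) v.m (fun j s' => s'.nat 31 0 =
        if ∃ i < j, Covers X v.C v.ρ p i then 1 else 0) rfl ?_ (by simp) (by simp) ?_
        (by have := Nat.mul_le_mul_right 60 hS.m_le; omega)) ?_ (T₂ := 20) (by omega)
    · intro s' hf
      simp only [NExp.eval, hf.nat 21 rfl]
      exact (congrFun (hf₃.nat 21 rfl) 0).trans h21
    · intro i s' hi hv' hf hI'
      refine .block rfl (by simp) ?_
      have hE' := ((hE₂.frame hf₃ rfl).frame (p := .setNat 31 (.lit 0) (.lit 0))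
        (s' := s₃.setNat 31 0 0) (Run.setNat s₃ 31 (.lit 0) (.lit 0)).frame rfl).frame hf rfl
      have h29 : s'.nat 29 0 = p := by
        rw [hf.nat 29 rfl, State.setNat_nat, if_neg (by decide), hv₃]
      have h25 : s'.nat 25 = s₂.nat 25 := by
        rw [hf.nat 25 rfl, State.setNat_nat, if_neg (by decide), hf₃.nat 25 rfl]
      have hs : (∃ j < i + 1, Covers X v.C v.ρ p j) ↔
          (∃ j < i, Covers X v.C v.ρ p j) ∨ Covers X v.C v.ρ p i := by
        constructor
        · rintro ⟨j, hj, h⟩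
          rcases Nat.lt_succ_iff_lt_or_eq.1 hj with hj | rfl
          · exact .inl ⟨j, hj, h⟩
          · exact .inr h
        · rintro (⟨j, hj, h⟩ | h)
          · exact ⟨j, by omega, h⟩
          · exact ⟨i, by omega, h⟩
      have hm := hS.m_le
      have hc := hcov p hp i (by omega)
      simp only [hs]
      by_cases hci : Covers X v.C v.ρ p i
      · simp [hv', h29, hE'.rowK p hp, h25, hc, hci]
      · simp [hv', h29, hE'.rowK p hp, h25, hc, hci, hI']
    · intro s₄ h₄ hf₄
      refine .block rfl (by simp) ?_
      have h23 : s₄.nat 23 = s₃.nat 23 := by rw [hf₄.nat 23 rfl]; rfl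
      have h29 : s₄.nat 29 = s₃.nat 29 := by rw [hf₄.nat 29 rfl]; rfl
      rw [lastUncovered]
      split_ifs at h₄ ⊢ with hc
      · simp [h₄, h23, hI₃]
      · simp [h₄, h29, hv₃]
  · intro s' h hf
    refine ⟨?_, ?_, h, ?_, ?_, ?_, ?_, hS.m_le, lastUncovered_lt hS.f_lt _ le_rfl⟩
    · rw [hf.nat 21 rfl, h21]
    · rw [hf.nat 22 rfl, h22]
    · rw [hf.nat 24 rfl, h24]
    · rw [hf.real 9 rfl, h9]; exact hS.a_eq
    · rw [hf.real 10 rfl, h10]; exact hS.C_eq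
    · rw [hf.real 11 rfl, h11]; exact hS.ρ_eq

/-- Store the accumulator as a coordinate or as a radius. -/
def storeCmd : Cmd :=
  .ite (.nle (.add (var 21) (.lit 1)) (.get 0 (.lit 2)))
    (.ite (.nle (.add (var 24) (.lit 1)) (.get 0 (.lit 1)))
      (.seq (.ite (.nle (.add (var 22) (.lit 1)) (var 21))
        (.setReal 10 (.add (.get 3 (var 21)) (var 24))
          (.add (.get 10 (.add (.get 3 (var 22)) (var 24))) (.mul (rvar 9) (rvar 7))))
        (.setReal 10 (.add (.get 3 (var 21)) (var 24))
          (.add (.get 1 (.add (.get 3 (var 23)) (var 24))) (.mul (rvar 9) (rvar 7))))) <|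
      .seq (.setNat 24 (.lit 0) (.add (var 24) (.lit 1))) <|
      .setReal 9 (.lit 0) (.cast (.lit 0)))
      (.seq (.ite (.rle (.cast (.lit 0)) (.mul (rvar 9) (rvar 6)))
        (.setReal 11 (var 21) (.mul (rvar 9) (rvar 6)))
        (.setReal 11 (var 21) (.cast (.lit 0)))) <|
      .seq (.setNat 21 (.lit 0) (.add (var 21) (.lit 1))) <|
      .seq (.setNat 24 (.lit 0) (.lit 0)) <|
      .setReal 9 (.lit 0) (.cast (.lit 0))))
    .skip

/-- One step of the machine, for the instruction in the integer variable `20`. -/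
def stepCmd : Cmd :=
  .ite (.nle (var 20) (.lit 2))
    (.setReal 9 (.lit 0) (.sub (.add (.add (rvar 9) (rvar 9)) (.cast (var 20))) (.cast (.lit 1))))
    (.ite (.nle (var 20) (.lit 3)) storeCmd
      (.ite (.nle (.add (var 22) (.lit 1)) (var 21)) advanceCmd .skip))

/-- The number of steps of `stepCmd`. -/
def stepTime (n d k : ℕ) : ℕ := advanceTime n d k + 250

/-- The cases follow the definition of the step: coordinate relative to a ball, coordinate relative
to a point, radius of either sign, and no ball left to place. -/
theorem storeCmd_spec {X : Params} {s : State} {v : Machine} {δ u : ℝ} (hE : Env X s)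
    (hS : Sim X s v) (hδ : s.real 6 0 = δ) (hu : s.real 7 0 = u) :
    Spec storeCmd s 200 fun s' => Sim X s' (v.step X δ u 3) := by
  refine .block rfl (by simp [storeCmd]) ?_
  obtain ⟨hm, hq, hf, hj, ha, hC, hρ, hmk, hfn⟩ := hS
  by_cases h1 : v.m < X.k
  · have hrm := hE.rowD v.m (by omega)
    have hrf := hE.rowD v.f (by omega)
    by_cases h2 : v.j < X.d
    · have hix := index_lt h1 h2
      have key : ∀ b : ℝ, ∀ x < X.k * X.d,
          Function.update (s.real 10) (v.m * X.d + v.j) b x =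
            Function.update v.C (v.m * X.d + v.j) b x := by
        intro b x hx
        simp only [Function.update_apply, hC x hx]
      by_cases h3 : v.q < v.m
      · have hrq := hE.rowD v.q (by omega)
        have hiq := hC _ (index_lt (h3.trans h1) h2)
        constructor <;> simp [storeCmd, Machine.step, h1, h2, h3, hE.k_eq, hE.d_eq, hm, hq, hf, hj,
          ha, hrm, hrq, hmk, hfn, hu, hiq]
        · exact key _
        · exact hρ
      · constructor <;> simp [storeCmd, Machine.step, h1, h2, h3, hE.k_eq, hE.d_eq, hm, hq, hf, hj,
          ha, hrm, hrf, hmk, hfn, hu, hE.pt_eq]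
        · exact key _
        · exact hρ
    · have key : ∀ b : ℝ, ∀ i < X.k,
          Function.update (s.real 11) v.m b i = Function.update v.ρ v.m b i := by
        intro b i hi
        simp only [Function.update_apply, hρ i hi]
      by_cases h3 : 0 ≤ v.a * δ
      · constructor <;> simp [storeCmd, Machine.step, h1, h2, h3, hE.k_eq, hE.d_eq, hm, hq, hf, hj,
          ha, hfn, hδ]
        · exact hC
        · exact key _
      · constructor <;> simp [storeCmd, Machine.step, h1, h2, h3, hE.k_eq, hE.d_eq, hm, hq, hf, hj,
          ha, hfn, hδ]
        · exact hC
        · rw [max_eq_right (not_le.1 h3).le]; exact key _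
  · constructor <;> simp [storeCmd, Machine.step, h1, hE.k_eq, hm, hq, hf, hj, ha, hmk, hfn]
    · exact hC
    · exact hρ

theorem stepCmd_spec {X : Params} {s : State} {v : Machine} {δ u : ℝ} {g : ℕ} (hE : Env X s)
    (hS : Sim X s v) (hδ : s.real 6 0 = δ) (hu : s.real 7 0 = u) (hg : s.nat 20 0 = g) :
    Spec stepCmd s (stepTime X.n X.d X.k) fun s' => Sim X s' (v.step X δ u g) := by
  refine Spec.ite (T' := advanceTime X.n X.d X.k + 230) (fun h => ?_) (fun h => ?_)
    (by simp [stepTime]; omega)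
  · simp only [Test.eval, NExp.eval, hg] at h
    refine .block rfl (by simp) ?_
    obtain ⟨hm, hq, hf, hj, ha, hC, hρ, hmk, hfn⟩ := hS
    constructor <;> simp [Machine.step, h, hm, hq, hf, hj, ha, hmk, hfn, hg]
    · exact hC
    · exact hρ
  simp only [Test.eval, NExp.eval, hg] at h
  refine Spec.ite (T' := advanceTime X.n X.d X.k + 220) (fun h' => ?_) (fun h' => ?_)
    (by simp; omega)
  · simp only [Test.eval, NExp.eval, hg] at h'
    obtain rfl : g = 3 := by omega
    exact (storeCmd_spec hE hS hδ hu).imp (fun _ h _ => h) (by omega)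
  simp only [Test.eval, NExp.eval, hg] at h'
  refine Spec.ite (T' := advanceTime X.n X.d X.k + 210) (fun h'' => ?_) (fun h'' => ?_)
    (by simp; omega)
  · simp only [Test.eval, NExp.eval, hS.q_eq, hS.m_eq] at h''
    rw [Machine.step, if_neg h, if_neg (by omega), if_pos (by omega)]
    exact (advanceCmd_spec hE hS).imp (fun _ h _ => h) (by omega)
  · simp only [Test.eval, NExp.eval, hS.q_eq, hS.m_eq] at h''
    rw [Machine.step, if_neg h, if_neg (by omega), if_neg (by omega)]
    exact .block rfl (by simp) hS

end SumOfRadii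

namespace SumOfRadii

open RealRAM

/-! ### Running the machine on a guess -/

/-- The `i`-th instruction of the guess `x`. -/
def instr (x i : ℕ) : ℕ :=
  x / 2 ^ (3 * i) % 2 + 2 * (x / 2 ^ (3 * i + 1) % 2) + 4 * (x / 2 ^ (3 * i + 2) % 2)

/-- The initial state of the machine. -/
def Machine.init : Machine := ⟨0, 0, 0, 0, 0, fun _ => 0, fun _ => 0⟩

/-- The state of the machine after the first `l` instructions of the guess `x`. -/
noncomputable def Machine.run (X : Params) (δ u : ℝ) (x l : ℕ) : Machine :=
  (List.range l).foldl (fun v i => v.step X δ u (instr x i)) .init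

/-- Set the machine to its initial state. -/
def resetCmd : Cmd :=
  .seq (.seq (.setNat 21 (.lit 0) (.lit 0)) <| .seq (.setNat 22 (.lit 0) (.lit 0)) <|
    .seq (.setNat 23 (.lit 0) (.lit 0)) <| .seq (.setNat 24 (.lit 0) (.lit 0)) <|
    .seq (.setNat 19 (.lit 0) (.lit 0)) <| .setReal 9 (.lit 0) (.cast (.lit 0))) <|
  forTo 43 (.get 0 (.lit 2)) <|
    .seq (.setReal 11 (var 43) (.cast (.lit 0))) <|
    forTo 44 (.get 0 (.lit 1)) <|
      .setReal 10 (.add (.get 3 (var 43)) (var 44)) (.cast (.lit 0))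

theorem resetCmd_spec {X : Params} {s : State} (hE : Env X s) (hn : 1 ≤ X.n) :
    Spec resetCmd s (X.k * (X.d * 50 + 80) + 80) fun s' => Sim X s' .init ∧ s'.nat 19 0 = 0 := by
  refine Spec.seq (T₁ := 50) (R := fun s' => Env X s' ∧ s'.nat 21 0 = 0 ∧ s'.nat 22 0 = 0 ∧
      s'.nat 23 0 = 0 ∧ s'.nat 24 0 = 0 ∧ s'.nat 19 0 = 0 ∧ s'.real 9 0 = 0)
    (Spec.imp (Q := fun s' => s'.nat 21 0 = 0 ∧ s'.nat 22 0 = 0 ∧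
      s'.nat 23 0 = 0 ∧ s'.nat 24 0 = 0 ∧ s'.nat 19 0 = 0 ∧ s'.real 9 0 = 0)
      (.block rfl (by simp) (by simp)) (fun s' h hf => ⟨hE.frame hf rfl, h⟩) le_rfl)
    (T₂ := X.k * (X.d * 50 + 80) + 30) ?_ (by omega)
  rintro s₁ ⟨hE₁, h21, h22, h23, h24, h19, h9⟩ -
  refine (Spec.forTo (T := X.d * 50 + 50) X.k (fun i s' => ∀ i' < i, s'.real 11 i' = 0 ∧
    ∀ c < X.d, s'.real 10 (i' * X.d + c) = 0) rfl ?_ (by simp) (by simp) ?_ le_rfl).imp ?_ le_rfl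
  · intro s' hf
    simp only [NExp.eval, hf.nat 0 rfl]
    exact hE₁.k_eq
  · intro i s₂ hi hv hf hI
    refine Spec.seq (T₁ := 6) (R := fun s' => s' = s₂.setReal 11 i 0)
      (.block rfl (by simp) (by simp [hv])) (T₂ := X.d * 50 + 30) ?_ (by omega)
    rintro s₃ rfl -
    refine (Spec.forTo (T := 20) X.d (fun j s' => (∀ c < j, s'.real 10 (i * X.d + c) = 0) ∧
      ∀ i' < i, ∀ c < X.d, s'.real 10 (i' * X.d + c) = 0) rfl ?_ (by simp) ?_ ?_ le_rfl).imp ?_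
      le_rfl
    · intro s' hf'
      simp only [NExp.eval, hf'.nat 0 rfl]
      exact (congrFun (hf.nat 0 rfl) 1).trans hE₁.d_eq
    · simpa using fun i' hi' => (hI i' hi').2
    · rintro c s' hc hv' hf' ⟨h1, h2⟩
      refine .block rfl (by simp) ?_
      have h43 : s'.nat 43 0 = i := (congrFun (hf'.nat 43 rfl) 0).trans hv
      have h3 : s'.nat 3 i = i * X.d :=
        (congrFun ((hf'.nat 3 rfl).trans (hf.nat 3 rfl)) i).trans (hE₁.rowD i (by omega))
      simp only [Cmd.exec, RExp.eval, NExp.eval, State.setNat_real, State.setReal_real, h43, h3,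
        hv', Function.update_apply, if_true]
      refine ⟨fun c' hc' => ?_, fun i' hi' c' hc' => ?_⟩
      · split_ifs with h
        · simp
        · exact h1 c' (by omega)
      · split_ifs with h
        · simp
        · exact h2 i' hi' c' hc'
    · rintro s₄ ⟨h1, h2⟩ hf₄ i' hi'
      simp only [State.setNat_real, hf₄.real 11 rfl, State.setReal_real, if_true,
        Function.update_apply]
      rcases Nat.lt_succ_iff_lt_or_eq.1 hi' with h | rfl
      · exact ⟨by rw [if_neg (by omega)]; exact (hI i' h).1, h2 i' h⟩
      · exact ⟨by simp, h1⟩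
  · intro s' h hf
    refine ⟨⟨?_, ?_, ?_, ?_, ?_, ?_, ?_, Nat.zero_le _, hn⟩, ?_⟩
    · rw [hf.nat 21 rfl, h21]; rfl
    · rw [hf.nat 22 rfl, h22]; rfl
    · rw [hf.nat 23 rfl, h23]; rfl
    · rw [hf.nat 24 rfl, h24]; rfl
    · rw [hf.real 9 rfl, h9]; rfl
    · intro x hx
      have hd : 0 < X.d := Nat.pos_of_ne_zero (by rintro h; simp [h] at hx)
      have := (h (x / X.d) ((Nat.div_lt_iff_lt_mul hd).2 hx)).2 (x % X.d) (Nat.mod_lt _ hd)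
      rwa [Nat.div_add_mod'] at this
    · exact fun i hi => (h i hi).1
    · rw [hf.nat 19 rfl, h19]

/-- Run the machine on the guess in the integer variable `14`. -/
def runCmd : Cmd :=
  .seq resetCmd <| .seq (bitsCmd (.get 6 (.lit 1)) (var 14)) <|
  forTo 18 (.get 6 (.lit 0)) <|
    .seq (.seq (.setNat 20 (.lit 0) (.add (.get 17 (var 19))
      (.add (.add (.get 17 (.add (var 19) (.lit 1))) (.get 17 (.add (var 19) (.lit 1))))
        (.add (.add (.get 17 (.add (var 19) (.lit 2))) (.get 17 (.add (var 19) (.lit 2))))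
          (.add (.get 17 (.add (var 19) (.lit 2))) (.get 17 (.add (var 19) (.lit 2))))))))
      (.setNat 19 (.lit 0) (.add (var 19) (.lit 3)))) stepCmd

/-- The number of steps of `runCmd`. -/
def runTime (n d k L : ℕ) : ℕ :=
  k * (d * 50 + 80) + 80 + bitsTime (3 * L) + (L * (stepTime n d k + 130) + 30)

theorem runCmd_spec {X : Params} {s : State} (hE : Env X s) (hn : 1 ≤ X.n) {δ u : ℝ} {x : ℕ}
    (hδ : s.real 6 0 = δ) (hu : s.real 7 0 = u) (hx : s.nat 14 0 = x) (hx' : x < 2 ^ (3 * X.L)) :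
    Spec runCmd s (runTime X.n X.d X.k X.L) fun s' => Sim X s' (.run X δ u x X.L) := by
  refine Spec.seq (resetCmd_spec hE hn)
    (T₂ := bitsTime (3 * X.L) + (X.L * (stepTime X.n X.d X.k + 130) + 30)) ?_
    (by rw [runTime]; omega)
  rintro s₁ ⟨hS₁, h19⟩ hf₁
  have hE₁ := hE.frame hf₁ rfl
  have h14 : s₁.nat 14 0 = x := by rw [hf₁.nat 14 rfl, hx]
  refine Spec.seq (bitsCmd_spec hE₁ (len := .get 6 (.lit 1)) (x := var 14) (l := 3 * X.L)
      (fun s' _ h => ?_) le_rfl (by simpa [h14] using hx') (by simp) (by simp)) ?_ le_rfl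
  · simp only [NExp.eval, h]; exact hE₁.L3_eq
  intro s₂ hb hf₂
  simp only [NExp.eval, h14] at hb
  have hE₂ := hE₁.frame hf₂ rfl
  refine (Spec.forTo (T := stepTime X.n X.d X.k + 100) X.L (fun i s' => s'.nat 19 0 = 3 * i ∧
    Sim X s' (.run X δ u x i)) rfl ?_ (by simp) ?_ ?_ le_rfl).imp (fun s' h _ => h.2) le_rfl
  · intro s' hf
    simp only [NExp.eval, hf.nat 6 rfl]
    exact hE₂.L_eq
  · refine ⟨?_, ?_⟩
    · simp [hf₂.nat 19 rfl, h19]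
    · change Sim X _ .init
      obtain ⟨hm, hq, hf, hj, ha, hC, hρ, hmk, hfn⟩ := hS₁
      refine ⟨?_, ?_, ?_, ?_, ?_, ?_, ?_, hmk, hfn⟩
      · simpa [hf₂.nat 21 rfl] using hm
      · simpa [hf₂.nat 22 rfl] using hq
      · simpa [hf₂.nat 23 rfl] using hf
      · simpa [hf₂.nat 24 rfl] using hj
      · simpa [hf₂.real 9 rfl] using ha
      · simpa [hf₂.real 10 rfl] using hC
      · simpa [hf₂.real 11 rfl] using hρ
  · rintro i s₃ hi hv hf₃ ⟨h19, hS⟩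
    have hB : ∀ t < 3 * X.L, s₃.nat 17 t = x / 2 ^ t % 2 := fun t ht => by
      rw [hf₃.nat 17 rfl, hb t ht]
    refine Spec.seq (T₁ := 80) (R := fun s' => s' = (s₃.setNat 20 0 (instr x i)).setNat 19 0
      (3 * (i + 1))) (.block rfl (by simp) ?_) (T₂ := stepTime X.n X.d X.k) ?_ (by omega)
    · have e : instr x i = x / 2 ^ (3 * i) % 2 + ((x / 2 ^ (3 * i + 1) % 2 +
        x / 2 ^ (3 * i + 1) % 2) + ((x / 2 ^ (3 * i + 2) % 2 + x / 2 ^ (3 * i + 2) % 2) +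
          (x / 2 ^ (3 * i + 2) % 2 + x / 2 ^ (3 * i + 2) % 2))) := by rw [instr]; omega
      rw [e]
      simp only [Cmd.exec, NExp.eval, h19, hB _ (show 3 * i < 3 * X.L by omega),
        hB _ (show 3 * i + 1 < 3 * X.L by omega), hB _ (show 3 * i + 2 < 3 * X.L by omega)]
      simp [h19, mul_add]
    rintro s₄ rfl hf₄
    have hE₄ := (hE₂.frame hf₃ rfl).frame hf₄ rfl
    refine (stepCmd_spec (v := .run X δ u x i) (δ := δ) (u := u) (g := instr x i) hE₄ ?_ ?_ ?_
      (by simp)).imp (fun s' h hf => ?_) le_rfl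
    · obtain ⟨hm, hq, hf, hj, ha, hC, hρ, hmk, hfn⟩ := hS
      exact ⟨by simpa using hm, by simpa using hq, by simpa using hf, by simpa using hj,
        ha, hC, hρ, hmk, hfn⟩
    · rw [← hδ, ← hf₁.real 6 rfl, ← hf₂.real 6 rfl, ← hf₃.real 6 rfl]; rfl
    · rw [← hu, ← hf₁.real 7 rfl, ← hf₂.real 7 rfl, ← hf₃.real 7 rfl]; rfl
    · refine ⟨by simp [hf.nat 19 rfl], ?_⟩
      have : Machine.run X δ u x (i + 1) = (Machine.run X δ u x i).step X δ u (instr x i) := by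
        simp [Machine.run, List.range_succ]
      rw [this]
      obtain ⟨hm, hq, hf, hj, ha, hC, hρ, hmk, hfn⟩ := h
      exact ⟨by simpa using hm, by simpa using hq, by simpa using hf, by simpa using hj,
        ha, hC, hρ, hmk, hfn⟩

end SumOfRadii

namespace SumOfRadii

open RealRAM

/-! ### Making the centres distinct -/

/-- Rows `i` and `j` of the table `C` with row length `d` agree. -/
def SameRow (d : ℕ) (C : ℕ → ℝ) (i j : ℕ) : Prop := ∀ c < d, C (i * d + c) = C (j * d + c)

/-- A sum of squares is nonpositive only if every term vanishes, so one comparison decides equality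
of rows. -/
theorem sqDist_nonpos_iff {d : ℕ} {C : ℕ → ℝ} {i j : ℕ} :
    sqDist d C (i * d) C (j * d) ≤ 0 ↔ SameRow d C i j := by
  have h0 : ∀ c ∈ Finset.range d, 0 ≤ (C (i * d + c) - C (j * d + c)) *
      (C (i * d + c) - C (j * d + c)) := fun c _ => mul_self_nonneg _
  rw [sqDist, (Finset.sum_nonneg h0).ge_iff_eq', Finset.sum_eq_zero_iff_of_nonneg h0]
  simp [SameRow, sub_eq_zero]

/-- Row `i` of `C`, with its first entry increased by `t`, is equal to an earlier row. -/
def Clash (d : ℕ) (C : ℕ → ℝ) (i : ℕ) (t : ℝ) : Prop :=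
  ∃ j < i, SameRow d (Function.update C (i * d) (C (i * d) + t)) i j

/-- The first `r` rows of `C'` are distinct, and `C'` arises from `C` by adding small multiples of
`τ` to the first entries of rows that are equal to earlier ones. -/
structure Deduped (d r : ℕ) (τ : ℝ) (C C' : ℕ → ℝ) : Prop where
  distinct : ∀ i < r, ∀ j < i, ¬ SameRow d C' i j
  shift : ∀ i < r, ∃ m ≤ i, C' (i * d) = C (i * d) + m * τ
  other : ∀ x, (∀ i < r, x ≠ i * d) → C' x = C x
  fixed : ∀ l, (∀ i < l, ∀ j < i, ¬ SameRow d C i j) → ∀ i < r, i < l → C' (i * d) = C (i * d)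

/-- Pigeonhole: the `i + 1` shifts would clash with only `i` earlier rows, so two shifts would give
the same first entry, although `τ ≠ 0`. -/
theorem exists_not_clash {d i : ℕ} {C : ℕ → ℝ} {τ : ℝ} (hd : 0 < d) (hτ : 0 < τ)
    (h : ∀ m ≤ i, Clash d C i (m * τ)) : False := by
  choose! g hg hg' using h
  obtain ⟨a, ha, b, hb, hab, e⟩ := Finset.exists_ne_map_eq_of_card_lt_of_maps_to
    (s := Finset.range (i + 1)) (t := Finset.range i) (by simp) (f := g) (fun m hm => by
      simp only [Finset.coe_range, Set.mem_Iio] at hm ⊢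
      exact hg m (by omega))
  simp only [Finset.mem_range] at ha hb
  have key : ∀ m ≤ i, C (i * d) + m * τ = C (g m * d) := by
    intro m hm
    have := hg' m hm 0 hd
    have hne : g m * d ≠ i * d := by
      have := Nat.mul_lt_mul_of_pos_right (hg m hm) hd
      omega
    simpa [hne] using this
  have h1 := key a (by omega)
  have h2 := key b (by omega)
  rw [e] at h1
  have h3 : (a : ℝ) * τ = b * τ := by linarith
  exact hab (by exact_mod_cast mul_right_cancel₀ hτ.ne' h3)

/-- Shift the centres in the real array `10` until they are distinct. -/
def dedupCmd : Cmd :=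
  forTo 32 (.get 0 (.lit 2)) <| forTo 33 (var 32) <|
    .seq (.setNat 35 (.lit 0) (.lit 0)) <|
    .seq (forTo 34 (var 32) (.seq (distSqCmd 10 10 (.get 3 (var 32)) (.get 3 (var 34)))
      (.ite (.rle (rvar 12) (.cast (.lit 0))) (.setNat 35 (.lit 0) (.lit 1)) .skip))) <|
    .ite (.nle (.lit 1) (var 35))
      (.setReal 10 (.get 3 (var 32)) (.add (.get 10 (.get 3 (var 32))) (rvar 8))) .skip

/-- The number of steps of `dedupCmd`. -/
def dedupTime (d k : ℕ) : ℕ := k * (k * (k * (d * 90 + 100) + 110) + 60) + 30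

/-- Row `r` receives the least multiple of `τ` that avoids all earlier rows. Minimality is what
gives `fixed`: rows that were distinct from the start do not move. -/
theorem Deduped.succ {d r : ℕ} {τ : ℝ} {C C' : ℕ → ℝ} (hd : 0 < d) (h : Deduped d r τ C C') {m : ℕ}
    (hm : m ≤ r) (hc : ¬ Clash d C' r (m * τ)) (hc' : ∀ m' < m, Clash d C' r (m' * τ)) :
    Deduped d (r + 1) τ C (Function.update C' (r * d) (C' (r * d) + m * τ)) := by
  have hne : ∀ {i c : ℕ}, i < r → c < d → i * d + c ≠ r * d := by
    intro i c hi hc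
    have : (i + 1) * d ≤ r * d := Nat.mul_le_mul_right _ hi
    rw [Nat.succ_mul] at this
    omega
  have hne' : ∀ {i : ℕ}, i < r → i * d ≠ r * d := fun hi => by simpa using hne hi hd
  have hr : C' (r * d) = C (r * d) := h.other _ fun i hi => (hne' hi).symm
  constructor
  · intro i hi j hj hs
    rcases Nat.lt_succ_iff_lt_or_eq.1 hi with hi | rfl
    · refine h.distinct i hi j hj fun c hcd => ?_
      have := hs c hcd
      rwa [Function.update_of_ne (hne hi hcd), Function.update_of_ne (hne (hj.trans hi) hcd)]
        at this
    · exact hc ⟨j, hj, hs⟩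
  · intro i hi
    rcases Nat.lt_succ_iff_lt_or_eq.1 hi with hi | rfl
    · rw [Function.update_of_ne (hne' hi)]
      exact h.shift i hi
    · exact ⟨m, hm, by rw [Function.update_self, hr]⟩
  · intro x hx
    rw [Function.update_of_ne (hx r (by omega))]
    exact h.other x fun i hi => hx i (by omega)
  · intro l hl i hi hil
    rcases Nat.lt_succ_iff_lt_or_eq.1 hi with hi | rfl
    · rw [Function.update_of_ne (hne' hi)]
      exact h.fixed l hl i hi hil
    · have hCC : ∀ i' ≤ i, ∀ c < d, C' (i' * d + c) = C (i' * d + c) := by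
        intro i' hi' c hcd
        rcases Nat.eq_zero_or_pos c with rfl | hc0
        · rcases hi'.lt_or_eq with hi' | rfl
          · exact h.fixed l hl i' hi' (by omega)
          · exact hr
        · refine h.other _ fun i'' _ e => ?_
          have := (index_inj (p := i'') (i := 0) (p' := i') (i' := c) hd hcd).1 (by simpa using e)
          omega
      -- Rows up to `i` still have their original entries and were distinct, so the shift `0` does
      -- not clash and minimality selects it.
      have hm0 : m = 0 := by
        by_contra hm0
        obtain ⟨j, hj, hs⟩ := hc' 0 (by omega)
        refine hl i hil j hj fun c hcd => ?_
        have := hs c hcd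
        simp only [Nat.cast_zero, zero_mul, add_zero, Function.update_eq_self] at this
        rwa [hCC i le_rfl c hcd, hCC j hj.le c hcd] at this
      simp [hm0, hr]

theorem dedupCmd_spec {X : Params} {s : State} (hE : Env X s) (hd : 0 < X.d) (hτ : 0 < s.real 8 0) :
    Spec dedupCmd s (dedupTime X.d X.k) fun s' =>
      Deduped X.d X.k (s.real 8 0) (s.real 10) (s'.real 10) := by
  classical
  set τ := s.real 8 0 with hτdef
  refine (Spec.forTo (T := X.k * (X.k * (X.d * 90 + 100) + 110) + 30) X.k (fun i s' =>
    Deduped X.d i τ (s.real 10) (s'.real 10)) rfl ?_ (by simp) ?_ ?_ le_rfl)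
  · intro s' hf
    simp only [NExp.eval, hf.nat 0 rfl]
    exact hE.k_eq
  · exact ⟨by simp, by simp, fun x _ => rfl, by simp⟩
  intro i s₁ hi hv₁ hf₁ hI₁
  have hE₁ := hE.frame hf₁ rfl
  have hτ₁ : s₁.real 8 0 = τ := by rw [hf₁.real 8 rfl]
  set C := s₁.real 10 with hC
  have hle : i * (X.k * (X.d * 90 + 100) + 80 + 30) ≤
      X.k * (X.k * (X.d * 90 + 100) + 110) := Nat.mul_le_mul hi.le (by omega)
  -- After `t` rounds `m ≤ t` shifts have been made, all smaller multiples clash, and if `m < t` the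
  -- search has already succeeded.
  refine (Spec.forTo (T := X.k * (X.d * 90 + 100) + 80)
    (T' := X.k * (X.k * (X.d * 90 + 100) + 110) + 30) i (fun t s' => ∃ m ≤ t,
    s'.real 10 = Function.update C (i * X.d) (C (i * X.d) + m * τ) ∧
    (∀ m' < m, Clash X.d C i (m' * τ)) ∧ (m < t → ¬ Clash X.d C i (m * τ))) rfl ?_ (by simp) ?_ ?_
    (Nat.add_le_add_right hle 30)).imp ?_ le_rfl
  · intro s' hf
    simp only [NExp.eval, hf.nat 32 rfl, hv₁]
  · exact ⟨0, le_rfl, by simp [hC], by simp, by simp⟩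
  · rintro t s₂ ht hv₂ hf₂ ⟨m, hm, h10, hlow, hlast⟩
    have hE₂ := hE₁.frame hf₂ rfl
    have hv32 : s₂.nat 32 0 = i := by rw [hf₂.nat 32 rfl, hv₁]
    have hτ₂ : s₂.real 8 0 = τ := by rw [hf₂.real 8 rfl, hτ₁]
    refine Spec.seq (T₁ := 3) (R := fun s' => s' = s₂.setNat 35 0 0)
      (.block rfl (by simp) (by simp)) (T₂ := X.k * (X.d * 90 + 100) + 70) ?_ (by omega)
    rintro s₃ rfl hf₃
    have hE₃ := hE₂.frame hf₃ rfl
    refine Spec.seq (R := fun s' => s'.nat 35 0 =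
          if ∃ j < i, SameRow X.d (Function.update C (i * X.d) (C (i * X.d) + m * τ)) i j
          then 1 else 0)
      (Spec.forTo (T := X.d * 90 + 70) (T' := X.k * (X.d * 90 + 100) + 30) i
        (fun l s' => s'.nat 35 0 =
          if ∃ j < l, SameRow X.d (Function.update C (i * X.d) (C (i * X.d) + m * τ)) i j
          then 1 else 0) rfl ?_ (by simp) (by simp) ?_ ?_) ?_ (T₂ := 30) (by omega)
    · intro s' hf
      simp only [NExp.eval, hf.nat 32 rfl]
      exact hv32
    · intro j s₄ hj hv₄ hf₄ hI₄
      have hE₄ := hE₃.frame hf₄ rfl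
      have hv32' : s₄.nat 32 0 = i := by rw [hf₄.nat 32 rfl]; exact hv32
      have h10' : s₄.real 10 = Function.update C (i * X.d) (C (i * X.d) + m * τ) := by
        rw [hf₄.real 10 rfl]; exact h10
      refine Spec.seq (distSqCmd_spec hE₄ (A := 10) (B := 10) (oa := .get 3 (var 32))
        (ob := .get 3 (var 34)) (by decide) (by decide) (fun s' h => by simp [h])
        (fun s' h => by simp [h]) (by simp) (by simp)) (T₂ := 20) ?_ (by omega)
      intro s₅ h₅ hf₅
      refine .block rfl (by simp) ?_
      simp only [NExp.eval, hv32', hv₄, hE₄.rowD i (by omega), hE₄.rowD j (by omega), h10'] at h₅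
      have h35 : s₅.nat 35 = s₄.nat 35 := hf₅.nat 35 rfl
      have hs : (∃ j' < j + 1, SameRow X.d
          (Function.update C (i * X.d) (C (i * X.d) + m * τ)) i j') ↔
          (∃ j' < j, SameRow X.d (Function.update C (i * X.d) (C (i * X.d) + m * τ)) i j') ∨
          SameRow X.d (Function.update C (i * X.d) (C (i * X.d) + m * τ)) i j := by
        constructor
        · rintro ⟨l, hl, h⟩
          rcases Nat.lt_succ_iff_lt_or_eq.1 hl with hl | rfl
          · exact .inl ⟨l, hl, h⟩
          · exact .inr h
        · rintro (⟨l, hl, h⟩ | h)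
          · exact ⟨l, by omega, h⟩
          · exact ⟨j, by omega, h⟩
      simp only [hs]
      rw [← sqDist_nonpos_iff (j := j), ← h₅]
      by_cases hz : s₅.real 12 0 ≤ 0
      · simp [hz]
      · simp [hz, h35, hI₄]
    · exact Nat.add_le_add_right (Nat.mul_le_mul_right _ hi.le) 30
    · intro s₄ h₄ hf₄
      refine .block rfl (by simp) ?_
      have h3 : s₄.nat 3 i = i * X.d := by
        rw [hf₄.nat 3 rfl]; exact hE₃.rowD i (by omega)
      have h32 : s₄.nat 32 0 = i := by rw [hf₄.nat 32 rfl]; exact hv32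
      have h10' : s₄.real 10 = Function.update C (i * X.d) (C (i * X.d) + m * τ) := by
        rw [hf₄.real 10 rfl]; exact h10
      have h8 : s₄.real 8 0 = τ := by rw [hf₄.real 8 rfl]; exact hτ₂
      split_ifs at h₄ with hcl
      · obtain rfl : m = t := by
          by_contra hne
          exact hlast (by omega) hcl
        refine ⟨m + 1, le_rfl, ?_, ?_, by simp⟩
        · simp only [Cmd.exec, Test.eval, NExp.eval, RExp.eval, h₄, le_refl, if_true, h32, h3, h8,
            State.setNat_real, State.setReal_real, h10', Function.update_idem,
            Function.update_self]
          congr 1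
          push_cast; ring
        · intro m' hm'
          rcases Nat.lt_succ_iff_lt_or_eq.1 hm' with h | rfl
          · exact hlow m' h
          · exact hcl
      · exact ⟨m, by omega, by simp [h₄, h10'], hlow, fun _ => hcl⟩
  · rintro s₂ ⟨m, hm, h10, hlow, hlast⟩ _
    have hnc : ¬ Clash X.d C i (m * τ) := by
      rcases hm.lt_or_eq with h | rfl
      · exact hlast h
      -- All `i` rounds led to a shift. A further clash would make all multiples up to `i` clash.
      · intro hc
        refine exists_not_clash hd hτ (C := C) (i := m) fun m' hm' => ?_
        rcases hm'.lt_or_eq with h | rfl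
        · exact hlow m' h
        · exact hc
    simp only [State.setNat_real, h10]
    exact hI₁.succ hd hm hnc hlow

end SumOfRadii

namespace SumOfRadii

open RealRAM

/-! ### Evaluating a candidate and keeping the best one -/

/-- The stored solution, if there is one, is feasible, and its value is known. -/
def StoreValid (X : Params) (s : State) : Prop :=
  s.nat 1 0 ≤ 1 ∧ (s.nat 1 0 = 1 →
    (∀ i < X.k, ∀ j < i, ¬ SameRow X.d (s.real 2) i j) ∧ (∀ i < X.k, 0 ≤ s.real 3 i) ∧
    Feasible X.n X.k X.U (Covers X (s.real 2) (s.real 3)) ∧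
    s.real 14 0 = ∑ i ∈ Finset.range X.k, s.real 3 i)

/-- A solution of value at most `V` is stored. -/
def Achieves (s : State) (V : ℝ) : Prop := s.nat 1 0 = 1 ∧ s.real 14 0 ≤ V

theorem StoreValid.frame {X : Params} {p : Cmd} {s s' : State} (h : StoreValid X s)
    (hf : Frame p s s') (h1 : p.writesNat 1 = false) (h2 : p.writesReal 2 = false)
    (h3 : p.writesReal 3 = false) (h14 : p.writesReal 14 = false) : StoreValid X s' := by
  rw [StoreValid, hf.nat 1 h1, hf.real 2 h2, hf.real 3 h3, hf.real 14 h14]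
  exact h

theorem Achieves.frame {V : ℝ} {p : Cmd} {s s' : State} (h : Achieves s V)
    (hf : Frame p s s') (h1 : p.writesNat 1 = false) (h14 : p.writesReal 14 = false) :
    Achieves s' V := by
  rw [Achieves, hf.nat 1 h1, hf.real 14 h14]
  exact h

theorem Feasible.mono {n k U : ℕ} {G G' : ℕ → ℕ → Prop} (h : Feasible n k U G)
    (hG : ∀ p < n, ∀ i < k, G p i → G' p i) : Feasible n k U G' := by
  obtain ⟨f, hf, hU⟩ := h
  exact ⟨f, fun p hp => ⟨(hf p hp).1, hG p hp _ (hf p hp).1 (hf p hp).2⟩, hU⟩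

theorem SameRow.congr {d k : ℕ} {C C' : ℕ → ℝ} (hC : ∀ x < k * d, C x = C' x) {i j : ℕ}
    (hi : i < k) (hj : j < k) (h : SameRow d C i j) : SameRow d C' i j := fun c hc => by
  rw [← hC _ (index_lt hi hc), ← hC _ (index_lt hj hc), h c hc]

/-- Copy the candidate to the output arrays. -/
def copyCmd : Cmd :=
  forTo 43 (.get 0 (.lit 2)) <|
    .seq (.setReal 3 (var 43) (.get 11 (var 43))) <|
    forTo 44 (.get 0 (.lit 1)) <| .setReal 2 (.add (.get 3 (var 43)) (var 44))
      (.get 10 (.add (.get 3 (var 43)) (var 44)))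

theorem copyCmd_spec {X : Params} {s : State} (hE : Env X s) :
    Spec copyCmd s (X.k * (X.d * 50 + 80) + 30) fun s' =>
      (∀ i < X.k, s'.real 3 i = s.real 11 i) ∧ ∀ x < X.k * X.d, s'.real 2 x = s.real 10 x := by
  refine (Spec.forTo (T := X.d * 50 + 50) X.k (fun i s' => ∀ i' < i,
    s'.real 3 i' = s.real 11 i' ∧ ∀ c < X.d, s'.real 2 (i' * X.d + c) = s.real 10 (i' * X.d + c))
    rfl ?_ (by simp) (by simp) ?_ le_rfl).imp ?_ le_rfl
  · intro s' hf
    simp only [NExp.eval, hf.nat 0 rfl]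
    exact hE.k_eq
  · intro i s₂ hi hv hf hI
    refine Spec.seq (T₁ := 10) (R := fun s' => s' = s₂.setReal 3 i (s.real 11 i))
      (.block rfl (by simp) (by simp [hv, hf.real 11 rfl])) (T₂ := X.d * 50 + 30) ?_ (by omega)
    rintro s₃ rfl -
    refine (Spec.forTo (T := 20) X.d (fun j s' =>
      (∀ c < j, s'.real 2 (i * X.d + c) = s.real 10 (i * X.d + c)) ∧
      ∀ i' < i, ∀ c < X.d, s'.real 2 (i' * X.d + c) = s.real 10 (i' * X.d + c)) rfl ?_ (by simp) ?_
      ?_ le_rfl).imp ?_ le_rfl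
    · intro s' hf'
      simp only [NExp.eval, hf'.nat 0 rfl]
      exact (congrFun (hf.nat 0 rfl) 1).trans hE.d_eq
    · simpa using fun i' hi' => (hI i' hi').2
    · rintro c s' hc hv' hf' ⟨h1, h2⟩
      refine .block rfl (by simp) ?_
      have h43 : s'.nat 43 0 = i := (congrFun (hf'.nat 43 rfl) 0).trans hv
      have h3 : s'.nat 3 i = i * X.d :=
        (congrFun ((hf'.nat 3 rfl).trans (hf.nat 3 rfl)) i).trans (hE.rowD i (by omega))
      have h10 : s'.real 10 = s.real 10 := (hf'.real 10 rfl).trans (hf.real 10 rfl)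
      simp only [Cmd.exec, RExp.eval, NExp.eval, State.setNat_real, State.setReal_real, h43, h3,
        hv', Function.update_apply, if_true, h10]
      refine ⟨fun c' hc' => ?_, fun i' hi' c' hc' => ?_⟩
      · split_ifs with h
        · rw [h]
        · exact h1 c' (by omega)
      · split_ifs with h
        · rw [h]
        · exact h2 i' hi' c' hc'
    · rintro s₄ ⟨h1, h2⟩ hf₄ i' hi'
      simp only [State.setNat_real, hf₄.real 3 rfl, State.setReal_real, if_true,
        Function.update_apply]
      rcases Nat.lt_succ_iff_lt_or_eq.1 hi' with h | rfl
      · exact ⟨by rw [if_neg (by omega)]; exact (hI i' h).1, h2 i' h⟩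
      · exact ⟨by simp, h1⟩
  · intro s' h _
    refine ⟨fun i hi => (h i hi).1, fun x hx => ?_⟩
    have hd : 0 < X.d := Nat.pos_of_ne_zero (by rintro h; simp [h] at hx)
    have := (h (x / X.d) ((Nat.div_lt_iff_lt_mul hd).2 hx)).2 (x % X.d) (Nat.mod_lt _ hd)
    rwa [Nat.div_add_mod'] at this

/-- Evaluate the candidate in the real arrays `10` and `11`, and store it if it is feasible and
better than the stored solution. -/
def evalCmd : Cmd :=
  .seq (coverCmd 10 11) <| .seq hallCmd <| .seq (.setReal 13 (.lit 0) (.cast (.lit 0))) <|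
  .seq (forTo 43 (.get 0 (.lit 2))
    (.setReal 13 (.lit 0) (.add (rvar 13) (.get 11 (var 43))))) <|
  .ite (.and (.nle (.lit 1) (var 42))
      (.not (.and (.nle (.lit 1) (.get 1 (.lit 0))) (.rle (rvar 14) (rvar 13)))))
    (.seq (.seq (.setNat 1 (.lit 0) (.lit 1)) (.setReal 14 (.lit 0) (rvar 13))) copyCmd) .skip

/-- The number of steps of `evalCmd`. -/
def evalTime (n d k : ℕ) : ℕ := coverTime n d k + hallTime n k + (k * (d * 50 + 150) + 150)

/-- The stored value is replaced only by a smaller one, so each bound `V` achieved earlier stays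
achieved, and a feasible candidate adds its own value. Stating this for all `V` avoids speaking of
minima. -/
theorem evalCmd_spec {X : Params} {s : State} (hE : Env X s) (hk : X.k ≤ 3 * X.L)
    (hV : StoreValid X s) (hdist : ∀ i < X.k, ∀ j < i, ¬ SameRow X.d (s.real 10) i j)
    (hρ : ∀ i < X.k, 0 ≤ s.real 11 i) :
    Spec evalCmd s (evalTime X.n X.d X.k) fun s' => StoreValid X s' ∧
      ∀ V, (Achieves s V ∨ Feasible X.n X.k X.U (Covers X (s.real 10) (s.real 11)) ∧
        ∑ i ∈ Finset.range X.k, s.real 11 i ≤ V) → Achieves s' V := by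
  classical
  set G := Covers X (s.real 10) (s.real 11) with hG
  have hmul : X.k * (X.d * 50 + 150) = X.k * (X.d * 50 + 80) + X.k * 70 := by ring
  refine Spec.seq (coverCmd_spec hE (by decide) (by decide))
    (T₂ := hallTime X.n X.k + (X.k * (X.d * 50 + 150) + 150)) ?_ (by rw [evalTime]; omega)
  intro s₁ hT hf₁
  have hE₁ := hE.frame hf₁ rfl
  refine Spec.seq (hallCmd_spec hE₁ hk hT) (T₂ := X.k * (X.d * 50 + 150) + 150) ?_ le_rfl
  intro s₂ h42 hf₂
  have hE₂ := hE₁.frame hf₂ rfl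
  have h11 : s₂.real 11 = s.real 11 := by rw [hf₂.real 11 rfl, hf₁.real 11 rfl]
  have h10 : s₂.real 10 = s.real 10 := by rw [hf₂.real 10 rfl, hf₁.real 10 rfl]
  refine Spec.seq (T₁ := 4) (R := fun s' => s' = s₂.setReal 13 0 0)
    (.block rfl (by simp) (by simp)) (T₂ := X.k * (X.d * 50 + 150) + 140) ?_ (by omega)
  rintro s₃ rfl -
  refine Spec.seq (R := fun s' => s'.real 13 0 = ∑ i ∈ Finset.range X.k, s.real 11 i)
    (Spec.forTo (T := 20) X.k (fun i s' => s'.real 13 0 = ∑ i ∈ Finset.range i, s.real 11 i)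
      rfl ?_ (by simp) (by simp) ?_ le_rfl) (T₂ := X.k * (X.d * 50 + 80) + 100) ?_
    (by rw [hmul]; omega)
  · intro s' hf
    simp only [NExp.eval, hf.nat 0 rfl]
    exact hE₂.k_eq
  · intro i s' hi hv hf hI
    refine .block rfl (by simp) ?_
    have : s'.real 11 = s.real 11 := by rw [hf.real 11 rfl]; exact h11
    simp [hv, hI, this, Finset.sum_range_succ]
  intro s₄ h13 hf₄
  have hE₄ : Env X s₄ := by
    have h : Env X (s₂.setReal 13 0 0) :=
      hE₂.frame (p := .setReal 13 (.lit 0) (.cast (.lit 0))) (s' := s₂.setReal 13 0 0)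
        ⟨fun _ _ => rfl, fun a ha => by
          have : a ≠ 13 := by rintro rfl; simp [Cmd.writesReal] at ha
          simp [this]⟩ rfl
    exact h.frame hf₄ rfl
  have h42' : s₄.nat 42 0 ≤ 1 ∧ (s₄.nat 42 0 = 1 ↔ Feasible X.n X.k X.U G) := by
    rw [hf₄.nat 42 rfl]; exact h42
  have h1 : s₄.nat 1 = s.nat 1 := by
    rw [hf₄.nat 1 rfl]; exact (hf₂.nat 1 rfl).trans (hf₁.nat 1 rfl)
  have hr2 : s₄.real 2 = s.real 2 := by
    rw [hf₄.real 2 rfl]; exact (hf₂.real 2 rfl).trans (hf₁.real 2 rfl)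
  have hr3 : s₄.real 3 = s.real 3 := by
    rw [hf₄.real 3 rfl]; exact (hf₂.real 3 rfl).trans (hf₁.real 3 rfl)
  have hr14 : s₄.real 14 = s.real 14 := by
    rw [hf₄.real 14 rfl]; exact (hf₂.real 14 rfl).trans (hf₁.real 14 rfl)
  have hr10 : s₄.real 10 = s.real 10 := by rw [hf₄.real 10 rfl]; exact h10
  have hr11 : s₄.real 11 = s.real 11 := by rw [hf₄.real 11 rfl]; exact h11
  have hV₄ : StoreValid X s₄ := by rw [StoreValid, h1, hr2, hr3, hr14]; exact hV
  have hA₄ : ∀ V, Achieves s V → Achieves s₄ V := fun V h => by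
    rw [Achieves, h1, hr14]; exact h
  refine Spec.ite (T' := X.k * (X.d * 50 + 80) + 50) (fun h => ?_) (fun h => ?_) (by simp; omega)
  · simp only [Test.eval, NExp.eval, RExp.eval] at h
    have hfeas : Feasible X.n X.k X.U G := h42'.2.1 (by have := h42'.1; omega)
    refine Spec.seq (T₁ := 10) (R := fun s' => s' = (s₄.setNat 1 0 1).setReal 14 0 (s₄.real 13 0))
      (.block rfl (by simp) (by simp)) (T₂ := X.k * (X.d * 50 + 80) + 30) ?_ (by omega)
    rintro s₅ rfl hf₅
    refine (copyCmd_spec (hE₄.frame hf₅ rfl)).imp ?_ le_rfl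
    rintro s₆ ⟨h3, h2⟩ hf₆
    have e1 : s₆.nat 1 0 = 1 := by rw [hf₆.nat 1 rfl]; simp
    have e14 : s₆.real 14 0 = ∑ i ∈ Finset.range X.k, s.real 11 i := by
      rw [hf₆.real 14 rfl, ← h13]; simp
    replace h3 : ∀ i < X.k, s.real 11 i = s₆.real 3 i := fun i hi => by
      rw [h3 i hi, ← hr11]; rfl
    replace h2 : ∀ x < X.k * X.d, s.real 10 x = s₆.real 2 x := fun x hx => by
      rw [h2 x hx, ← hr10]; rfl
    refine ⟨⟨e1.le, fun _ => ⟨fun i hi j hj hs => ?_, fun i hi => ?_, ?_, ?_⟩⟩, ?_⟩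
    · exact hdist i hi j hj (hs.congr (fun x hx => (h2 x hx).symm) hi (hj.trans hi))
    · rw [← h3 i hi]; exact hρ i hi
    · exact hfeas.mono fun p _ i hi => (Covers.congr h2 h3 hi).1
    · rw [e14]
      exact Finset.sum_congr rfl fun i hi => h3 i (Finset.mem_range.1 hi)
    · rintro V (hV | ⟨-, hV⟩)
      · refine ⟨e1, ?_⟩
        have hA := hA₄ V hV
        have : ¬ s₄.real 14 0 ≤ s₄.real 13 0 := fun hle => h.2 ⟨hA.1.ge, hle⟩
        rw [e14, ← h13]
        exact (not_le.1 this).le.trans hA.2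
      · exact ⟨e1, e14.trans_le hV⟩
  · simp only [Test.eval, NExp.eval, RExp.eval] at h
    refine .block rfl (by simp) ⟨hV₄, ?_⟩
    rintro V (hV | ⟨hfeas, hV⟩)
    · exact hA₄ V hV
    · have : 1 ≤ s₄.nat 42 0 := (h42'.2.2 hfeas).ge
      have h' : 1 ≤ s₄.nat 1 0 ∧ s₄.real 14 0 ≤ s₄.real 13 0 := by tauto
      exact ⟨le_antisymm hV₄.1 h'.1, h'.2.trans (h13.trans_le hV)⟩

/-! ### The search -/

/-- Radii are clamped at zero when stored, so even a meaningless guess yields nonnegative radii. -/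
theorem Machine.step_nonneg {X : Params} {δ u : ℝ} {v : Machine} {g : ℕ} (h : ∀ i, 0 ≤ v.ρ i)
    (i : ℕ) : 0 ≤ (v.step X δ u g).ρ i := by
  rw [Machine.step]
  split_ifs <;> try exact h i
  simp only [Function.update_apply]
  split_ifs
  · exact le_max_right _ _
  · exact h i

theorem Machine.run_nonneg (X : Params) (δ u : ℝ) (x l i : ℕ) :
    0 ≤ (Machine.run X δ u x l).ρ i := by
  induction l generalizing i with
  | zero => exact le_rfl
  | succ l ih =>
    rw [Machine.run, List.range_succ, List.foldl_append]
    exact Machine.step_nonneg ih i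

/-- The guess `x` leads to a feasible solution of value at most `V`. -/
def GoodGuess (X : Params) (δ u τ : ℝ) (x : ℕ) (V : ℝ) : Prop :=
  ∀ C C' ρ' : ℕ → ℝ, (∀ y < X.k * X.d, C y = (Machine.run X δ u x X.L).C y) →
    (∀ i < X.k, ρ' i = (Machine.run X δ u x X.L).ρ i) → Deduped X.d X.k τ C C' →
    Feasible X.n X.k X.U (Covers X C' ρ') ∧ ∑ i ∈ Finset.range X.k, ρ' i ≤ V

/-- Try one guess. -/
def guessCmd : Cmd := .seq runCmd <| .seq dedupCmd evalCmd

/-- The number of steps of `guessCmd`. -/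
def guessTime (n d k L : ℕ) : ℕ := runTime n d k L + (dedupTime d k + evalTime n d k)

/-- What the search maintains between the states `s` and `s'`, where the guesses satisfying `G`
have been tried in the meantime. -/
def Progress (X : Params) (s s' : State) (G : ℝ → Prop) : Prop :=
  StoreValid X s' ∧ ∀ V, (Achieves s V ∨ G V) → Achieves s' V

/-- The memory is known only on the cells in use, and the shifted centres only through `Deduped`;
this is why `GoodGuess` quantifies over all arrays with these properties. -/
theorem guessCmd_spec {X : Params} {s : State} (hE : Env X s) (hn : 1 ≤ X.n) (hd : 0 < X.d)
    (hk : X.k ≤ 3 * X.L) (hV : StoreValid X s) {δ u τ : ℝ} {x : ℕ} (hτ : 0 < τ)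
    (hδ : s.real 6 0 = δ) (hu : s.real 7 0 = u) (hτ' : s.real 8 0 = τ) (hx : s.nat 14 0 = x)
    (hx' : x < 2 ^ (3 * X.L)) :
    Spec guessCmd s (guessTime X.n X.d X.k X.L) fun s' =>
      Progress X s s' (GoodGuess X δ u τ x) := by
  refine Spec.seq (runCmd_spec hE hn hδ hu hx hx') ?_ (le_refl (_ + _))
  intro s₁ hS hf₁
  have hE₁ := hE.frame hf₁ rfl
  have hV₁ := hV.frame hf₁ rfl rfl rfl rfl
  have hτ₁ : s₁.real 8 0 = τ := by rw [hf₁.real 8 rfl, hτ']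
  refine Spec.seq (dedupCmd_spec hE₁ hd (by rwa [hτ₁])) ?_ le_rfl
  intro s₂ hD hf₂
  have hE₂ := hE₁.frame hf₂ rfl
  have hV₂ := hV₁.frame hf₂ rfl rfl rfl rfl
  have h11 : ∀ i < X.k, s₂.real 11 i = (Machine.run X δ u x X.L).ρ i := by
    rw [hf₂.real 11 rfl]; exact hS.ρ_eq
  rw [hτ₁] at hD
  refine (evalCmd_spec hE₂ hk hV₂ hD.distinct fun i hi => ?_).imp ?_ le_rfl
  · rw [h11 i hi]; exact Machine.run_nonneg ..
  · rintro s₃ ⟨hV₃, hA⟩ -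
    refine ⟨hV₃, fun V h => hA V ?_⟩
    rcases h with h | h
    · exact .inl ((h.frame hf₁ rfl rfl).frame hf₂ rfl rfl)
    · exact .inr (h _ _ _ hS.C_eq h11 hD)

end SumOfRadii

/-! ### Composing the search loops over guesses and units of length. -/

namespace SumOfRadii

open RealRAM

theorem Progress.of_eq {X : Params} {s s' s'' : State} {G : ℝ → Prop} (h : Progress X s s' G)
    (h1 : s''.nat 1 = s'.nat 1) (hr : ∀ a ∈ [2, 3, 14], s''.real a = s'.real a) :
    Progress X s s'' G := by
  have h2 := hr 2 (by simp)
  have h3 := hr 3 (by simp)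
  have h14 := hr 14 (by simp)
  simp only [Progress, StoreValid, Achieves, h1, h2, h3, h14] at h ⊢
  exact h

theorem Progress.trans {X : Params} {s s' s'' : State} {G G' G'' : ℝ → Prop}
    (h : Progress X s s' G) (h' : Progress X s' s'' G') (hG : ∀ V, G'' V → G V ∨ G' V) :
    Progress X s s'' G'' := by
  refine ⟨h'.1, fun V hV => h'.2 V ?_⟩
  rcases hV with hV | hV
  · exact .inl (h.2 V (.inl hV))
  · rcases hG V hV with hV | hV
    · exact .inl (h.2 V (.inr hV))
    · exact .inr hV

theorem Progress.refl {X : Params} {s s' : State} (h : StoreValid X s) (h1 : s'.nat 1 = s.nat 1)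
    (hr : ∀ a ∈ [2, 3, 14], s'.real a = s.real a) : Progress X s s' fun _ => False :=
  Progress.of_eq ⟨h, fun _ hV => hV.resolve_right id⟩ h1 hr

/-- Running a loop amounts to a disjunction over its rounds, so nested loops turn into nested
existential quantifiers in `searchCmd_spec`. -/
theorem forTo_progress {X : Params} {v : ℕ} {b : NExp} {p : Cmd} {s : State} {T T' : ℕ} (N : ℕ)
    (G : ℕ → ℝ → Prop) (hV : StoreValid X s) (hv1 : v ≠ 1)
    (hv : p.writesNat v = false)
    (hb : ∀ s', Frame (forTo v b p) s s' → b.eval s' = N)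
    (hc : b.cost ≤ 10)
    (hstep : ∀ i s', i < N → s'.nat v 0 = i → Frame (forTo v b p) s s' → StoreValid X s' →
      Spec p s' T fun s'' => Progress X s' s'' (G i))
    (hT : N * (T + 30) + 30 ≤ T') :
    Spec (forTo v b p) s T' fun s' => Progress X s s' fun V => ∃ i < N, G i V := by
  refine Spec.forTo N (fun i s' => Progress X s s' fun V => ∃ i' < i, G i' V) hv hb hc ?_ ?_ hT
  · refine (Progress.refl hV ?_ ?_).trans (Progress.refl (s' := s.setNat v 0 0) ?_ rfl (by simp))
      (by simp) (s' := s.setNat v 0 0)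
    · simp [hv1.symm]
    · simp
    · exact (Progress.refl hV (by simp [hv1.symm]) (by simp)).1
  · intro i s₁ hi hvi hf hI
    refine (hstep i s₁ hi hvi hf hI.1).imp (fun s₂ h _ => ?_) le_rfl
    refine (hI.trans h ?_).of_eq (by simp [hv1.symm]) (by simp)
    rintro V ⟨i', hi', hG⟩
    rcases Nat.lt_succ_iff_lt_or_eq.1 hi' with hi' | rfl
    · exact .inl ⟨i', hi', hG⟩
    · exact .inr hG

/-- The unit of length for radii. -/
noncomputable def unit (X : Params) (p q c e : ℕ) : ℝ :=
  2 ^ e * ((X.pt (p * X.d + c) - X.pt (q * X.d + c)) / (8 * X.K))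

/-- The shift that makes centres distinct, for the unit of length `δ`. -/
noncomputable def shift (X : Params) (δ : ℝ) : ℝ := if δ ≤ 0 then 1 else δ / X.k

/-- The guess `x` is good for the given unit of length. -/
def GoodUnitGuess (X : Params) (δ : ℝ) (x : ℕ) : ℝ → Prop :=
  GoodGuess X δ (δ / X.root) (shift X δ) x

/-- Try all guesses, for the unit of length in the real variable `6`, and double it. -/
def unitCmd : Cmd :=
  .seq (.seq (.setReal 7 (.lit 0) (.div (rvar 6) (.cast (.get 6 (.lit 2)))))
    (.ite (.rle (rvar 6) (.cast (.lit 0))) (.setReal 8 (.lit 0) (.cast (.lit 1)))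
      (.setReal 8 (.lit 0) (.div (rvar 6) (.cast (.get 0 (.lit 2))))))) <|
  .seq (forTo 14 (.get 5 (.get 6 (.lit 1))) guessCmd) <|
  .setReal 6 (.lit 0) (.add (rvar 6) (rvar 6))

/-- The number of steps of `unitCmd`. -/
def unitTime (n d k L : ℕ) : ℕ := 2 ^ (3 * L) * (guessTime n d k L + 30) + 100

theorem unitCmd_spec {X : Params} {s : State} (hE : Env X s) (hn : 1 ≤ X.n) (hd : 0 < X.d)
    (hk0 : 1 ≤ X.k) (hk : X.k ≤ 3 * X.L) (hV : StoreValid X s) {δ : ℝ} (hδ : s.real 6 0 = δ) :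
    Spec unitCmd s (unitTime X.n X.d X.k X.L) fun s' => s'.real 6 0 = 2 * δ ∧
      Progress X s s' fun V => ∃ x < 2 ^ (3 * X.L), GoodUnitGuess X δ x V := by
  -- Separating centres needs a positive shift even for a unit `δ ≤ 0`, whence the default value
  -- `1`.
  have hτ : 0 < shift X δ := by
    rw [shift]
    have : (0 : ℝ) < X.k := by exact_mod_cast hk0
    split_ifs with h
    · exact one_pos
    · exact div_pos (not_le.1 h) this
  refine Spec.seq (T₁ := 40) (R := fun s' => s'.real 6 0 = δ ∧ s'.real 7 0 = δ / X.root ∧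
    s'.real 8 0 = shift X δ) (.block rfl (by simp) ?_)
    (T₂ := 2 ^ (3 * X.L) * (guessTime X.n X.d X.k X.L + 30) + 50) ?_ (by rw [unitTime]; omega)
  · rw [shift]
    by_cases h : δ ≤ 0 <;> simp [hδ, h, hE.root_eq, hE.k_eq]
  rintro s₁ ⟨h6, h7, h8⟩ hf₁
  have hE₁ := hE.frame hf₁ rfl
  have hV₁ := hV.frame hf₁ rfl rfl rfl rfl
  refine Spec.seq (forTo_progress (T := guessTime X.n X.d X.k X.L) (2 ^ (3 * X.L))
    (GoodUnitGuess X δ) hV₁ (by decide) rfl ?_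
    (by simp) ?_ le_rfl) (T₂ := 20) ?_ (by omega)
  · intro s' hf
    have h6 : s'.nat 6 1 = 3 * X.L := (congrFun (hf.nat 6 rfl) 1).trans hE₁.L3_eq
    have h5 : s'.nat 5 (3 * X.L) = 2 ^ (3 * X.L) :=
      (congrFun (hf.nat 5 rfl) _).trans (hE₁.pow _ le_rfl)
    simp only [NExp.eval, h6, h5]
  · intro x s₂ hx hv hf hV₂
    exact guessCmd_spec (hE₁.frame hf rfl) hn hd hk hV₂ hτ (by rw [hf.real 6 rfl, h6])
      (by rw [hf.real 7 rfl, h7]) (by rw [hf.real 8 rfl, h8]) hv hx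
  · intro s₂ hP hf
    have h6' : s₂.real 6 0 = δ := by rw [hf.real 6 rfl, h6]
    refine .block rfl (by simp) ⟨?_, ?_⟩
    · simp [h6', two_mul]
    · refine Progress.of_eq (s' := s₂) ?_ (by simp) (by simp)
      refine ⟨hP.1, fun V h => hP.2 V (h.imp_left fun h => h.frame hf₁ rfl rfl)⟩

/-- Try all units of length and all guesses. -/
def searchCmd : Cmd :=
  forTo 10 (.get 0 (.lit 0)) <| forTo 11 (.get 0 (.lit 0)) <| forTo 12 (.get 0 (.lit 1)) <|
    .seq (.setReal 6 (.lit 0) (.div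
      (.sub (.get 1 (.add (.get 3 (var 10)) (var 12))) (.get 1 (.add (.get 3 (var 11)) (var 12))))
      (.mul (.cast (.lit 8)) (rvar 4)))) <|
    forTo 13 (.get 6 (.lit 5)) unitCmd

/-- The number of steps of `searchCmd`. -/
def searchTime (n d k L : ℕ) : ℕ :=
  n * (n * (d * ((d + k + 1) * (unitTime n d k L + 30) + 100) + 60) + 60) + 30

theorem searchCmd_spec {X : Params} {s : State} (hE : Env X s) (hn : 1 ≤ X.n) (hd : 0 < X.d)
    (hk0 : 1 ≤ X.k) (hk : X.k ≤ 3 * X.L) (hV : StoreValid X s) :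
    Spec searchCmd s (searchTime X.n X.d X.k X.L) fun s' =>
      Progress X s s' fun V => ∃ p < X.n, ∃ q < X.n, ∃ c < X.d, ∃ e < X.d + X.k + 1,
        ∃ x < 2 ^ (3 * X.L), GoodUnitGuess X (unit X p q c e) x V := by
  refine forTo_progress (T := X.n * (X.d * ((X.d + X.k + 1) * (unitTime X.n X.d X.k X.L + 30) +
    100) + 60) + 30) X.n _ hV (by decide) rfl ?_ (by simp) ?_ (by rw [searchTime])
  · intro s' hf
    simp only [NExp.eval, hf.nat 0 rfl]
    exact hE.n_eq
  intro p s₁ hp hv₁ hf₁ hV₁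
  have hE₁ := hE.frame hf₁ rfl
  refine forTo_progress (T := X.d * ((X.d + X.k + 1) * (unitTime X.n X.d X.k X.L + 30) +
    100) + 30) X.n _ hV₁ (by decide) rfl ?_ (by simp) ?_ le_rfl
  · intro s' hf
    simp only [NExp.eval, hf.nat 0 rfl]
    exact hE₁.n_eq
  intro q s₂ hq hv₂ hf₂ hV₂
  have hE₂ := hE₁.frame hf₂ rfl
  refine forTo_progress (T := (X.d + X.k + 1) * (unitTime X.n X.d X.k X.L + 30) + 70) X.d _ hV₂
    (by decide) rfl ?_ (by simp) ?_ le_rfl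
  · intro s' hf
    simp only [NExp.eval, hf.nat 0 rfl]
    exact hE₂.d_eq
  intro c s₃ hc hv₃ hf₃ hV₃
  have hE₃ := hE₂.frame hf₃ rfl
  have hp₃ : s₃.nat 10 0 = p := by rw [hf₃.nat 10 rfl, hf₂.nat 10 rfl, hv₁]
  have hq₃ : s₃.nat 11 0 = q := by rw [hf₃.nat 11 rfl, hv₂]
  refine Spec.seq (T₁ := 30) (R := fun s' => s'.real 6 0 = unit X p q c 0)
    (.block rfl (by simp) ?_)
    (T₂ := (X.d + X.k + 1) * (unitTime X.n X.d X.k X.L + 30) + 30) ?_ (by omega)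
  · simp [hp₃, hq₃, hv₃, hE₃.rowD p (by omega), hE₃.rowD q (by omega), hE₃.pt_eq, hE₃.K_eq, unit]
  intro s₄ h6 hf₄
  have hE₄ := hE₃.frame hf₄ rfl
  have hV₄ := hV₃.frame hf₄ rfl rfl rfl rfl
  refine (Spec.forTo (T := unitTime X.n X.d X.k X.L) (X.d + X.k + 1) (fun e s' =>
    s'.real 6 0 = unit X p q c e ∧ Progress X s₄ s' fun V => ∃ e' < e,
      ∃ x < 2 ^ (3 * X.L), GoodUnitGuess X (unit X p q c e') x V) rfl ?_ (by simp) ?_ ?_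
      le_rfl).imp ?_ le_rfl
  · intro s' hf
    simp only [NExp.eval, hf.nat 6 rfl]
    exact hE₄.e_eq
  · refine ⟨by simpa using h6, ?_⟩
    refine (Progress.refl hV₄ ?_ ?_).trans (Progress.refl (s' := s₄.setNat 13 0 0) ?_ rfl
      (by simp)) (by simp) (s' := s₄.setNat 13 0 0)
    · simp
    · simp
    · exact (Progress.refl hV₄ (by simp) (by simp)).1
  · rintro e s₅ he hv₅ hf₅ ⟨h6, hP⟩
    refine (unitCmd_spec (hE₄.frame hf₅ rfl) hn hd hk0 hk hP.1 h6).imp ?_ le_rfl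
    rintro s₆ ⟨h6', hP'⟩ -
    refine ⟨?_, ?_⟩
    · simp only [State.setNat_real, h6', unit]; ring
    · refine (hP.trans hP' ?_).of_eq (by simp) (by simp)
      rintro V ⟨e', he', h⟩
      rcases Nat.lt_succ_iff_lt_or_eq.1 he' with he' | rfl
      · exact .inl ⟨e', he', h⟩
      · exact .inr h
  · rintro s₅ ⟨-, hP⟩ -
    exact ⟨hP.1, fun V h => hP.2 V (h.imp_left fun h => h.frame hf₄ rfl rfl)⟩

/-! ### Extracting an assignment -/

/-- Delete entries of the table in array `25` as long as an assignment exists; what remains is an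
assignment, which is written to the integer array `2`. -/
def assignCmd : Cmd :=
  .seq (coverCmd 2 3) <| forTo 45 (.get 0 (.lit 0)) <| forTo 46 (.get 0 (.lit 2)) <|
    .seq (.setNat 25 (.add (.get 4 (var 45)) (var 46)) (.lit 0)) <|
    .seq hallCmd <|
    .ite (.nle (.lit 1) (var 42)) .skip
      (.seq (.setNat 25 (.add (.get 4 (var 45)) (var 46)) (.lit 1))
        (.setNat 2 (var 45) (var 46)))

/-- The number of steps of `assignCmd`. -/
def assignTime (n d k : ℕ) : ℕ :=
  coverTime n d k + (n * (k * (hallTime n k + 100) + 60) + 30)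

/-- `f` is an assignment of the points to the balls that respects `G` and the capacity `U`. -/
structure IsAssignment (n k U : ℕ) (G : ℕ → ℕ → Prop) (f : ℕ → ℕ) : Prop where
  mem : ∀ p < n, f p < k ∧ G p (f p)
  card_le : ∀ i < k, ((Finset.range n).filter fun p => f p = i).card ≤ U

/-- The table `t` has an assignment, all assignments for `t` are assignments for `G`, and the
entries of `t` satisfying `D` belong to every assignment for `t` and are recorded in `g`. -/
structure Pruned (n k U : ℕ) (G : ℕ → ℕ → Prop) (D : ℕ → ℕ → Prop) (t g : ℕ → ℕ) : Prop where
  le_one : ∀ p < n, ∀ i < k, t (p * k + i) ≤ 1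
  sub : ∀ p < n, ∀ i < k, t (p * k + i) = 1 → G p i
  exists_f : ∃ f, IsAssignment n k U (fun p i => t (p * k + i) = 1) f
  forced : ∀ p < n, ∀ i < k, D p i → t (p * k + i) = 1 →
    g p = i ∧ ∀ f, IsAssignment n k U (fun p i => t (p * k + i) = 1) f → f p = i

/-- Self-reducibility: an incidence is deleted unless this destroys all assignments. An incidence
that is restored lies in every assignment for the current table, and remains so because deleting
entries only removes assignments. In the end the recorded entries form the unique assignment. -/
theorem assignCmd_spec {X : Params} {s : State} (hE : Env X s) (hk : X.k ≤ 3 * X.L)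
    (hF : Feasible X.n X.k X.U (Covers X (s.real 2) (s.real 3))) :
    Spec assignCmd s (assignTime X.n X.d X.k) fun s' =>
      IsAssignment X.n X.k X.U (Covers X (s.real 2) (s.real 3)) (s'.nat 2) := by
  set G := Covers X (s.real 2) (s.real 3) with hG
  refine Spec.seq (coverCmd_spec hE (by decide) (by decide))
    (T₂ := X.n * (X.k * (hallTime X.n X.k + 100) + 60) + 30) ?_ (by rw [assignTime])
  intro s₁ hT hf₁
  have hE₁ := hE.frame hf₁ rfl
  refine (Spec.forTo (T := X.k * (hallTime X.n X.k + 100) + 30) X.n (fun p s' =>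
    Pruned X.n X.k X.U G (fun p' _ => p' < p) (s'.nat 25) (s'.nat 2)) rfl ?_ (by simp) ?_ ?_
    le_rfl).imp ?_ le_rfl
  · intro s' hf
    simp only [NExp.eval, hf.nat 0 rfl]
    exact hE₁.n_eq
  · obtain ⟨f, hf, hU⟩ := hF
    refine ⟨fun p hp i hi => (hT p hp i hi).1, fun p hp i hi => (hT p hp i hi).2.1, ⟨f,
      ⟨fun p hp => ⟨(hf p hp).1, ?_⟩, hU⟩⟩, by simp⟩
    exact (hT p hp _ (hf p hp).1).2.2 (hf p hp).2
  · intro p s₂ hp hv₂ hf₂ hI₂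
    have hE₂ := hE₁.frame hf₂ rfl
    refine (Spec.forTo (T := hallTime X.n X.k + 70) X.k (fun i s' =>
      Pruned X.n X.k X.U G (fun p' i' => p' < p ∨ p' = p ∧ i' < i) (s'.nat 25) (s'.nat 2)) rfl ?_
      (by simp) ?_ ?_ le_rfl).imp ?_ le_rfl
    · intro s' hf
      simp only [NExp.eval, hf.nat 0 rfl]
      exact hE₂.k_eq
    · obtain ⟨h1, h2, h3, h4⟩ := hI₂
      exact ⟨by simpa using h1, by simpa using h2, by simpa using h3, by simpa using h4⟩
    · rintro i s₃ hi hv₃ hf₃ ⟨h1, h2, h3, h4⟩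
      have hE₃ := hE₂.frame hf₃ rfl
      set t := s₃.nat 25 with ht
      set g := s₃.nat 2 with hg
      have h45 : s₃.nat 45 0 = p := by rw [hf₃.nat 45 rfl, hv₂]
      have hix : s₃.nat 4 p = p * X.k := hE₃.rowK p hp
      set t' := Function.update t (p * X.k + i) 0 with ht'
      have ht'1 : ∀ p' < X.n, ∀ i' < X.k, t' (p' * X.k + i') = 1 ↔
          t (p' * X.k + i') = 1 ∧ ¬ (p' = p ∧ i' = i) := by
        intro p' hp' i' hi'
        rw [ht', Function.update_apply]
        simp only [index_inj hi hi']
        split_ifs with h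
        · simp [h]
        · simp [h]
      have ht'0 : ∀ p' < X.n, ∀ i' < X.k, t' (p' * X.k + i') ≤ 1 := by
        intro p' hp' i' hi'
        rw [ht', Function.update_apply]
        split_ifs with h
        · omega
        · exact h1 p' hp' i' hi'
      have hmono : ∀ f, IsAssignment X.n X.k X.U (fun p i => t' (p * X.k + i) = 1) f →
          IsAssignment X.n X.k X.U (fun p i => t (p * X.k + i) = 1) f := fun f hf =>
        ⟨fun p' hp' => ⟨(hf.mem p' hp').1,
          ((ht'1 p' hp' _ (hf.mem p' hp').1).1 (hf.mem p' hp').2).1⟩, hf.card_le⟩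
      refine Spec.seq (T₁ := 20) (R := fun s' => s' = s₃.setNat 25 (p * X.k + i) 0)
        (.block rfl (by simp) (by simp [h45, hv₃, hix])) (T₂ := hallTime X.n X.k + 50) ?_
        (by omega)
      rintro s₄ rfl hf₄
      have hE₄ := hE₃.frame hf₄ rfl
      refine Spec.seq (hallCmd_spec hE₄ hk (G := fun p i => t' (p * X.k + i) = 1)
        fun p' hp' i' hi' => ?_) (T₂ := 50) ?_ le_rfl
      · simp only [State.setNat_nat, if_true]
        exact ⟨ht'0 p' hp' i' hi', Iff.rfl⟩
      rintro s₅ ⟨h42, hfeas⟩ hf₅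
      have h25₅ : s₅.nat 25 = t' := by rw [hf₅.nat 25 rfl]; simp [ht', ht]
      have h2₅ : s₅.nat 2 = g := by rw [hf₅.nat 2 rfl]; simp [hg]
      have h4₅ : s₅.nat 4 = s₃.nat 4 := by rw [hf₅.nat 4 rfl]; simp
      have h45₅ : s₅.nat 45 0 = p := by rw [hf₅.nat 45 rfl, ← h45]; simp
      have h46₅ : s₅.nat 46 0 = i := by rw [hf₅.nat 46 rfl, ← hv₃]; simp
      refine .block rfl (by simp) ?_
      by_cases hok : 1 ≤ s₅.nat 42 0
      · obtain ⟨f, hf, hU⟩ := hfeas.1 (by omega)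
        have goal : Pruned X.n X.k X.U G (fun p' i' => p' < p ∨ p' = p ∧ i' < i + 1) t' g := by
          refine ⟨ht'0, fun p' hp' i' hi' h => h2 p' hp' i' hi' ((ht'1 p' hp' i' hi').1 h).1,
            ⟨f, hf, hU⟩, fun p' hp' i' hi' hD h => ?_⟩
          obtain ⟨ha, hb⟩ := (ht'1 p' hp' i' hi').1 h
          obtain ⟨hc, hd⟩ := h4 p' hp' i' hi' (by omega) ha
          exact ⟨hc, fun f hf => hd f (hmono f hf)⟩
        simpa [hok, h25₅, h2₅] using goal
      · have hne : ∀ f, ¬ IsAssignment X.n X.k X.U (fun p i => t' (p * X.k + i) = 1) f :=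
          fun f hf => hok (hfeas.2 ⟨f, hf.mem, hf.card_le⟩).ge
        -- An assignment avoiding `(p, i)` would survive the deletion.
        have hforce : ∀ f, IsAssignment X.n X.k X.U (fun p i => t (p * X.k + i) = 1) f →
            f p = i := by
          intro f hf
          by_contra hfp
          refine hne f ⟨fun p' hp' => ⟨(hf.mem p' hp').1, ?_⟩, hf.card_le⟩
          refine (ht'1 p' hp' _ (hf.mem p' hp').1).2 ⟨(hf.mem p' hp').2, ?_⟩
          rintro ⟨rfl, h⟩
          exact hfp h
        have htpi : t (p * X.k + i) = 1 := by
          obtain ⟨f, hf⟩ := h3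
          have := (hf.mem p hp).2
          rwa [hforce f hf] at this
        have hback : Function.update t' (p * X.k + i) 1 = t := by
          rw [ht', Function.update_idem, ← htpi, Function.update_eq_self]
        have goal : Pruned X.n X.k X.U G (fun p' i' => p' < p ∨ p' = p ∧ i' < i + 1) t
            (Function.update g p i) := by
          refine ⟨h1, h2, h3, fun p' hp' i' hi' hD h => ?_⟩
          by_cases hpi : p' = p ∧ i' = i
          · obtain ⟨rfl, rfl⟩ := hpi
            exact ⟨by simp, hforce⟩
          · obtain ⟨hc, hd⟩ := h4 p' hp' i' hi' (by omega) h
            refine ⟨?_, hd⟩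
            -- If an earlier incidence of the same point also survives, both are forced, so they
            -- coincide and overwriting the record changes nothing.
            rcases eq_or_ne p' p with rfl | hpp
            · obtain ⟨f, hf⟩ := h3
              rw [Function.update_self, ← hforce f hf, hd f hf]
            · rw [Function.update_of_ne hpp, hc]
        have hix' : s₃.nat 4 p = p * X.k := hix
        simpa [hok, h25₅, h2₅, h4₅, h45₅, h46₅, hix', hback] using goal
    · rintro s₃ ⟨h1, h2, h3, h4⟩ _
      refine ⟨by simpa using h1, by simpa using h2, by simpa using h3, ?_⟩
      intro p' hp' i' hi' hD
      have := h4 p' hp' i' hi' (by omega)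
      simpa using this
  · rintro s₂ ⟨h1, h2, ⟨f, hf⟩, h4⟩ _
    have e : ∀ p < X.n, s₂.nat 2 p = f p := fun p hp =>
      (h4 p hp _ (hf.mem p hp).1 hp (hf.mem p hp).2).1
    refine ⟨fun p hp => ?_, fun i hi => ?_⟩
    · rw [e p hp]
      exact ⟨(hf.mem p hp).1, h2 p hp _ (hf.mem p hp).1 (hf.mem p hp).2⟩
    · convert hf.card_le i hi using 2
      refine Finset.filter_congr fun p hp => ?_
      rw [e p (Finset.mem_range.1 hp)]

end SumOfRadii

namespace SumOfRadii

open RealRAM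

/-! ### Computing the constants -/

/-- Compute `max 2 (k / ε)`. -/
def ratioCmd : Cmd :=
  .ite (.rle (.div (.cast (.get 0 (.lit 2))) (.get 0 (.lit 0))) (.cast (.lit 2)))
    (.setReal 4 (.lit 0) (.cast (.lit 2)))
    (.setReal 4 (.lit 0) (.div (.cast (.get 0 (.lit 2))) (.get 0 (.lit 0))))

/-- Compute the least `a` with `K ≤ 2 ^ a`. -/
def logCmd : Cmd :=
  .seq (.seq (.setReal 5 (.lit 0) (.cast (.lit 1))) (.setNat 6 (.lit 3) (.lit 0))) <|
  .loop (.not (.rle (rvar 4) (rvar 5))) <|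
    .seq (.setReal 5 (.lit 0) (.add (rvar 5) (rvar 5)))
      (.setNat 6 (.lit 3) (.add (.get 6 (.lit 3)) (.lit 1)))

/-- Compute the length of a guess. -/
def lengthCmd : Cmd :=
  .seq (.setNat 6 (.lit 0) (.lit 0)) <|
  .seq (forTo 10 (.get 0 (.lit 2)) <| forTo 11 (.get 0 (.lit 1)) <|
    .setNat 6 (.lit 0)
      (.add (var 6) (.add (.add (.get 6 (.lit 3)) (.get 6 (.lit 3))) (.lit 36)))) <|
  .seq (.setNat 6 (.lit 1) (.add (.add (var 6) (var 6)) (var 6)))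
    (.setNat 6 (.lit 5) (.add (.add (.get 0 (.lit 1)) (.get 0 (.lit 2))) (.lit 1)))

/-- Compute the least `r` with `d ≤ r ^ 2`. -/
def rootCmd : Cmd :=
  .seq (.setNat 6 (.lit 2) (.lit 0)) <|
  .loop (.not (.rle (.cast (.get 0 (.lit 1)))
      (.mul (.cast (.get 6 (.lit 2))) (.cast (.get 6 (.lit 2)))))) <|
    .setNat 6 (.lit 2) (.add (.get 6 (.lit 2)) (.lit 1))

/-- Write the multiples of `y` to the array `A`. -/
def multiplesCmd (A : ℕ) (b y : NExp) : Cmd :=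
  .seq (.setNat 15 (.lit 0) (.lit 0)) <|
  forTo 10 b (.seq (.setNat A (var 10) (var 15)) (.setNat 15 (.lit 0) (.add (var 15) y)))

/-- Write the powers of `2` to the array `5`. -/
def powersCmd : Cmd :=
  .seq (.setNat 15 (.lit 0) (.lit 1)) <|
  forTo 10 (.add (.get 6 (.lit 1)) (.lit 1))
    (.seq (.setNat 5 (var 10) (var 15)) (.setNat 15 (.lit 0) (.add (var 15) (var 15))))

/-- Compute all constants. -/
def setupCmd : Cmd :=
  .seq ratioCmd <| .seq logCmd <| .seq lengthCmd <| .seq rootCmd <|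
  .seq (multiplesCmd 3 (.add (.get 0 (.lit 0)) (.get 0 (.lit 2))) (.get 0 (.lit 1))) <|
  .seq (multiplesCmd 4 (.get 0 (.lit 0)) (.get 0 (.lit 2))) powersCmd

theorem ratioCmd_spec {s : State} {k : ℕ} {ε : ℝ} (hk : s.nat 0 2 = k) (hε : s.real 0 0 = ε) :
    Spec ratioCmd s 50 fun s' => s'.real 4 0 = max 2 (k / ε) := by
  refine .block rfl (by simp [ratioCmd]) ?_
  by_cases h : (k : ℝ) / ε ≤ 2
  · simp [ratioCmd, hk, hε, h]
  · simp [ratioCmd, hk, hε, h, (not_le.1 h).le]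

theorem logCmd_spec {s : State} {K : ℝ} {a : ℕ} (hK : s.real 4 0 = K) (ha : K ≤ 2 ^ a)
    (ha' : ∀ i < a, ¬ K ≤ 2 ^ i) : Spec logCmd s (a * 40 + 40) fun s' => s'.nat 6 3 = a := by
  refine Spec.seq (T₁ := 10) (R := fun s' => s'.real 4 0 = K ∧ s'.real 5 0 = 1 ∧ s'.nat 6 3 = 0)
    (.block rfl (by simp) (by simp [hK])) (T₂ := a * 40 + 30) ?_ (by omega)
  rintro s₁ ⟨h4, h5, h6⟩ -
  refine (Spec.loop (T := 20) (N := a) (fun i s' => s'.real 5 0 = 2 ^ i ∧ s'.nat 6 3 = i)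
    ⟨by simpa using h5, h6⟩ ?_ ?_).imp (fun s' h _ => h.2) ?_
  · rintro i s' hi hf ⟨h5', h6'⟩
    have h4' : s'.real 4 0 = K := by rw [hf.real 4 rfl, h4]
    refine ⟨by simpa [h4', h5'] using ha' i hi, .block rfl (by simp) ?_⟩
    simp [h5', h6']
    ring
  · rintro s' hf ⟨h5', h6'⟩
    have h4' : s'.real 4 0 = K := by rw [hf.real 4 rfl, h4]
    simpa [h4', h5'] using ha
  · simp; omega

theorem lengthCmd_spec {s : State} {k d a : ℕ} (hk : s.nat 0 2 = k) (hd : s.nat 0 1 = d)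
    (ha : s.nat 6 3 = a) : Spec lengthCmd s (k * (d * 60 + 60) + 80) fun s' =>
      s'.nat 6 0 = k * d * (2 * a + 36) ∧ s'.nat 6 1 = 3 * (k * d * (2 * a + 36)) ∧
      s'.nat 6 5 = d + k + 1 := by
  refine Spec.seq (T₁ := 3) (R := fun s' => s' = s.setNat 6 0 0)
    (.block rfl (by simp) (by simp)) (T₂ := k * (d * 60 + 60) + 70) ?_ (by omega)
  rintro s₁ rfl -
  refine Spec.seq (R := fun s' => s'.nat 6 0 = k * d * (2 * a + 36) ∧ s'.nat 6 3 = a)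
    (Spec.forTo (T := d * 60 + 30) (T' := k * (d * 60 + 60) + 30) k
      (fun i s' => s'.nat 6 0 = i * d * (2 * a + 36) ∧ s'.nat 6 3 = a) rfl ?_ (by simp)
      ?_ ?_ le_rfl)
    (T₂ := 40) ?_ (by omega)
  · intro s' hf
    simp only [NExp.eval, hf.nat 0 rfl]
    exact hk
  · simpa using ha
  · rintro i s₂ hi hv hf ⟨h0, h3⟩
    refine (Spec.forTo (T := 30) d
      (fun j s' => s'.nat 6 0 = (i * d + j) * (2 * a + 36) ∧ s'.nat 6 3 = a) rfl ?_ (by simp) ?_ ?_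
      le_rfl).imp ?_ le_rfl
    · intro s' hf'
      simp only [NExp.eval, hf'.nat 0 rfl]
      exact (congrFun (hf.nat 0 rfl) 1).trans hd
    · simpa [h3] using h0
    · rintro j s₃ hj hv' hf' ⟨h0', h3'⟩
      refine .block rfl (by simp) ?_
      simp [h0', h3']
      ring
    · rintro s₃ ⟨h0', h3'⟩ -
      refine ⟨?_, by simpa using h3'⟩
      simp [h0']
      ring
  · rintro s₂ ⟨h0, h3⟩ hf
    have hk' : s₂.nat 0 2 = k := (congrFun (hf.nat 0 rfl) 2).trans hk
    have hd' : s₂.nat 0 1 = d := (congrFun (hf.nat 0 rfl) 1).trans hd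
    refine .block rfl (by simp) ?_
    simp [h0, hk', hd']
    ring

theorem rootCmd_spec {s : State} {d r : ℕ} (hd : s.nat 0 1 = d) (hr : d ≤ r * r)
    (hr' : ∀ i < r, ¬ d ≤ i * i) : Spec rootCmd s (r * 40 + 40) fun s' => s'.nat 6 2 = r ∧
      ∀ i ≠ 2, s'.nat 6 i = s.nat 6 i := by
  refine Spec.seq (T₁ := 3) (R := fun s' => s' = s.setNat 6 2 0)
    (.block rfl (by simp) (by simp)) (T₂ := r * 40 + 30) ?_ (by omega)
  rintro s₁ rfl -
  refine (Spec.loop (T := 10) (N := r) (fun i s' => s'.nat 6 2 = i ∧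
    ∀ i ≠ 2, s'.nat 6 i = s.nat 6 i) ⟨by simp, fun i hi => by simp [hi]⟩ ?_ ?_).imp
    (fun s' h _ => h) ?_
  · rintro i s' hi hf ⟨h6, h⟩
    have hd' : s'.nat 0 1 = d := (congrFun (hf.nat 0 rfl) 1).trans hd
    refine ⟨?_, .block rfl (by simp) ⟨by simp [h6], fun i hi => by simpa [hi] using h i hi⟩⟩
    have := hr' i hi
    simp only [Test.eval, RExp.eval, NExp.eval, h6, hd']
    exact_mod_cast this
  · rintro s' hf ⟨h6, h⟩
    have hd' : s'.nat 0 1 = d := (congrFun (hf.nat 0 rfl) 1).trans hd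
    simp only [Test.eval, RExp.eval, NExp.eval, h6, hd', not_not]
    exact_mod_cast hr
  · simp; omega

theorem multiplesCmd_spec {s : State} {A N z : ℕ} {b y : NExp}
    (hA : A ≠ 0 ∧ A ≠ 10 ∧ A ≠ 15)
    (hb : ∀ s' : State, s'.nat 0 = s.nat 0 → b.eval s' = N)
    (hy : ∀ s' : State, s'.nat 0 = s.nat 0 → y.eval s' = z) (hbc : b.cost ≤ 5) (hyc : y.cost ≤ 5) :
    Spec (multiplesCmd A b y) s (N * 60 + 40) fun s' => ∀ i < N, s'.nat A i = i * z := by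
  obtain ⟨hA0, hA10, hA15⟩ := hA
  refine Spec.seq (T₁ := 3) (R := fun s' => s' = s.setNat 15 0 0)
    (.block rfl (by simp) (by simp)) (T₂ := N * 60 + 30) ?_ (by omega)
  rintro s₁ rfl -
  refine (Spec.forTo (T := 30) N (fun i s' => s'.nat 15 0 = i * z ∧ ∀ j < i, s'.nat A j = j * z)
    ?_ ?_ (by omega) (by simp) ?_ le_rfl).imp (fun s' h _ => h.2) le_rfl
  · simp [Cmd.writesNat, hA10]
  · intro s' hf
    exact hb s' (by rw [hf.nat 0 (by simp [forTo, Cmd.writesNat, hA0])]; simp)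
  · rintro i s' hi hv hf ⟨h15, h⟩
    have h0 : s'.nat 0 = s.nat 0 := by
      rw [hf.nat 0 (by simp [forTo, Cmd.writesNat, hA0])]; simp
    refine .block rfl (by simp; omega) ?_
    have hy' := hy (s'.setNat A i (i * z)) (by simp [hA0.symm, h0])
    have hy'' : ∀ v, NExp.eval (s'.setNat A i v) y = z := fun v =>
      hy (s'.setNat A i v) (by simp [hA0.symm, h0])
    refine ⟨?_, fun j hj => ?_⟩
    · simp [hv, hA15.symm, h15, hy'', Nat.succ_mul]
    · simp only [Cmd.exec, NExp.eval, State.setNat_nat, hv, hA15, hA10, if_false, if_true,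
        Function.update_apply]
      rcases Nat.lt_succ_iff_lt_or_eq.1 hj with hj | rfl
      · rw [if_neg (by omega), h j hj]
      · rw [if_pos rfl, h15]

theorem powersCmd_spec {s : State} {N : ℕ} (hN : s.nat 6 1 = N) :
    Spec powersCmd s ((N + 1) * 60 + 40) fun s' => ∀ i ≤ N, s'.nat 5 i = 2 ^ i := by
  refine Spec.seq (T₁ := 3) (R := fun s' => s' = s.setNat 15 0 1)
    (.block rfl (by simp) (by simp)) (T₂ := (N + 1) * 60 + 30) ?_ (by omega)
  rintro s₁ rfl -
  refine (Spec.forTo (T := 30) (N + 1) (fun i s' => s'.nat 15 0 = 2 ^ i ∧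
    ∀ j < i, s'.nat 5 j = 2 ^ j) rfl ?_ (by simp) (by simp) ?_ le_rfl).imp
    (fun s' h _ i hi => h.2 i (by omega)) le_rfl
  · intro s' hf
    simp only [NExp.eval, hf.nat 6 rfl]
    exact congrArg (· + 1) hN
  · rintro i s' hi hv hf ⟨h15, h⟩
    refine .block rfl (by simp) ⟨?_, fun j hj => ?_⟩
    · simp [h15]; ring
    · simp only [Cmd.exec, NExp.eval, State.setNat_nat, hv]
      rcases Nat.lt_succ_iff_lt_or_eq.1 hj with hj | rfl
      · simpa [hj.ne] using h j hj
      · simpa using h15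

/-- The number of steps of `setupCmd`. -/
def setupTime (n d k a r L : ℕ) : ℕ :=
  50 + (a * 40 + 40) + (k * (d * 60 + 60) + 80) + (r * 40 + 40) + ((n + k) * 60 + 40) +
    (n * 60 + 40) + ((3 * L + 1) * 60 + 40)

theorem setupCmd_spec {s : State} {n d k U a r : ℕ} {ε : ℝ} (hn : s.nat 0 0 = n)
    (hd : s.nat 0 1 = d) (hk : s.nat 0 2 = k) (hU : s.nat 0 3 = U) (hε : s.real 0 0 = ε)
    (ha : max 2 (k / ε) ≤ 2 ^ a) (ha' : ∀ i < a, ¬ max 2 (k / ε) ≤ 2 ^ i) (hr : d ≤ r * r)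
    (hr' : ∀ i < r, ¬ d ≤ i * i) :
    Spec setupCmd s (setupTime n d k a r (k * d * (2 * a + 36))) fun s' =>
      Env ⟨n, d, k, U, k * d * (2 * a + 36), r, max 2 (k / ε), s.real 1⟩ s' := by
  set L := k * d * (2 * a + 36) with hL
  refine Spec.seq (ratioCmd_spec hk hε) (T₂ := (a * 40 + 40) + (k * (d * 60 + 60) + 80) +
    (r * 40 + 40) + ((n + k) * 60 + 40) + (n * 60 + 40) + ((3 * L + 1) * 60 + 40)) ?_
    (by rw [setupTime]; omega)
  intro s₁ h4 hf₁
  refine Spec.seq (logCmd_spec h4 ha ha') (T₂ := (k * (d * 60 + 60) + 80) +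
    (r * 40 + 40) + ((n + k) * 60 + 40) + (n * 60 + 40) + ((3 * L + 1) * 60 + 40)) ?_ (by omega)
  intro s₂ h63 hf₂
  have e2 : s₂.nat 0 = s.nat 0 := (hf₂.nat 0 rfl).trans (hf₁.nat 0 rfl)
  refine Spec.seq (lengthCmd_spec (by rw [e2, hk]) (by rw [e2, hd]) h63) (T₂ :=
    (r * 40 + 40) + ((n + k) * 60 + 40) + (n * 60 + 40) + ((3 * L + 1) * 60 + 40)) ?_ (by omega)
  rintro s₃ ⟨h60, h61, h65⟩ hf₃
  have e3 : s₃.nat 0 = s.nat 0 := (hf₃.nat 0 rfl).trans e2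
  refine Spec.seq (rootCmd_spec (by rw [e3, hd]) hr hr') (T₂ :=
    ((n + k) * 60 + 40) + (n * 60 + 40) + ((3 * L + 1) * 60 + 40)) ?_ (by omega)
  rintro s₄ ⟨h62, h6⟩ hf₄
  have e4 : s₄.nat 0 = s.nat 0 := (hf₄.nat 0 rfl).trans e3
  refine Spec.seq (multiplesCmd_spec (N := n + k) (z := d) (by decide) (fun s' h => ?_)
    (fun s' h => ?_) (by simp) (by simp)) (T₂ := (n * 60 + 40) + ((3 * L + 1) * 60 + 40)) ?_
    (by omega)
  · simp [h, e4, hn, hk]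
  · simp [h, e4, hd]
  intro s₅ h3 hf₅
  have e5 : s₅.nat 0 = s.nat 0 := (hf₅.nat 0 rfl).trans e4
  refine Spec.seq (multiplesCmd_spec (N := n) (z := k) (by decide) (fun s' h => ?_)
    (fun s' h => ?_) (by simp) (by simp)) (T₂ := (3 * L + 1) * 60 + 40) ?_ le_rfl
  · simp [h, e5, hn]
  · simp [h, e5, hk]
  intro s₆ h4' hf₆
  have e6 : s₆.nat 6 = s₄.nat 6 := (hf₆.nat 6 rfl).trans (hf₅.nat 6 rfl)
  refine (powersCmd_spec (N := 3 * L) (by rw [e6, h6 1 (by decide), h61])).imp ?_ le_rfl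
  intro s₇ h5 hf₇
  have e0 : s₇.nat 0 = s.nat 0 := (hf₇.nat 0 rfl).trans ((hf₆.nat 0 rfl).trans e5)
  have e7 : s₇.nat 6 = s₄.nat 6 := (hf₇.nat 6 rfl).trans e6
  refine ⟨?_, ?_, ?_, ?_, ?_, ?_, h5, ?_, ?_, ?_, ?_, ?_, ?_⟩
  · rw [e0, hn]
  · rw [e0, hd]
  · rw [e0, hk]
  · rw [e0, hU]
  · rw [hf₇.nat 3 rfl, hf₆.nat 3 rfl]; exact h3
  · rw [hf₇.nat 4 rfl]; exact h4'
  · rw [e7, h6 0 (by decide), h60]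
  · rw [e7, h6 1 (by decide), h61]
  · rw [e7, h62]
  · rw [e7, h6 5 (by decide), h65]
  · rw [hf₇.real 1 rfl, hf₆.real 1 rfl, hf₅.real 1 rfl, hf₄.real 1 rfl, hf₃.real 1 rfl,
      hf₂.real 1 rfl, hf₁.real 1 rfl]
  · rw [hf₇.real 4 rfl, hf₆.real 4 rfl, hf₅.real 4 rfl, hf₄.real 4 rfl, hf₃.real 4 rfl,
      hf₂.real 4 rfl, h4]

/-- The algorithm. -/
def mainCmd : Cmd :=
  .seq setupCmd <| .seq searchCmd <| .ite (.nle (.lit 1) (.get 1 (.lit 0))) assignCmd .skip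

/-- The number of steps of `mainCmd`. -/
def mainTime (n d k a r L : ℕ) : ℕ :=
  setupTime n d k a r L + (searchTime n d k L + (assignTime n d k + 10))

/-- The answer cell is initially `0`, so the stored solution is vacuously valid. The last conjunct,
applied to any guess that works, also excludes the answer `0`. -/
theorem mainCmd_spec {s : State} {n d k U a r : ℕ} {ε : ℝ} (hn : s.nat 0 0 = n)
    (hd : s.nat 0 1 = d) (hk : s.nat 0 2 = k) (hU : s.nat 0 3 = U) (hε : s.real 0 0 = ε)
    (ha : max 2 (k / ε) ≤ 2 ^ a) (ha' : ∀ i < a, ¬ max 2 (k / ε) ≤ 2 ^ i) (hr : d ≤ r * r)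
    (hr' : ∀ i < r, ¬ d ≤ i * i) (hn1 : 1 ≤ n) (hd1 : 1 ≤ d) (hk1 : 1 ≤ k)
    (hout : s.nat 1 0 = 0) {X : Params}
    (hX : X = ⟨n, d, k, U, k * d * (2 * a + 36), r, max 2 (k / ε), s.real 1⟩) :
    Spec mainCmd s (mainTime n d k a r (k * d * (2 * a + 36))) fun s' =>
      (s'.nat 1 0 = 0 ∨ s'.nat 1 0 = 1 ∧
        (∀ i < X.k, ∀ j < i, ¬ SameRow X.d (s'.real 2) i j) ∧ (∀ i < X.k, 0 ≤ s'.real 3 i) ∧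
        IsAssignment X.n X.k X.U (Covers X (s'.real 2) (s'.real 3)) (s'.nat 2)) ∧
      ∀ V, (∃ p < X.n, ∃ q < X.n, ∃ c < X.d, ∃ e < X.d + X.k + 1, ∃ x < 2 ^ (3 * X.L),
        GoodUnitGuess X (unit X p q c e) x V) →
        s'.nat 1 0 = 1 ∧ ∑ i ∈ Finset.range X.k, s'.real 3 i ≤ V := by
  have hkL : X.k ≤ 3 * X.L := by
    subst hX
    calc k = k * 1 * 1 := by ring
      _ ≤ k * d * (2 * a + 36) := by gcongr; omega
      _ ≤ _ := Nat.le_mul_of_pos_left _ (by norm_num)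
  refine Spec.seq (setupCmd_spec hn hd hk hU hε ha ha' hr hr') (T₂ :=
    searchTime n d k (k * d * (2 * a + 36)) + (assignTime n d k + 10)) ?_ (by rw [mainTime])
  intro s₁ hE₁ hf₁
  rw [← hX] at hE₁
  have h1 : s₁.nat 1 0 = 0 := by rw [hf₁.nat 1 rfl, hout]
  have hV₁ : StoreValid X s₁ := ⟨by omega, by omega⟩
  have hs := searchCmd_spec hE₁ (by subst hX; exact hn1) (by subst hX; exact hd1)
    (by subst hX; exact hk1) hkL hV₁
  refine Spec.seq (T₁ := searchTime n d k (k * d * (2 * a + 36))) (T₂ := assignTime n d k + 10)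
    (hs.imp (fun _ h _ => h) (by subst hX; exact le_rfl)) ?_ le_rfl
  rintro s₂ ⟨hV₂, hA⟩ hf₂
  have hE₂ := hE₁.frame hf₂ rfl
  refine Spec.ite (T' := assignTime n d k + 5) (fun h => ?_) (fun h => ?_)
    (by simp; omega)
  · simp only [Test.eval, NExp.eval] at h
    have h1₂ : s₂.nat 1 0 = 1 := le_antisymm hV₂.1 h
    obtain ⟨hdist, hρ, hF, hsum⟩ := hV₂.2 h1₂
    refine (assignCmd_spec hE₂ hkL hF).imp (fun s₃ h₃ hf₃ => ?_)
      (by subst hX; exact Nat.le_add_right _ _)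
    rw [hf₃.nat 1 rfl, hf₃.real 2 rfl, hf₃.real 3 rfl]
    refine ⟨.inr ⟨h1₂, hdist, hρ, h₃⟩, fun V hV => ⟨h1₂, ?_⟩⟩
    rw [← hsum]
    exact (hA V (.inr hV)).2
  · simp only [Test.eval, NExp.eval] at h
    refine .block rfl (by simp) ⟨.inl (show s₂.nat 1 0 = 0 by omega), fun V hV => ?_⟩
    exact absurd (hA V (.inr hV)).1.ge h

end SumOfRadii

/-! ### The approximation argument: every clustering is reached by some guess. -/

namespace SumOfRadii

open RealRAM

/-! ### Encoding positions and radii by instructions -/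

/-- What is known about the constants; `a` is a binary logarithm of `K`, rounded up. -/
structure Params.Valid (X : Params) (a : ℕ) : Prop where
  n_pos : 1 ≤ X.n
  d_pos : 1 ≤ X.d
  k_pos : 1 ≤ X.k
  two_le : 2 ≤ X.K
  K_le : X.K ≤ 2 ^ a
  root_ge : X.d ≤ X.root * X.root
  root_le : X.root * X.root ≤ 4 * X.d
  L_eq : X.L = X.k * X.d * (2 * a + 36)

/-- The state of the machine after a list of instructions. -/
noncomputable def Machine.steps (X : Params) (δ u : ℝ) (v : Machine) (w : List ℕ) : Machine :=
  w.foldl (fun v g => v.step X δ u g) v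

theorem Machine.steps_append (X : Params) (δ u : ℝ) (v : Machine) (w w' : List ℕ) :
    v.steps X δ u (w ++ w') = (v.steps X δ u w).steps X δ u w' := List.foldl_append

/-- Digits are `-1, 0, 1`, encoded as `0, 1, 2`. Halving towards zero leaves a last digit with the
sign of `z`, so negative numbers need no separate sign. -/
theorem exists_digits (X : Params) (δ u : ℝ) (l : ℕ) (z : ℤ) (hz : z.natAbs < 2 ^ l) :
    ∃ w : List ℕ, w.length ≤ l ∧ (∀ g ∈ w, g < 8) ∧ ∀ v : Machine, v.a = 0 →
      v.steps X δ u w = { v with a := z } := by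
  induction l generalizing z with
  | zero =>
    obtain rfl : z = 0 := by omega
    refine ⟨[], by simp, by simp, fun v hv => ?_⟩
    cases v
    simp_all [Machine.steps]
  | succ l ih =>
    obtain ⟨q, b, hb, hb', hzq, hq⟩ :
        ∃ q b : ℤ, -1 ≤ b ∧ b ≤ 1 ∧ q + q + b = z ∧ q.natAbs < 2 ^ l := by
      rw [pow_succ] at hz
      rcases le_total 0 z with h | h
      · exact ⟨z / 2, z % 2, by omega, by omega, by omega, by omega⟩
      · exact ⟨-(-z / 2), -(-z % 2), by omega, by omega, by omega, by omega⟩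
    obtain ⟨w, hw, hw8, h⟩ := ih q hq
    refine ⟨w ++ [(b + 1).toNat], by simpa using hw, ?_, fun v hv => ?_⟩
    · intro g hg
      rcases List.mem_append.1 hg with hg | hg
      · exact hw8 g hg
      · rw [List.mem_singleton] at hg
        omega
    · rw [Machine.steps_append, h v hv]
      have e1 : (b + 1).toNat ≤ 2 := by omega
      have e2 : (((b + 1).toNat : ℕ) : ℝ) = b + 1 := by
        have : (((b + 1).toNat : ℕ) : ℤ) = b + 1 := Int.toNat_of_nonneg (by omega)
        exact_mod_cast congrArg (Int.cast : ℤ → ℝ) this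
      have e3 : (q : ℝ) + q + (b + 1) - 1 = z := by
        rw [← hzq]
        push_cast
        ring
      simp only [Machine.steps, List.foldl_cons, List.foldl_nil, Machine.step, e1, if_true, e2, e3]

/-- The bound exceeds `a` by a term linear in `|z|`. It can therefore be summed over coordinates
using only the average size of the coefficients, with no factor `log d`. -/
theorem exists_digits' (X : Params) (δ u : ℝ) (a : ℕ) (z : ℤ) :
    ∃ w : List ℕ, w.length ≤ a + z.natAbs / 2 ^ a ∧ (∀ g ∈ w, g < 8) ∧ ∀ v : Machine, v.a = 0 →
      v.steps X δ u w = { v with a := z } := by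
  refine exists_digits X δ u _ z ?_
  have h1 := Nat.lt_mul_div_succ z.natAbs (show 0 < 2 ^ a by positivity)
  have h2 : z.natAbs / 2 ^ a + 1 ≤ 2 ^ (z.natAbs / 2 ^ a) := Nat.lt_two_pow_self
  calc z.natAbs < 2 ^ a * (z.natAbs / 2 ^ a + 1) := h1
    _ ≤ 2 ^ a * 2 ^ (z.natAbs / 2 ^ a) := Nat.mul_le_mul_left _ h2
    _ = _ := (pow_add _ _ _).symm

/-- The reference point of the machine. -/
noncomputable def Machine.base (X : Params) (v : Machine) (c : ℕ) : ℝ :=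
  if v.q < v.m then v.C (v.q * X.d + c) else X.pt (v.f * X.d + c)

theorem exists_coordinates (X : Params) (δ u : ℝ) (a : ℕ) (z : ℕ → ℤ) (v : Machine)
    (hm : v.m < X.k) (ha : v.a = 0) (hj : v.j = 0) (l : ℕ) (hl : l ≤ X.d) :
    ∃ w : List ℕ, w.length ≤ ∑ c ∈ Finset.range l, (a + (z c).natAbs / 2 ^ a + 1) ∧
      (∀ g ∈ w, g < 8) ∧ ∃ C', v.steps X δ u w = { v with j := l, C := C' } ∧
      (∀ c < l, C' (v.m * X.d + c) = v.base X c + z c * u) ∧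
      ∀ y, (∀ c < l, y ≠ v.m * X.d + c) → C' y = v.C y := by
  induction l with
  | zero =>
    refine ⟨[], by simp, by simp, v.C, ?_, by simp, by simp⟩
    cases v
    simp_all [Machine.steps]
  | succ l ih =>
    obtain ⟨w, hw, hw8, C', hs, h1, h2⟩ := ih (by omega)
    obtain ⟨w', hw', hw8', h'⟩ := exists_digits' X δ u a (z l)
    refine ⟨w ++ (w' ++ [3]), ?_, ?_, Function.update C' (v.m * X.d + l) (v.base X l + z l * u),
      ?_, ?_, ?_⟩
    · rw [Finset.sum_range_succ]
      simp only [List.length_append, List.length_singleton]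
      omega
    · intro g hg
      simp only [List.mem_append, List.mem_singleton] at hg
      rcases hg with hg | hg | rfl
      · exact hw8 g hg
      · exact hw8' g hg
      · norm_num
    · rw [Machine.steps_append, Machine.steps_append, hs, h' { v with j := l, C := C' } ha]
      -- The reference row `q` differs from the row `m` being written, so it is unaffected by the
      -- coordinates already stored.
      have hbase : (if v.q < v.m then C' (v.q * X.d + l) else X.pt (v.f * X.d + l)) =
          v.base X l := by
        rw [Machine.base]
        split_ifs with hq
        · refine h2 _ fun c hc e => ?_
          have := ((index_inj (by omega) (by omega)).1 e).1
          omega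
        · rfl
      simp [Machine.steps, Machine.step, hm, show l < X.d by omega, hbase, ha]
    · intro c hc
      rcases Nat.lt_succ_iff_lt_or_eq.1 hc with hc | rfl
      · rw [Function.update_of_ne (by omega), h1 c hc]
      · rw [Function.update_self]
    · intro y hy
      rw [Function.update_of_ne (hy l (by omega))]
      exact h2 y fun c hc => hy c (by omega)

theorem exists_ball (X : Params) {δ : ℝ} (u : ℝ) (hδ : 0 ≤ δ) (a : ℕ) (z : ℕ → ℤ) (N : ℕ)
    (v : Machine) (hm : v.m < X.k) (ha : v.a = 0) (hj : v.j = 0) :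
    ∃ w : List ℕ, w.length ≤ ∑ c ∈ Finset.range X.d, (a + (z c).natAbs / 2 ^ a + 1) +
      (a + N / 2 ^ a + 1) ∧ (∀ g ∈ w, g < 8) ∧ ∃ C', v.steps X δ u w =
        { v with m := v.m + 1, C := C', ρ := Function.update v.ρ v.m (N * δ) } ∧
      (∀ c < X.d, C' (v.m * X.d + c) = v.base X c + z c * u) ∧
      ∀ y, (∀ c < X.d, y ≠ v.m * X.d + c) → C' y = v.C y := by
  obtain ⟨w, hw, hw8, C', hs, h1, h2⟩ := exists_coordinates X δ u a z v hm ha hj X.d le_rfl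
  obtain ⟨w', hw', hw8', h'⟩ := exists_digits' X δ u a N
  refine ⟨w ++ (w' ++ [3]), ?_, ?_, C', ?_, h1, h2⟩
  · simp only [List.length_append, List.length_singleton]
    rw [Int.natAbs_natCast] at hw'
    omega
  · intro g hg
    simp only [List.mem_append, List.mem_singleton] at hg
    rcases hg with hg | hg | rfl
    · exact hw8 g hg
    · exact hw8' g hg
    · norm_num
  · rw [Machine.steps_append, Machine.steps_append, hs, h' { v with j := X.d, C := C' } ha]
    have : 0 ≤ (N : ℝ) * δ := by positivity
    simp [Machine.steps, Machine.step, hm, ha, hj, this]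

/-! ### Rows as vectors -/

/-- Row `i` of a table with row length `d`. -/
def row (d : ℕ) (A : ℕ → ℝ) (i : ℕ) : EuclideanSpace ℝ (Fin d) :=
  WithLp.toLp 2 fun j => A (i * d + j)

theorem sqDist_eq (d : ℕ) (A B : ℕ → ℝ) (i j : ℕ) :
    sqDist d A (i * d) B (j * d) = dist (row d A i) (row d B j) ^ 2 := by
  rw [EuclideanSpace.dist_eq, Real.sq_sqrt (Finset.sum_nonneg fun _ _ => sq_nonneg _), sqDist,
    Finset.sum_range]
  refine Finset.sum_congr rfl fun c _ => ?_
  rw [Real.dist_eq, sq_abs, sq]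
  rfl

/-- Squares are compared because the machine has no roots; this is faithful only for nonnegative
radii. -/
theorem covers_iff {X : Params} {C ρ : ℕ → ℝ} {p i : ℕ} (h : 0 ≤ ρ i) :
    Covers X C ρ p i ↔ dist (row X.d X.pt p) (row X.d C i) ≤ ρ i := by
  rw [Covers, sqDist_eq, ← sq, sq_le_sq₀ dist_nonneg h]

theorem sameRow_iff {d : ℕ} {C : ℕ → ℝ} {i j : ℕ} : SameRow d C i j ↔ row d C i = row d C j := by
  constructor
  · intro h
    ext c
    exact h c c.2
  · intro h c hc
    exact congrArg (fun v : EuclideanSpace ℝ (Fin d) => v ⟨c, hc⟩) h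

/-- A displacement can be rounded to the grid, with coefficients that are small on average. -/
theorem exists_rounding {X : Params} {a : ℕ} (hX : X.Valid a) {δ : ℝ} (hδ : 0 ≤ δ)
    (Δ : EuclideanSpace ℝ (Fin X.d)) (hΔ : ‖Δ‖ ≤ 11 * X.K * δ) :
    ∃ z : ℕ → ℤ, ‖Δ - WithLp.toLp 2 fun j : Fin X.d => (z j : ℝ) * (δ / X.root)‖ ≤ δ ∧
      ∑ c ∈ Finset.range X.d, (a + (z c).natAbs / 2 ^ a + 1) ≤ X.d * (a + 24) := by
  have hK := hX.two_le
  have hd : (1 : ℝ) ≤ X.d := by exact_mod_cast hX.d_pos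
  -- Division by `2 ^ a ≥ K` turns the bound `23 K d` into `23 d`, and the remaining `d (a + 1)`
  -- digits complete `d (a + 24)`.
  suffices H : ∃ z : Fin X.d → ℤ, ‖Δ - WithLp.toLp 2 fun j => (z j : ℝ) * (δ / X.root)‖ ≤ δ ∧
      ∑ c, |(z c : ℝ)| ≤ 23 * X.K * X.d by
    obtain ⟨z, hz, hsum⟩ := H
    refine ⟨fun c => if h : c < X.d then z ⟨c, h⟩ else 0, by simpa using hz, ?_⟩
    have key : ∑ c ∈ Finset.range X.d, ((if h : c < X.d then z ⟨c, h⟩ else 0).natAbs / 2 ^ a) ≤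
        23 * X.d := by
      have : ((∑ c ∈ Finset.range X.d,
          ((if h : c < X.d then z ⟨c, h⟩ else 0).natAbs / 2 ^ a) : ℕ) : ℝ) ≤ 23 * X.d := by
        rw [Finset.sum_range]
        push_cast
        calc ∑ c : Fin X.d, (((if h : (c : ℕ) < X.d then z ⟨c, h⟩ else 0).natAbs / 2 ^ a : ℕ) : ℝ)
            ≤ ∑ c, |(z c : ℝ)| / 2 ^ a := by
              refine Finset.sum_le_sum fun c _ => Nat.cast_div_le.trans ?_
              simp [Nat.cast_natAbs]
          _ = (∑ c, |(z c : ℝ)|) / 2 ^ a := by rw [Finset.sum_div]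
          _ ≤ 23 * X.d := by
              rw [div_le_iff₀ (by positivity)]
              calc _ ≤ 23 * X.K * X.d := hsum
                _ = 23 * X.d * X.K := by ring
                _ ≤ _ := by gcongr; exact hX.K_le
      exact_mod_cast this
    have e : ∀ f : ℕ → ℕ, ∑ c ∈ Finset.range X.d, (a + f c + 1) =
        X.d * (a + 1) + ∑ c ∈ Finset.range X.d, f c := by
      intro f
      simp only [Finset.sum_add_distrib, Finset.sum_const, Finset.card_range, smul_eq_mul]
      ring
    rw [e]
    calc _ ≤ X.d * (a + 1) + 23 * X.d := by gcongr
      _ = _ := by ring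
  rcases hδ.eq_or_lt with rfl | hδ
  · have : Δ = 0 := by simpa using hΔ
    exact ⟨0, by simp [this]; rfl, by simp; positivity⟩
  have hr1 : 1 ≤ X.root := by
    by_contra h
    have h0 : X.root = 0 := by omega
    have := hX.root_ge
    have := hX.d_pos
    simp [h0] at *
    omega
  have hr : (1 : ℝ) ≤ X.root := by exact_mod_cast hr1
  set u := δ / X.root with hu
  have hu0 : 0 < u := by positivity
  -- Rounding down errs by at most `u` per coordinate, hence by at most `√d · u ≤ δ` in norm.
  refine ⟨fun j => ⌊Δ j / u⌋, ?_, ?_⟩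
  · rw [EuclideanSpace.norm_eq]
    refine Real.sqrt_le_iff.2 ⟨hδ.le, ?_⟩
    calc ∑ i, ‖(Δ - WithLp.toLp 2 fun j => ((⌊Δ j / u⌋ : ℤ) : ℝ) * u) i‖ ^ 2
        ≤ ∑ i : Fin X.d, u ^ 2 := by
          refine Finset.sum_le_sum fun i _ => ?_
          rw [Real.norm_eq_abs, sq_abs]
          have h1 := Int.floor_le (Δ i / u)
          have h2 := (Int.lt_floor_add_one (Δ i / u)).le
          rw [le_div_iff₀ hu0] at h1
          rw [div_le_iff₀ hu0] at h2
          simp only [PiLp.sub_apply]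
          refine pow_le_pow_left₀ (by linarith) ?_ 2
          linarith
      _ = X.d * u ^ 2 := by simp
      _ ≤ (X.root * X.root) * u ^ 2 := by
          gcongr
          exact_mod_cast hX.root_ge
      _ = δ ^ 2 := by rw [hu]; field_simp
  · have hsum : (∑ i, |Δ i|) ^ 2 ≤ X.d * ‖Δ‖ ^ 2 := by
      have := sq_sum_le_card_mul_sum_sq (s := Finset.univ) (f := fun i => |Δ i|)
      simpa [EuclideanSpace.norm_eq, Real.sq_sqrt (Finset.sum_nonneg fun _ _ => sq_nonneg _)]
        using this
    -- Cauchy–Schwarz and `root ^ 2 ≤ 4 d`: the square is at most `4 d · d · (11 K δ) ^ 2`. Flooring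
    -- adds at most `1` per coordinate, whence `22 K d + d ≤ 23 K d`.
    have h2 : X.root * ∑ i, |Δ i| ≤ 22 * X.K * X.d * δ := by
      refine abs_le_of_sq_le_sq' ?_ (by positivity) |>.2
      calc (X.root * ∑ i, |Δ i|) ^ 2 = (X.root * X.root) * (∑ i, |Δ i|) ^ 2 := by ring
        _ ≤ (4 * X.d) * (X.d * (11 * X.K * δ) ^ 2) := by
          refine mul_le_mul (by exact_mod_cast hX.root_le) (hsum.trans ?_) (by positivity)
            (by positivity)
          gcongr
        _ = _ := by ring
    calc ∑ c, |((⌊Δ c / u⌋ : ℤ) : ℝ)| ≤ ∑ c, (|Δ c| / u + 1) := by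
          refine Finset.sum_le_sum fun c _ => ?_
          have h1 := Int.floor_le (Δ c / u)
          have h2 := (Int.lt_floor_add_one (Δ c / u)).le
          have h3 : |Δ c| / u = |Δ c / u| := by rw [abs_div, abs_of_pos hu0]
          rw [h3, abs_le]
          have h4 := abs_le.1 (le_refl |Δ c / u|)
          constructor <;> linarith
      _ = (X.root * ∑ c, |Δ c|) / δ + X.d := by
          rw [Finset.sum_add_distrib, ← Finset.sum_div, hu]
          simp
          field_simp
      _ ≤ 22 * X.K * X.d + X.d := by
          gcongr
          rwa [div_le_iff₀ hδ]
      _ ≤ _ := by nlinarith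

end SumOfRadii

namespace SumOfRadii

open RealRAM

/-! ### Every clustering is found -/

/-- A capacitated clustering; the centres need not be distinct. -/
structure Clustering (X : Params) where
  c : Fin X.k → EuclideanSpace ℝ (Fin X.d)
  r : Fin X.k → ℝ
  μ : ℕ → Fin X.k
  r_nonneg : ∀ i, 0 ≤ r i
  dist_le : ∀ p < X.n, dist (row X.d X.pt p) (c (μ p)) ≤ r (μ p)
  card_le : ∀ i, ((Finset.range X.n).filter fun p => μ p = i).card ≤ X.U

/-- The value of a clustering. -/
def Clustering.value {X : Params} (T : Clustering X) : ℝ := ∑ i, T.r i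

theorem Clustering.r_le_value {X : Params} (T : Clustering X) (i : Fin X.k) : T.r i ≤ T.value :=
  Finset.single_le_sum (fun i _ => T.r_nonneg i) (Finset.mem_univ i)

theorem Clustering.add_le_value {X : Params} (T : Clustering X) {i l : Fin X.k} (h : i ≠ l) :
    T.r i + T.r l ≤ T.value := by
  rw [← Finset.sum_pair h]
  exact Finset.sum_le_sum_of_subset_of_nonneg (Finset.subset_univ _) fun i _ _ => T.r_nonneg i

/-- The cluster `i` contains a point. -/
def Clustering.Nonempty {X : Params} (T : Clustering X) (i : Fin X.k) : Prop :=
  ∃ p < X.n, T.μ p = i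

/-- The balls placed so far approximate the clusters `π 0, π 1, …` of `T`, and all clusters near
the first `q` of these have been placed. -/
structure Tracks (X : Params) (T : Clustering X) (δ : ℝ) (v : Machine) (π : ℕ → Fin X.k) :
    Prop where
  j_eq : v.j = 0
  a_eq : v.a = 0
  f_lt : v.f < X.n
  q_le : v.q ≤ v.m
  inj : ∀ i < v.m, ∀ i' < v.m, π i = π i' → i = i'
  nonempty : ∀ i < v.m, T.Nonempty (π i)
  dist_le : ∀ i < v.m, dist (row X.d v.C i) (T.c (π i)) ≤ δ
  radius : ∀ i < v.m, T.r (π i) + 2 * δ ≤ v.ρ i ∧ v.ρ i ≤ T.r (π i) + 3 * δ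
  radius_zero : ∀ i, v.m ≤ i → v.ρ i = 0
  near : ∀ i < v.q, ∀ l, T.Nonempty l → (∀ i' < v.m, π i' ≠ l) →
    T.r (π i) + T.r l + 4 * δ < dist (T.c (π i)) (T.c l)
  uncovered : v.q = v.m → (∀ p < X.n, ∃ i < v.m, Covers X v.C v.ρ p i) ∨
    ¬ ∃ i < v.m, Covers X v.C v.ρ v.f i

/-- Placed balls stand for different clusters, so there are at most `k` of them, and fewer while
some cluster is missing. -/
theorem card_placed {k m : ℕ} {π : ℕ → Fin k} (h : ∀ i < m, ∀ i' < m, π i = π i' → i = i') :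
    m ≤ k ∧ ∀ l, (∀ i < m, π i ≠ l) → m < k := by
  have hc : ((Finset.range m).image π).card = m := by
    rw [Finset.card_image_of_injOn, Finset.card_range]
    intro i hi i' hi' e
    exact h i (by simpa using hi) i' (by simpa using hi') e
  refine ⟨?_, fun l hl => ?_⟩
  · have := Finset.card_le_univ ((Finset.range m).image π)
    rwa [hc, Fintype.card_fin] at this
  · have : (Finset.range m).image π ⊂ Finset.univ := by
      refine Finset.ssubset_univ_iff.2 fun e => ?_
      have hl' : l ∈ (Finset.range m).image π := e ▸ Finset.mem_univ l
      obtain ⟨i, hi, h'⟩ := Finset.mem_image.1 hl'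
      exact hl i (Finset.mem_range.1 hi) h'
    have := Finset.card_lt_card this
    rwa [hc, Finset.card_univ, Fintype.card_fin] at this

/-- The enlargement of the radius exceeds the error of the centre. Used in contrapositive form: an
uncovered point belongs to a cluster not yet placed. -/
theorem Tracks.covers {X : Params} {T : Clustering X} {δ : ℝ} {v : Machine} {π : ℕ → Fin X.k}
    (h : Tracks X T δ v π) (hδ : 0 ≤ δ) {p i : ℕ} (hp : p < X.n) (hi : i < v.m)
    (e : π i = T.μ p) : Covers X v.C v.ρ p i := by
  have h1 := (h.radius i hi).1
  have h2 := T.r_nonneg (π i)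
  rw [covers_iff (by linarith)]
  have h3 := T.dist_le p hp
  have h4 := h.dist_le i hi
  rw [← e] at h3
  have := dist_triangle_right (row X.d X.pt p) (row X.d v.C i) (T.c (π i))
  linarith

/-- The number of instructions that suffices to place a ball. -/
def ballLength (d a : ℕ) : ℕ := d * (a + 24) + (a + 11)

/-- Take `N = ⌈r / δ⌉ + 2`, which is at most `8 K + 3 ≤ 10 · 2 ^ a`. If `δ = 0`, the hypothesis
forces `r = 0`. -/
theorem exists_radius {X : Params} {a : ℕ} (hX : X.Valid a) {δ r : ℝ} (hδ : 0 ≤ δ) (hr : 0 ≤ r)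
    (hr' : r ≤ 8 * X.K * δ) : ∃ N : ℕ, r + 2 * δ ≤ N * δ ∧ N * δ ≤ r + 3 * δ ∧
      N / 2 ^ a ≤ 10 := by
  rcases hδ.eq_or_lt with rfl | hδ
  · obtain rfl : r = 0 := le_antisymm (by simpa using hr') hr
    exact ⟨0, by simp, by simp, by simp⟩
  refine ⟨⌈r / δ⌉₊ + 2, ?_, ?_, ?_⟩
  · have := Nat.le_ceil (r / δ)
    rw [div_le_iff₀ hδ] at this
    push_cast
    linarith
  · have := (Nat.ceil_lt_add_one (show 0 ≤ r / δ by positivity)).le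
    have h2 : (⌈r / δ⌉₊ : ℝ) * δ ≤ (r / δ + 1) * δ := by gcongr
    rw [add_mul, div_mul_cancel₀ _ hδ.ne'] at h2
    push_cast
    linarith
  · have h1 := (Nat.ceil_lt_add_one (show 0 ≤ r / δ by positivity)).le
    have h2 : r / δ ≤ 8 * X.K := by rwa [div_le_iff₀ hδ]
    have h3 := hX.two_le
    have h4 := hX.K_le
    have : ((⌈r / δ⌉₊ + 2 : ℕ) : ℝ) ≤ ((10 * 2 ^ a : ℕ) : ℝ) := by
      push_cast
      linarith
    have h5 : ⌈r / δ⌉₊ + 2 ≤ 10 * 2 ^ a := by exact_mod_cast this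
    exact Nat.div_le_of_le_mul (by rwa [mul_comm])

/-- Any missing cluster close to the current reference point can be placed next, by encoding the
rounded displacement and the rounded radius. `near` survives because placing a ball only shrinks the
set of missing clusters. -/
theorem Tracks.place {X : Params} {T : Clustering X} {δ : ℝ} {v : Machine} {π : ℕ → Fin X.k}
    {a : ℕ} (hX : X.Valid a) (h : Tracks X T δ v π) (hδ : 0 ≤ δ) (h8 : T.value ≤ 8 * X.K * δ)
    {l : Fin X.k} (hl : T.Nonempty l) (hl' : ∀ i < v.m, π i ≠ l)
    (hb : dist (T.c l) (if v.q < v.m then row X.d v.C v.q else row X.d X.pt v.f) ≤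
      11 * X.K * δ) :
    ∃ w : List ℕ, w.length ≤ ballLength X.d a ∧ (∀ g ∈ w, g < 8) ∧
      (v.steps X δ (δ / X.root) w).m = v.m + 1 ∧ (v.steps X δ (δ / X.root) w).q = v.q ∧
      Tracks X T δ (v.steps X δ (δ / X.root) w) (Function.update π v.m l) := by
  have hm : v.m < X.k := (card_placed h.inj).2 l hl'
  set b := (if v.q < v.m then row X.d v.C v.q else row X.d X.pt v.f) with hbdef
  obtain ⟨z, hz, hzlen⟩ := exists_rounding hX hδ (T.c l - b) (by rwa [← dist_eq_norm])
  obtain ⟨N, hN1, hN2, hN3⟩ := exists_radius hX hδ (T.r_nonneg l) ((T.r_le_value l).trans h8)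
  obtain ⟨w, hw, hw8, C', hs, hC1, hC2⟩ :=
    exists_ball X (δ / X.root) hδ a z N v hm h.a_eq h.j_eq
  refine ⟨w, ?_, hw8, by rw [hs], by rw [hs], ?_⟩
  · rw [ballLength]; omega
  have hrow : ∀ i < v.m, row X.d C' i = row X.d v.C i := by
    intro i hi
    ext c
    refine hC2 _ fun c' hc' e => ?_
    have := ((index_inj hc' c.2).1 e).1
    omega
  have hrowm : row X.d C' v.m =
      b + WithLp.toLp 2 fun j : Fin X.d => (z j : ℝ) * (δ / X.root) := by
    ext c
    have h1 := hC1 c c.2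
    have h2 : v.base X c = b c := by
      rw [Machine.base, hbdef]
      split_ifs <;> rfl
    rw [h2] at h1
    exact h1
  rw [hs]
  have hπ : ∀ i < v.m, Function.update π v.m l i = π i := fun i hi =>
    Function.update_of_ne hi.ne _ _
  have hρ : ∀ i < v.m, Function.update v.ρ v.m (N * δ) i = v.ρ i := fun i hi =>
    Function.update_of_ne hi.ne _ _
  constructor
  · exact h.j_eq
  · exact h.a_eq
  · exact h.f_lt
  · exact h.q_le.trans (Nat.le_succ _)
  · intro i hi i' hi' e
    dsimp only at hi hi'
    rcases Nat.lt_succ_iff_lt_or_eq.1 hi with hi | rfl <;>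
      rcases Nat.lt_succ_iff_lt_or_eq.1 hi' with hi' | rfl
    · rw [hπ i hi, hπ i' hi'] at e
      exact h.inj i hi i' hi' e
    · rw [hπ i hi, Function.update_self] at e
      exact absurd e (hl' i hi)
    · rw [hπ i' hi', Function.update_self] at e
      exact absurd e.symm (hl' i' hi')
    · rfl
  · intro i hi
    rcases Nat.lt_succ_iff_lt_or_eq.1 hi with hi | rfl
    · rw [hπ i hi]; exact h.nonempty i hi
    · rwa [Function.update_self]
  · intro i hi
    rcases Nat.lt_succ_iff_lt_or_eq.1 hi with hi | rfl
    · rw [hπ i hi]; dsimp only; rw [hrow i hi]; exact h.dist_le i hi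
    · rw [Function.update_self]
      dsimp only
      rw [hrowm, dist_comm, dist_eq_norm, ← sub_sub]
      exact hz
  · intro i hi
    rcases Nat.lt_succ_iff_lt_or_eq.1 hi with hi | rfl
    · rw [hπ i hi]; dsimp only; rw [hρ i hi]; exact h.radius i hi
    · rw [Function.update_self]
      dsimp only
      rw [Function.update_self]
      exact ⟨hN1, hN2⟩
  · intro i hi
    dsimp only at hi ⊢
    rw [Function.update_of_ne (by omega)]
    exact h.radius_zero i (by omega)
  · intro i hi l' hl₁ hl₂
    have hi' : i < v.m := hi.trans_le h.q_le
    rw [hπ i hi']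
    refine h.near i hi l' hl₁ fun i' hi' => ?_
    have := hl₂ i' (Nat.lt_succ_of_lt hi')
    rwa [hπ i' hi'] at this
  -- Vacuous: `q ≤ m < m + 1`.
  · intro e
    have := h.q_le
    dsimp only at e
    omega

/-- The default `f` can be returned only if all points scanned are covered. -/
theorem lastUncovered_spec (X : Params) (C ρ : ℕ → ℝ) (m f n : ℕ) :
    (∀ p < n, ∃ i < m, Covers X C ρ p i) ∨
      ¬ ∃ i < m, Covers X C ρ (lastUncovered X C ρ m f n) i := by
  induction n with
  | zero => exact .inl (by simp)
  | succ n ih =>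
    rw [lastUncovered]
    split_ifs with hc
    · refine ih.imp_left fun h p hp => ?_
      rcases Nat.lt_succ_iff_lt_or_eq.1 hp with hp | rfl
      · exact h p hp
      · exact hc
    · exact .inr hc

theorem Tracks.advance {X : Params} {T : Clustering X} {δ : ℝ} (u : ℝ) {v : Machine}
    {π : ℕ → Fin X.k} (h : Tracks X T δ v π) (hq : v.q < v.m)
    (hnear : ∀ l, T.Nonempty l → (∀ i' < v.m, π i' ≠ l) →
      T.r (π v.q) + T.r l + 4 * δ < dist (T.c (π v.q)) (T.c l)) :
    (v.steps X δ u [4]).m = v.m ∧ (v.steps X δ u [4]).q = v.q + 1 ∧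
      Tracks X T δ (v.steps X δ u [4]) π := by
  have e : v.steps X δ u [4] =
      { v with q := v.q + 1, f := lastUncovered X v.C v.ρ v.m v.f X.n } := by
    simp [Machine.steps, Machine.step, hq]
  rw [e]
  refine ⟨rfl, rfl, h.j_eq, h.a_eq, lastUncovered_lt h.f_lt _ le_rfl, hq, h.inj, h.nonempty,
    h.dist_le, h.radius, h.radius_zero, fun i hi => ?_, fun _ => lastUncovered_spec ..⟩
  rcases Nat.lt_succ_iff_lt_or_eq.1 hi with hi | rfl
  · exact h.near i hi
  · exact hnear

/-- Induction on the remaining placements and advances. If `q < m`, either a missing cluster is near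
ball `q` and is placed relative to it, or `q` advances. If `q = m`, an uncovered point leads to a
missing cluster, and without one nothing is missing. -/
theorem Tracks.complete {X : Params} {T : Clustering X} {δ : ℝ} {a : ℕ} (hX : X.Valid a)
    (hδ : 0 ≤ δ) (h8 : T.value ≤ 8 * X.K * δ) (N : ℕ) :
    ∀ {v : Machine} {π : ℕ → Fin X.k}, Tracks X T δ v π → (X.k - v.m) + (X.k - v.q) = N →
    ∃ w : List ℕ, w.length ≤ (X.k - v.m) * ballLength X.d a + (X.k - v.q) ∧ (∀ g ∈ w, g < 8) ∧
      ∃ π', Tracks X T δ (v.steps X δ (δ / X.root) w) π' ∧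
        ∀ p < X.n, ∃ i < (v.steps X δ (δ / X.root) w).m, π' i = T.μ p := by
  induction N using Nat.strong_induction_on with
  | _ N ih =>
  intro v π h hN
  have hmk := (card_placed h.inj).1
  have hK := hX.two_le
  have place : ∀ l, T.Nonempty l → (∀ i < v.m, π i ≠ l) →
      dist (T.c l) (if v.q < v.m then row X.d v.C v.q else row X.d X.pt v.f) ≤ 11 * X.K * δ →
      ∃ w : List ℕ, w.length ≤ (X.k - v.m) * ballLength X.d a + (X.k - v.q) ∧ (∀ g ∈ w, g < 8) ∧
      ∃ π', Tracks X T δ (v.steps X δ (δ / X.root) w) π' ∧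
        ∀ p < X.n, ∃ i < (v.steps X δ (δ / X.root) w).m, π' i = T.μ p := by
    intro l hl hl' hb
    have hm : v.m < X.k := (card_placed h.inj).2 l hl'
    obtain ⟨w, hw, hw8, e1, e2, ht⟩ := h.place hX hδ h8 hl hl' hb
    obtain ⟨w', hw', hw8', π', ht', hall⟩ := ih _ (by rw [e1, e2] at *; omega) ht rfl
    refine ⟨w ++ w', ?_, ?_, π', by rwa [Machine.steps_append], by rwa [Machine.steps_append]⟩
    · rw [e1, e2] at hw'
      obtain ⟨x, hx⟩ : ∃ x, X.k - v.m = x + 1 := ⟨X.k - v.m - 1, by omega⟩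
      have : X.k - (v.m + 1) = x := by omega
      rw [this] at hw'
      rw [hx, Nat.succ_mul, List.length_append]
      omega
    · intro g hg
      rcases List.mem_append.1 hg with hg | hg
      exacts [hw8 g hg, hw8' g hg]
  rcases h.q_le.lt_or_eq with hq | hq
  · by_cases hex : ∃ l, T.Nonempty l ∧ (∀ i < v.m, π i ≠ l) ∧
        dist (T.c (π v.q)) (T.c l) ≤ T.r (π v.q) + T.r l + 4 * δ
    · obtain ⟨l, hl, hl', hd⟩ := hex
      refine place l hl hl' ?_
      rw [if_pos hq]
      -- The two clusters differ, so `r_q + r_l` is at most the value; the distance is at most `8Kδ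
      -- + 4δ + δ ≤ 11Kδ` because `K ≥ 2`.
      have h1 := T.add_le_value (hl' v.q hq)
      have h2 := h.dist_le v.q hq
      have h3 := dist_triangle_left (T.c l) (row X.d v.C v.q) (T.c (π v.q))
      rw [dist_comm (T.c (π v.q)) (row X.d v.C v.q)] at h3
      nlinarith
    · obtain ⟨e1, e2, ht⟩ := h.advance (δ / X.root) hq fun l hl hl' => by
        by_contra hc
        exact hex ⟨l, hl, hl', not_lt.1 hc⟩
      obtain ⟨w', hw', hw8', π', ht', hall⟩ := ih _ (by rw [e1, e2] at *; omega) ht rfl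
      refine ⟨[4] ++ w', ?_, ?_, π', by rwa [Machine.steps_append], by rwa [Machine.steps_append]⟩
      · rw [e1, e2] at hw'
        rw [List.length_append, List.length_singleton]
        omega
      · intro g hg
        rcases List.mem_append.1 hg with hg | hg
        · rw [List.mem_singleton] at hg; omega
        · exact hw8' g hg
  · rcases h.uncovered hq with hcov | hunc
    · refine ⟨[], by simp, by simp, π, h, fun p hp => ?_⟩
      change ∃ i < v.m, π i = T.μ p
      by_contra hno
      push Not at hno
      obtain ⟨i, hi, hc⟩ := hcov p hp
      have h1 := (h.radius i hi)
      have h0 := T.r_nonneg (π i)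
      rw [covers_iff (by linarith)] at hc
      have h2 := h.near i (by omega) (T.μ p) ⟨p, hp, rfl⟩ hno
      have h3 := h.dist_le i hi
      have h4 := T.dist_le p hp
      -- A covered point of a missing cluster would bring the two centres within `δ + (r_i + 3δ) +
      -- r_l`, which is exactly the threshold in `near`.
      have h6 := dist_triangle4 (T.c (π i)) (row X.d v.C i) (row X.d X.pt p) (T.c (T.μ p))
      rw [dist_comm (T.c (π i)) (row X.d v.C i),
        dist_comm (row X.d v.C i) (row X.d X.pt p)] at h6
      linarith
    · have hl' : ∀ i < v.m, π i ≠ T.μ v.f := fun i hi e =>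
        hunc ⟨i, hi, h.covers hδ h.f_lt hi e⟩
      refine place (T.μ v.f) ⟨v.f, h.f_lt, rfl⟩ hl' ?_
      rw [if_neg (by omega), dist_comm]
      have h1 := T.dist_le v.f h.f_lt
      have h2 := T.r_le_value (T.μ v.f)
      nlinarith

/-- Instructions are octal digits, so a word of them is read off from three bits each. -/
theorem exists_guess (w : List ℕ) (hw : ∀ g ∈ w, g < 8) :
    ∃ x < 2 ^ (3 * w.length), ∀ i (h : i < w.length), instr x i = w[i] := by
  obtain ⟨x, hx, hb⟩ := exists_binary (3 * w.length)
    (fun t => decide (w.getD (t / 3) 0 / 2 ^ (t % 3) % 2 = 1))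
  refine ⟨x, hx, fun i hi => ?_⟩
  have h8 := hw _ (List.getElem_mem hi)
  have e : w.getD i 0 = w[i] := by simp [hi]
  rw [instr, hb _ (by omega), hb _ (by omega), hb _ (by omega),
    show 3 * i / 3 = i by omega, show (3 * i + 1) / 3 = i by omega,
    show (3 * i + 2) / 3 = i by omega, show 3 * i % 3 = 0 by omega,
    show (3 * i + 1) % 3 = 1 by omega, show (3 * i + 2) % 3 = 2 by omega, e]
  generalize w[i] = g at h8
  interval_cases g <;> simp

theorem Machine.run_eq_steps {X : Params} {δ u : ℝ} {x : ℕ} {w : List ℕ}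
    (h : ∀ i (h : i < w.length), instr x i = w[i]) :
    Machine.run X δ u x w.length = Machine.init.steps X δ u w := by
  have e : (List.range w.length).map (instr x) = w :=
    List.ext_getElem (by simp) fun i h1 h2 => by simpa using h i h2
  rw [Machine.run, Machine.steps, ← List.foldl_map (f := instr x)
    (g := fun v g => Machine.step X δ u v g), e]

/-- Completing the empty configuration takes at most `k (ballLength + 1) ≤ L` instructions; the word
is then padded to length `L`. -/
theorem exists_run {X : Params} {T : Clustering X} {δ : ℝ} {a : ℕ} (hX : X.Valid a) (hδ : 0 ≤ δ)
    (h8 : T.value ≤ 8 * X.K * δ) : ∃ x < 2 ^ (3 * X.L), ∃ π,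
      Tracks X T δ (Machine.run X δ (δ / X.root) x X.L) π ∧
      ∀ p < X.n, ∃ i < (Machine.run X δ (δ / X.root) x X.L).m, π i = T.μ p := by
  -- No ball has been placed, so `q = m = 0` and the point `0` is trivially uncovered.
  have h0 : Tracks X T δ .init fun _ => ⟨0, hX.k_pos⟩ := by
    refine ⟨rfl, rfl, hX.n_pos, le_rfl, ?_, ?_, ?_, ?_, fun _ _ => rfl, ?_, fun _ => .inr ?_⟩ <;>
      simp [Machine.init]
  obtain ⟨w, hw, hw8, π, hT, hall⟩ := Tracks.complete hX hδ h8 _ h0 rfl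
  have hlen : w.length ≤ X.L := by
    refine hw.trans ?_
    rw [hX.L_eq]
    have hd := hX.d_pos
    have h1 : ballLength X.d a + 1 ≤ X.d * (2 * a + 36) := by
      have : 1 * (a + 12) ≤ X.d * (a + 12) := Nat.mul_le_mul_right _ hd
      have e : X.d * (2 * a + 36) = X.d * (a + 24) + X.d * (a + 12) := by ring
      rw [ballLength, e]
      omega
    calc _ = X.k * (ballLength X.d a + 1) := by simp [Machine.init]; ring
      _ ≤ X.k * (X.d * (2 * a + 36)) := Nat.mul_le_mul_left _ h1
      _ = _ := by ring
  obtain ⟨l, hl⟩ := Nat.exists_eq_add_of_le hlen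
  -- Instruction `1` appends the digit `0` to an accumulator that is zero, so it changes nothing.
  have hpad : ∀ v : Machine, v.a = 0 →
      v.steps X δ (δ / X.root) (List.replicate l 1) = v := by
    intro v hv
    clear hl
    have h1 : v.step X δ (δ / X.root) 1 = v := by
      cases v
      simp_all [Machine.step]
    induction l with
    | zero => rfl
    | succ l ih => rw [List.replicate_succ, Machine.steps, List.foldl_cons, h1]; exact ih
  obtain ⟨x, hx, hxi⟩ := exists_guess (w ++ List.replicate l 1) (fun g hg => by
    rcases List.mem_append.1 hg with hg | hg
    · exact hw8 g hg
    · rw [List.eq_of_mem_replicate hg]; norm_num)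
  have hrun := Machine.run_eq_steps (X := X) (δ := δ) (u := δ / X.root) hxi
  rw [Machine.steps_append, hpad _ hT.a_eq] at hrun
  have hL : (w ++ List.replicate l 1).length = X.L := by simp [hl]
  rw [hL] at hrun hx
  exact ⟨x, hx, π, by rwa [hrun], by rwa [hrun]⟩

/-- Rounding and separation each move a placed centre by at most `δ`, which the enlarged radii
absorb, so `T.μ` itself is still an admissible assignment. Rows that were never placed have radius
zero and cost nothing. -/
theorem exists_goodUnitGuess {X : Params} {T : Clustering X} {δ : ℝ} {a : ℕ} (hX : X.Valid a)
    (hinj : ∀ p < X.n, ∀ q < X.n, row X.d X.pt p = row X.d X.pt q → p = q)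
    (hδ : 0 ≤ δ) (h8 : T.value ≤ 8 * X.K * δ) :
    ∃ x < 2 ^ (3 * X.L), GoodUnitGuess X δ x (T.value + 3 * X.k * δ) := by
  obtain ⟨x, hx, π, hT, hall⟩ := exists_run hX hδ h8
  refine ⟨x, hx, fun C C' ρ' hC hρ hD => ?_⟩
  set v := Machine.run X δ (δ / X.root) x X.L with hv
  have hmk : v.m ≤ X.k := (card_placed hT.inj).1
  have hd := hX.d_pos
  have hk : (0 : ℝ) < X.k := by exact_mod_cast hX.k_pos
  have hrowC : ∀ i < X.k, row X.d C i = row X.d v.C i := fun i hi => by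
    ext c
    exact hC _ (index_lt hi c.2)
  have hother : ∀ i, ∀ c < X.d, c ≠ 0 → C' (i * X.d + c) = C (i * X.d + c) := by
    intro i c hc hc0
    refine hD.other _ fun i' _ e => ?_
    have := (index_inj (p := i') (i := 0) (p' := i) (i' := c) hd hc).1 (by simpa using e)
    exact hc0 this.2
  have hshift : ∀ i < v.m, dist (row X.d C' i) (row X.d v.C i) ≤ δ := by
    intro i hi
    rw [← hrowC i (by omega)]
    have key : ∀ t, C' (i * X.d) = C (i * X.d) + t → |t| ≤ δ →
        dist (row X.d C' i) (row X.d C i) ≤ δ := by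
      intro t ht htδ
      have e : row X.d C' i = row X.d C i + EuclideanSpace.single (⟨0, hd⟩ : Fin X.d) t := by
        ext c
        by_cases hc : c = ⟨0, hd⟩
        · subst hc
          simpa [row] using ht
        · have hc' : (c : ℕ) ≠ 0 := fun h => hc (Fin.ext h)
          simpa [row, hc] using hother i c c.2 hc'
      rw [e, dist_eq_norm, add_sub_cancel_left, PiLp.norm_single]
      exact htδ
    rcases hδ.eq_or_lt with h0 | hpos
    · refine key 0 ?_ (by simpa using hδ)
      rw [add_zero]
      refine hD.fixed v.m (fun i₁ hi₁ i₂ hi₂ hs => ?_) i (by omega) hi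
      rw [sameRow_iff, hrowC i₁ (by omega), hrowC i₂ (by omega)] at hs
      have hval : T.value ≤ 0 := by simpa [← h0] using h8
      have hc : ∀ i < v.m, ∃ p < X.n, T.μ p = π i ∧ row X.d X.pt p = row X.d v.C i := by
        intro i hi
        obtain ⟨p, hp, e⟩ := hT.nonempty i hi
        refine ⟨p, hp, e, ?_⟩
        have h1 := T.dist_le p hp
        have h2 := hT.dist_le i hi
        have h3 := T.r_le_value (T.μ p)
        rw [e] at h1 h3
        have h5 := dist_triangle_right (row X.d X.pt p) (row X.d v.C i) (T.c (π i))
        exact dist_le_zero.1 (by linarith)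
      obtain ⟨p₁, hp₁, e₁, e₁'⟩ := hc i₁ hi₁
      obtain ⟨p₂, hp₂, e₂, e₂'⟩ := hc i₂ (by omega)
      have hp := hinj p₁ hp₁ p₂ hp₂ (by rw [e₁', e₂', hs])
      have := hT.inj i₁ hi₁ i₂ (by omega) (by rw [← e₁, ← e₂, hp])
      omega
    -- At most `i < k` shifts by `δ / k`.
    · obtain ⟨m, hm, e⟩ := hD.shift i (by omega)
      refine key _ e ?_
      rw [shift, if_neg (not_le.2 hpos), abs_of_nonneg (by positivity), mul_div_assoc',
        div_le_iff₀ hk, mul_comm]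
      gcongr
      omega
  constructor
  · choose! g hg hg' using hall
    refine ⟨g, fun p hp => ⟨(hg p hp).trans_le hmk, ?_⟩, fun i hi => ?_⟩
    · have hi := hg p hp
      have hrad := hT.radius (g p) hi
      have hr0 := T.r_nonneg (π (g p))
      have hρ' := hρ (g p) (by omega)
      rw [covers_iff (by rw [hρ']; linarith), hρ']
      have h1 := T.dist_le p hp
      rw [← hg' p hp] at h1
      have h2 := hT.dist_le (g p) hi
      have h3 := hshift (g p) hi
      have h5 := dist_triangle4 (row X.d X.pt p) (T.c (π (g p))) (row X.d v.C (g p))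
        (row X.d C' (g p))
      rw [dist_comm (T.c (π (g p))), dist_comm (row X.d v.C (g p)) (row X.d C' (g p))] at h5
      linarith
    · refine (Finset.card_le_card fun p hp => ?_).trans (T.card_le (π i))
      simp only [Finset.mem_filter, Finset.mem_range] at hp ⊢
      exact ⟨hp.1, by rw [← hg' p hp.1, hp.2]⟩
  · calc ∑ i ∈ Finset.range X.k, ρ' i = ∑ i ∈ Finset.range X.k, v.ρ i :=
          Finset.sum_congr rfl fun i hi => hρ i (Finset.mem_range.1 hi)
      _ = ∑ i ∈ Finset.range v.m, v.ρ i := by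
          refine (Finset.sum_subset (Finset.range_mono hmk) fun i _ hi => ?_).symm
          exact hT.radius_zero i (by simpa using hi)
      _ ≤ ∑ i ∈ Finset.range v.m, (T.r (π i) + 3 * δ) :=
          Finset.sum_le_sum fun i hi => (hT.radius i (Finset.mem_range.1 hi)).2
      _ = ∑ l ∈ (Finset.range v.m).image π, T.r l + v.m * (3 * δ) := by
          rw [Finset.sum_add_distrib, Finset.sum_image]
          · simp
          · intro i hi i' hi' e
            exact hT.inj i (by simpa using hi) i' (by simpa using hi') e
      _ ≤ T.value + X.k * (3 * δ) := by
          refine add_le_add (Finset.sum_le_sum_of_subset_of_nonneg (Finset.subset_univ _)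
            fun i _ _ => T.r_nonneg i) ?_
          gcongr
      _ = _ := by ring

end SumOfRadii

namespace SumOfRadii

open RealRAM

/-! ### The choice of the unit -/

/-- Each radius vanishes or is comparable to a distance of two points. -/
def Clustering.Tight {X : Params} (T : Clustering X) : Prop :=
  ∀ i, T.r i = 0 ∨ ∃ p < X.n, ∃ q < X.n, T.r i ≤ dist (row X.d X.pt p) (row X.d X.pt q) ∧
    dist (row X.d X.pt p) (row X.d X.pt q) ≤ 2 * T.r i

/-- Compare the radius of a cluster with its diameter `D`. Always `D ≤ 2 r`; if `D < r`, recentre at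
an endpoint of a diametral pair with radius `D`. Empty clusters get radius zero. -/
theorem Clustering.exists_tight {X : Params} (T : Clustering X) :
    ∃ T' : Clustering X, T'.value ≤ T.value ∧ T'.Tight := by
  have key : ∀ i, ∃ (c : EuclideanSpace ℝ (Fin X.d)) (r : ℝ), 0 ≤ r ∧ r ≤ T.r i ∧
      (∀ p < X.n, T.μ p = i → dist (row X.d X.pt p) c ≤ r) ∧
      (r = 0 ∨ ∃ p < X.n, ∃ q < X.n, r ≤ dist (row X.d X.pt p) (row X.d X.pt q) ∧
        dist (row X.d X.pt p) (row X.d X.pt q) ≤ 2 * r) := by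
    intro i
    by_cases hne : T.Nonempty i
    · obtain ⟨p₀, hp₀, e₀⟩ := hne
      set F := (Finset.range X.n).filter fun p => T.μ p = i with hF
      have hmem : ∀ p, p ∈ F ↔ p < X.n ∧ T.μ p = i := by simp [hF]
      obtain ⟨⟨p, q⟩, hpq, hmax⟩ := (F ×ˢ F).exists_max_image
        (fun x => dist (row X.d X.pt x.1) (row X.d X.pt x.2))
        ⟨(p₀, p₀), by simp [hmem, hp₀, e₀]⟩
      rw [Finset.mem_product, hmem, hmem] at hpq
      obtain ⟨⟨hp, hpi⟩, hq, hqi⟩ := hpq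
      by_cases h : T.r i ≤ dist (row X.d X.pt p) (row X.d X.pt q)
      · refine ⟨T.c i, T.r i, T.r_nonneg i, le_rfl, fun p hp e => e ▸ T.dist_le p hp,
          .inr ⟨p, hp, q, hq, h, ?_⟩⟩
        have h1 := T.dist_le p hp
        have h2 := T.dist_le q hq
        rw [hpi] at h1
        rw [hqi] at h2
        have := dist_triangle_right (row X.d X.pt p) (row X.d X.pt q) (T.c i)
        linarith
      · refine ⟨row X.d X.pt p, dist (row X.d X.pt p) (row X.d X.pt q), dist_nonneg,
          (not_le.1 h).le, fun p' hp' e => ?_, .inr ⟨p, hp, q, hq, le_rfl, ?_⟩⟩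
        · exact hmax (p', p) (by simp [hmem, hp', e, hp, hpi])
        · linarith [dist_nonneg (x := row X.d X.pt p) (y := row X.d X.pt q)]
    · exact ⟨0, 0, le_rfl, T.r_nonneg i, fun p hp e => (hne ⟨p, hp, e⟩).elim, .inl rfl⟩
  choose c r h0 hle hdist htight using key
  exact ⟨⟨c, r, T.μ, h0, fun p hp => hdist _ p hp rfl, T.card_le⟩,
    Finset.sum_le_sum fun i _ => hle i, htight⟩

/-- A coordinate with the largest difference approximates the distance within the factor `d`. This
replaces the distance itself, which would require a root. -/
theorem exists_coordinate {d : ℕ} (hd : 1 ≤ d) (A : ℕ → ℝ) (p q : ℕ) :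
    ∃ c < d, |A (p * d + c) - A (q * d + c)| ≤ dist (row d A p) (row d A q) ∧
      dist (row d A p) (row d A q) ≤ d * |A (p * d + c) - A (q * d + c)| := by
  obtain ⟨c, _, hc⟩ := Finset.exists_max_image (Finset.univ : Finset (Fin d))
    (fun c => |A (p * d + c) - A (q * d + c)|) ⟨⟨0, hd⟩, Finset.mem_univ _⟩
  have hd1 : (1 : ℝ) ≤ d := by exact_mod_cast hd
  have e : dist (row d A p) (row d A q) ^ 2 =
      ∑ j : Fin d, |A (p * d + j) - A (q * d + j)| ^ 2 := by
    rw [EuclideanSpace.dist_eq, Real.sq_sqrt (Finset.sum_nonneg fun _ _ => sq_nonneg _)]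
    rfl
  refine ⟨c, c.2, ?_, ?_⟩
  · refine (sq_le_sq₀ (abs_nonneg _) dist_nonneg).1 ?_
    rw [e]
    exact Finset.single_le_sum (f := fun j : Fin d => |A (p * d + j) - A (q * d + j)| ^ 2)
      (fun _ _ => sq_nonneg _) (Finset.mem_univ c)
  · refine (sq_le_sq₀ dist_nonneg (by positivity)).1 ?_
    rw [e]
    calc _ ≤ ∑ _j : Fin d, |A (p * d + c) - A (q * d + c)| ^ 2 :=
          Finset.sum_le_sum fun j hj => pow_le_pow_left₀ (abs_nonneg _) (hc j hj) 2
      _ = d * |A (p * d + c) - A (q * d + c)| ^ 2 := by simp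
      _ ≤ d * d * |A (p * d + c) - A (q * d + c)| ^ 2 := by
          gcongr
          exact le_mul_of_one_le_left (by positivity) hd1
      _ = _ := by ring

/-- For the largest radius `r`, the value lies in `[r, k r]`. Tightness and a largest coordinate
give a difference `b` with `b ≤ 2 r` and `r ≤ d b`. So the value is between `b / 2` and `2 d k · b /
2`, and doubling `b / 2` suitably often comes within a factor of two. -/
theorem Clustering.Tight.exists_unit {X : Params} {T : Clustering X} (hT : T.Tight) {a : ℕ}
    (hX : X.Valid a) : ∃ p < X.n, ∃ q < X.n, ∃ c < X.d, ∃ e < X.d + X.k + 1,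
      0 ≤ unit X p q c e ∧ T.value ≤ 8 * X.K * unit X p q c e ∧
      4 * X.K * unit X p q c e ≤ T.value := by
  have hd := hX.d_pos
  have hk := hX.k_pos
  have hK : 0 < X.K := by linarith [hX.two_le]
  have : _root_.Nonempty (Fin X.k) := ⟨⟨0, hk⟩⟩
  obtain ⟨i, hi⟩ := Finite.exists_max T.r
  have hV0 : 0 ≤ T.value := Finset.sum_nonneg fun i _ => T.r_nonneg i
  have hVi : T.value ≤ X.k * T.r i := by
    calc T.value ≤ ∑ _j : Fin X.k, T.r i := Finset.sum_le_sum fun j _ => hi j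
      _ = _ := by simp
  have hiV := T.r_le_value i
  rcases hV0.eq_or_lt with h0 | hpos
  -- Value zero is matched by the unit zero, from a point paired with itself.
  · refine ⟨0, hX.n_pos, 0, hX.n_pos, 0, hd, 0, by omega, ?_⟩
    simp [unit, ← h0]
  obtain h | ⟨p₀, hp₀, q₀, hq₀, hD1, hD2⟩ := hT i
  · rw [h, mul_zero] at hVi
    linarith
  obtain ⟨p, hp, q, hq, c, hc, hb1, hb2⟩ : ∃ p < X.n, ∃ q < X.n, ∃ c < X.d,
      X.pt (p * X.d + c) - X.pt (q * X.d + c) ≤ 2 * T.r i ∧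
      T.r i ≤ X.d * (X.pt (p * X.d + c) - X.pt (q * X.d + c)) := by
    obtain ⟨c, hc, h1, h2⟩ := exists_coordinate hd X.pt p₀ q₀
    -- The search runs over ordered pairs, so the difference may be assumed positive.
    rcases abs_cases (X.pt (p₀ * X.d + c) - X.pt (q₀ * X.d + c)) with ⟨e, _⟩ | ⟨e, _⟩
    · rw [e] at h1 h2
      exact ⟨p₀, hp₀, q₀, hq₀, c, hc, by linarith, by linarith⟩
    · rw [e, neg_sub] at h1 h2
      exact ⟨q₀, hq₀, p₀, hp₀, c, hc, by linarith, by linarith⟩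
  set b := X.pt (p * X.d + c) - X.pt (q * X.d + c) with hb
  have hkR : (0 : ℝ) < X.k := by exact_mod_cast hk
  have hdR : (0 : ℝ) < X.d := by exact_mod_cast hd
  have hri : 0 < T.r i := by
    by_contra h
    nlinarith [not_lt.1 h]
  have hbpos : 0 < b := by
    by_contra h
    nlinarith [not_lt.1 h]
  obtain ⟨e, he1, he2⟩ := exists_nat_pow_near (x := T.value / (b / 2)) (y := 2)
    ((one_le_div (by positivity)).2 (by linarith)) one_lt_two
  rw [le_div_iff₀ (by positivity)] at he1
  rw [div_lt_iff₀ (by positivity), pow_succ] at he2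
  have hunit : unit X p q c e = 2 ^ e * (b / (8 * X.K)) := rfl
  refine ⟨p, hp, q, hq, c, hc, e, ?_, ?_, ?_, ?_⟩
  -- `2 d k ≤ 2 · 2 ^ d · 2 ^ (k - 1) = 2 ^ (d + k)` bounds the number of doublings.
  · have h2 : (2 : ℝ) ^ e ≤ 2 ^ (X.d + X.k) := by
      have h1 : (X.k : ℝ) ≤ 2 ^ (X.k - 1) := by
        have := Nat.lt_two_pow_self (n := X.k - 1)
        exact_mod_cast (show X.k ≤ 2 ^ (X.k - 1) by omega)
      have h3 : (X.d : ℝ) ≤ 2 ^ X.d := by exact_mod_cast Nat.lt_two_pow_self.le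
      have h4 : (2 : ℝ) ^ (X.d + X.k) = 2 * 2 ^ X.d * 2 ^ (X.k - 1) := by
        rw [mul_comm 2, ← pow_succ, ← pow_add]
        congr 1
        omega
      rw [h4]
      refine le_of_mul_le_mul_right (?_ : _ ≤ _) (half_pos hbpos)
      calc 2 ^ e * (b / 2) ≤ X.k * T.r i := he1.trans hVi
        _ ≤ X.k * (X.d * b) := by gcongr
        _ = 2 * X.d * X.k * (b / 2) := by ring
        _ ≤ _ := by gcongr
    have := (pow_le_pow_iff_right₀ (one_lt_two (α := ℝ))).1 h2
    omega
  · rw [hunit]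
    positivity
  · rw [hunit, show 8 * X.K * (2 ^ e * (b / (8 * X.K))) = 2 ^ e * 2 * (b / 2) by field_simp]
    exact he2.le
  · rw [hunit, show 4 * X.K * (2 ^ e * (b / (8 * X.K))) = 2 ^ e * (b / 2) by field_simp; ring]
    exact he1

/-- Every clustering is matched by some guess, up to the factor `1 + ε`. -/
theorem Clustering.exists_guess {X : Params} (T : Clustering X) {a : ℕ} (hX : X.Valid a)
    (hinj : ∀ p < X.n, ∀ q < X.n, row X.d X.pt p = row X.d X.pt q → p = q) {ε : ℝ} (hε : 0 < ε)
    (hK : X.k / ε ≤ X.K) : ∃ V ≤ (1 + ε) * T.value, ∃ p < X.n, ∃ q < X.n, ∃ c < X.d,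
      ∃ e < X.d + X.k + 1, ∃ x < 2 ^ (3 * X.L), GoodUnitGuess X (unit X p q c e) x V := by
  obtain ⟨T', hle, htight⟩ := T.exists_tight
  obtain ⟨p, hp, q, hq, c, hc, e, he, h0, h8, h4⟩ := htight.exists_unit hX
  obtain ⟨x, hx, hG⟩ := exists_goodUnitGuess hX hinj h0 h8
  refine ⟨_, ?_, p, hp, q, hq, c, hc, e, he, x, hx, hG⟩
  rw [div_le_iff₀ hε] at hK
  -- The excess is `3kδ ≤ 3Kεδ`, at most three quarters of `ε` times the value, because `4Kδ` does
  -- not exceed the value.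
  have h1 : X.k * unit X p q c e ≤ X.K * ε * unit X p q c e := by gcongr
  have h2 : ε * (4 * X.K * unit X p q c e) ≤ ε * T'.value := by gcongr
  have h3 : (1 + ε) * T'.value ≤ (1 + ε) * T.value := by gcongr
  have h5 : 0 ≤ X.K * ε * unit X p q c e := by
    have := hX.two_le
    positivity
  linarith

end SumOfRadii

namespace SumOfRadii

open RealRAM

/-! ### The running time -/

/-- `x` is at most `n ^ i * B ^ j`, where `B` exceeds all numeric coefficients in use. -/
structure Bounded (n B i j x : ℕ) : Prop where
  n_pos : 1 ≤ n
  B_ge : 1024 ≤ B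
  le : x ≤ n ^ i * B ^ j

namespace Bounded

variable {n B i j x i' j' y : ℕ}

theorem lit (h : Bounded n B i j x) (c : ℕ) (hc : c ≤ 1024) : Bounded n B 0 1 c :=
  ⟨h.n_pos, h.B_ge, by simpa using hc.trans h.B_ge⟩

theorem mul (h : Bounded n B i j x) (h' : Bounded n B i' j' y) :
    Bounded n B (i + i') (j + j') (x * y) :=
  ⟨h.n_pos, h.B_ge, (Nat.mul_le_mul h.le h'.le).trans_eq (by ring)⟩

theorem mono (h : Bounded n B i j x) (hi : i ≤ i') (hj : j ≤ j') : Bounded n B i' j' x :=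
  ⟨h.n_pos, h.B_ge, h.le.trans (Nat.mul_le_mul (Nat.pow_le_pow_right h.n_pos hi)
    (Nat.pow_le_pow_right (by have := h.B_ge; omega) hj))⟩

theorem add (h : Bounded n B i j x) (h' : Bounded n B i' j' y) :
    Bounded n B (max i i') (max j j' + 1) (x + y) := by
  refine ⟨h.n_pos, h.B_ge, ?_⟩
  have h1 := (h.mono (le_max_left i i') (le_max_left j j')).le
  have h2 := (h'.mono (le_max_right i i') (le_max_right j j')).le
  calc x + y ≤ 2 * (n ^ max i i' * B ^ max j j') := by omega
    _ ≤ B * (n ^ max i i' * B ^ max j j') := Nat.mul_le_mul_right _ (by have := h.B_ge; omega)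
    _ = _ := by ring

end Bounded

/-- The exponents are found by unification along the structure of the time functions; only the final
`3` and a generous `60` are stated. -/
theorem mainTime_bounded {n B d k a r L : ℕ} (hn : Bounded n B 1 0 n) (hd : Bounded n B 0 1 d)
    (hk : Bounded n B 0 1 k) (ha : Bounded n B 0 1 a) (hr : Bounded n B 0 1 r)
    (hL : Bounded n B 0 1 L) (h2k : Bounded n B 0 1 (2 ^ k)) (h2L : Bounded n B 0 3 (2 ^ (3 * L))) :
    Bounded n B 3 60 (mainTime n d k a r L) := by
  have c := fun (c : ℕ) (hc : c ≤ 1024) => hn.lit c hc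
  have hcover : Bounded n B _ _ (coverTime n d k) :=
    (hn.mul ((hk.mul ((hd.mul (c 90 (by decide))).add (c 130 (by decide)))).add
      (c 60 (by decide)))).add (c 30 (by decide))
  have h3L := (c 3 (by decide)).mul hL
  have hbits : Bounded n B _ _ (bitsTime (3 * L)) :=
    (h3L.mul (c 130 (by decide))).add (c 50 (by decide))
  have hhall : Bounded n B _ _ (hallTime n k) :=
    (h2k.mul (((((hk.mul (c 130 (by decide))).add (c 50 (by decide))).add
      ((hk.mul (c 70 (by decide))).add (c 30 (by decide)))).add
      ((hn.mul (((hk.mul (c 80 (by decide))).add (c 80 (by decide))).add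
        (c 30 (by decide)))).add (c 30 (by decide)))).add (c 100 (by decide)))).add
      (c 50 (by decide))
  have hadv : Bounded n B _ _ (advanceTime n d k) :=
    hcover.add ((hn.mul ((hk.mul (c 60 (by decide))).add (c 100 (by decide)))).add
      (c 50 (by decide)))
  have hstep : Bounded n B _ _ (stepTime n d k) := hadv.add (c 250 (by decide))
  have hrun : Bounded n B _ _ (runTime n d k L) :=
    (((hk.mul ((hd.mul (c 50 (by decide))).add (c 80 (by decide)))).add (c 80 (by decide))).add
      hbits).add ((hL.mul (hstep.add (c 130 (by decide)))).add (c 30 (by decide)))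
  have hdedup : Bounded n B _ _ (dedupTime d k) :=
    (hk.mul ((hk.mul ((hk.mul ((hd.mul (c 90 (by decide))).add (c 100 (by decide)))).add
      (c 110 (by decide)))).add (c 60 (by decide)))).add (c 30 (by decide))
  have heval : Bounded n B _ _ (evalTime n d k) :=
    (hcover.add hhall).add ((hk.mul ((hd.mul (c 50 (by decide))).add (c 150 (by decide)))).add
      (c 150 (by decide)))
  have hguess : Bounded n B _ _ (guessTime n d k L) := hrun.add (hdedup.add heval)
  have hunit : Bounded n B _ _ (unitTime n d k L) :=
    (h2L.mul (hguess.add (c 30 (by decide)))).add (c 100 (by decide))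
  have hsearch : Bounded n B _ _ (searchTime n d k L) :=
    (hn.mul ((hn.mul ((hd.mul ((((hd.add hk).add (c 1 (by decide))).mul
      (hunit.add (c 30 (by decide)))).add (c 100 (by decide)))).add (c 60 (by decide)))).add
      (c 60 (by decide)))).add (c 30 (by decide))
  have hassign : Bounded n B _ _ (assignTime n d k) :=
    hcover.add ((hn.mul ((hk.mul (hhall.add (c 100 (by decide)))).add (c 60 (by decide)))).add
      (c 30 (by decide)))
  have hsetup : Bounded n B _ _ (setupTime n d k a r L) :=
    (((((((c 50 (by decide)).add ((ha.mul (c 40 (by decide))).add (c 40 (by decide)))).add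
      ((hk.mul ((hd.mul (c 60 (by decide))).add (c 60 (by decide)))).add (c 80 (by decide)))).add
      ((hr.mul (c 40 (by decide))).add (c 40 (by decide)))).add
      (((hn.add hk).mul (c 60 (by decide))).add (c 40 (by decide)))).add
      ((hn.mul (c 60 (by decide))).add (c 40 (by decide)))).add
      (((h3L.add (c 1 (by decide))).mul (c 60 (by decide))).add (c 40 (by decide))))
  have hmain : Bounded n B _ _ (mainTime n d k a r L) :=
    hsetup.add (hsearch.add (hassign.add (c 10 (by decide))))
  exact hmain.mono (by norm_num) (by norm_num)

/-- With `B = 2 ^ L` all parameters except `n`, all numeric coefficients and `2 ^ k` are at most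
`B`, and the number of guesses is `B ^ 3`. -/
theorem mainTime_le {n d k a r : ℕ} (hn : 1 ≤ n) (hd : 1 ≤ d) (hk : 1 ≤ k) (hr : r * r ≤ 4 * d) :
    mainTime n d k a r (k * d * (2 * a + 36)) ≤
      n ^ 3 * (2 ^ (k * d * (2 * a + 36))) ^ 60 := by
  set L := k * d * (2 * a + 36) with hL
  have hkL : k ≤ L := by
    calc k = k * 1 * 1 := by ring
      _ ≤ _ := by rw [hL]; gcongr; omega
  have hdL : 4 * d ≤ L := by
    calc 4 * d = 1 * d * 4 := by ring
      _ ≤ _ := by rw [hL]; gcongr; omega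
  have haL : 2 * a + 36 ≤ L := Nat.le_mul_of_pos_left _ (by positivity)
  have hrL : r ≤ L := (Nat.le_mul_self r).trans (hr.trans hdL)
  have hLB : L < 2 ^ L := Nat.lt_two_pow_self
  have hB : 1024 ≤ 2 ^ L := by
    calc 1024 = 2 ^ 10 := by norm_num
      _ ≤ _ := Nat.pow_le_pow_right (by norm_num) (by omega)
  have key : ∀ x ≤ 2 ^ L, Bounded n (2 ^ L) 0 1 x := fun x hx => ⟨hn, hB, by simpa using hx⟩
  refine (mainTime_bounded ⟨hn, hB, by simp⟩ (key d (by omega)) (key k (by omega))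
    (key a (by omega)) (key r (by omega)) (key L hLB.le)
    (key _ (Nat.pow_le_pow_right (by norm_num) hkL)) ⟨hn, hB, ?_⟩).le
  rw [pow_zero, one_mul, ← pow_mul, mul_comm]

/-- The number of steps in terms of `log₂ K`. -/
theorem length_le_log {k d a : ℕ} {K : ℝ} (hK : 2 ≤ K) (ha : ∀ i < a, ¬ K ≤ 2 ^ i) :
    ((k * d * (2 * a + 36) : ℕ) : ℝ) ≤ 40 * (k * d * Real.logb 2 K) := by
  have h1 : 1 ≤ Real.logb 2 K := by
    rw [Real.le_logb_iff_rpow_le one_lt_two (by linarith)]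
    simpa using hK
  have h2 : (a : ℝ) ≤ Real.logb 2 K + 1 := by
    rcases a with _ | a
    · push_cast
      linarith
    · have := not_le.1 (ha a (by omega))
      have : (a : ℝ) ≤ Real.logb 2 K := by
        rw [Real.le_logb_iff_rpow_le one_lt_two (by linarith), Real.rpow_natCast]
        exact this.le
      push_cast
      linarith
  push_cast
  calc (k * d * (2 * a + 36) : ℝ) ≤ k * d * (40 * Real.logb 2 K) := by gcongr; linarith
    _ = _ := by ring

/-! ### Solutions and clusterings -/

theorem inputState_row {n d k U : ℕ} {ε : ℝ} {P : Fin n → EuclideanSpace ℝ (Fin d)} (i : Fin n) :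
    row d ((inputState k U ε P).real 1) i = P i := by
  ext j
  have h : (i : ℕ) * d + j < n * d := index_lt i.2 j.2
  have e : (⟨i * d + j, h⟩ : Fin (n * d)) = finProdFinEquiv (i, j) := by
    ext
    simp [mul_comm, add_comm]
  change (if h : (i : ℕ) * d + j < n * d then _ else _) = _
  rw [dif_pos h, e, Equiv.symm_apply_apply]

theorem card_filter_range {n : ℕ} (f : ℕ → Prop) [DecidablePred f] :
    ((Finset.range n).filter f).card = (Finset.univ.filter fun i : Fin n => f i).card := by
  rw [← Nat.Iio_eq_range, ← Fin.map_valEmbedding_univ, Finset.filter_map, Finset.card_map]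
  rfl

/-- Distinctness of the centres is dropped, since the algorithm restores it for its own solution.
The value of `μ` beyond the `n` points is irrelevant. -/
theorem Solution.Valid.exists_clustering {X : Params} {P : Fin X.n → EuclideanSpace ℝ (Fin X.d)}
    (hP : ∀ i : Fin X.n, row X.d X.pt i = P i) {T : Solution X.n X.d X.k} (hT : T.Valid X.U P)
    (hk : 1 ≤ X.k) : ∃ T' : Clustering X, T'.value = T.value := by
  refine ⟨⟨T.centre, T.radius, fun p => if h : p < X.n then T.assign ⟨p, h⟩ else ⟨0, hk⟩,
    hT.radius_nonneg, fun p hp => ?_, fun i => ?_⟩, rfl⟩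
  · rw [dif_pos hp, hP ⟨p, hp⟩]
    exact hT.dist_le ⟨p, hp⟩
  · rw [card_filter_range]
    simpa using hT.card_le i

/-- The solution with the centres `C`, the radii `ρ` and the assignment `f`. -/
theorem IsAssignment.exists_solution {X : Params} {P : Fin X.n → EuclideanSpace ℝ (Fin X.d)}
    (hP : ∀ i : Fin X.n, row X.d X.pt i = P i) {s : State}
    (hne : ∀ i < X.k, ∀ j < i, ¬ SameRow X.d (s.real 2) i j) (h0 : ∀ i < X.k, 0 ≤ s.real 3 i)
    (hf : IsAssignment X.n X.k X.U (Covers X (s.real 2) (s.real 3)) (s.nat 2)) :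
    ∃ S : Solution X.n X.d X.k, Holds s S ∧ S.Valid X.U P ∧
      S.value = ∑ i ∈ Finset.range X.k, s.real 3 i := by
  refine ⟨⟨fun c => row X.d (s.real 2) c, fun c => s.real 3 c,
    fun i => ⟨s.nat 2 i, (hf.mem i i.2).1⟩⟩, ⟨fun _ _ => rfl, fun _ => rfl, fun _ => rfl⟩,
    ⟨fun c c' e => ?_, fun c => h0 c c.2, fun i => ?_, fun c => ?_⟩, ?_⟩
  · by_contra hc
    rcases lt_or_gt_of_ne (fun h => hc (Fin.ext h) : (c : ℕ) ≠ c') with h | h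
    · exact hne c' c'.2 c h (sameRow_iff.2 e.symm)
    · exact hne c c.2 c' h (sameRow_iff.2 e)
  · obtain ⟨h1, h2⟩ := hf.mem i i.2
    rw [covers_iff (h0 _ h1), hP] at h2
    exact h2
  · refine le_of_eq_of_le ?_ (hf.card_le c c.2)
    rw [card_filter_range]
    simp [Fin.ext_iff]
  · exact (Finset.sum_range fun i => s.real 3 i).symm

end SumOfRadii

/-! ### Assembly of correctness and running time. -/

theorem theorem4 :
    ∃ (prog : RealRAM.Cmd) (C : ℝ), ∀ (n d k U : ℕ) (ε : ℝ) (P : Fin n → EuclideanSpace ℝ (Fin d)),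
      1 ≤ n → 1 ≤ d → 1 ≤ k → 0 < ε → Function.Injective P →
      ∃ (t : ℕ) (s : RealRAM.State),
        RealRAM.Run prog (SumOfRadii.inputState k U ε P) t s ∧
        (t : ℝ) ≤ (2 : ℝ) ^ (C * (k * d * Real.logb 2 (max 2 (k / ε)))) * (n : ℝ) ^ 3 ∧
        SumOfRadii.IsApproxOutput (1 + ε) k U P s := by
  classical
  -- `2400 = 60 · 40`: the exponent in `mainTime_le` times the constant in `length_le_log`.
  refine ⟨SumOfRadii.mainCmd, 2400, fun n d k U ε P hn hd hk hε hinj => ?_⟩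
  have hlog : ∃ a : ℕ, max 2 (k / ε) ≤ (2 : ℝ) ^ a :=
    (pow_unbounded_of_one_lt (max 2 (k / ε)) one_lt_two).imp fun _ h => h.le
  obtain ⟨a, ha, ha'⟩ : ∃ a : ℕ, max 2 (k / ε) ≤ (2 : ℝ) ^ a ∧
      ∀ i < a, ¬ max 2 (k / ε) ≤ (2 : ℝ) ^ i :=
    ⟨Nat.find hlog, Nat.find_spec hlog, fun i hi => Nat.find_min hlog hi⟩
  have hroot : ∃ r, d ≤ r * r := ⟨d, Nat.le_mul_self d⟩
  obtain ⟨r, hr, hr'⟩ : ∃ r, d ≤ r * r ∧ ∀ i < r, ¬ d ≤ i * i :=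
    ⟨Nat.find hroot, Nat.find_spec hroot, fun i hi => Nat.find_min hroot hi⟩
  -- By minimality `(r - 1) ^ 2 < d`, so rounding `√d` up at most doubles it.
  have hr4 : r * r ≤ 4 * d := by
    rcases r with _ | r
    · simp
    · have h := hr' r (by omega)
      nlinarith
  set s := SumOfRadii.inputState k U ε P with hs
  obtain ⟨X, hX⟩ : ∃ X : SumOfRadii.Params,
      X = ⟨n, d, k, U, k * d * (2 * a + 36), r, max 2 (k / ε), s.real 1⟩ := ⟨_, rfl⟩
  have hspec := SumOfRadii.mainCmd_spec (s := s) (U := U) rfl rfl rfl rfl rfl ha ha' hr hr'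
    hn hd hk rfl hX
  obtain ⟨t, s', hrun, ht, hpost⟩ := hspec
  have hrow : ∀ i : Fin n, SumOfRadii.row d (s.real 1) i = P i := SumOfRadii.inputState_row
  have hcomplete : ∀ T : SumOfRadii.Solution n d k, T.Valid U P → s'.nat 1 0 = 1 ∧
      ∑ i ∈ Finset.range k, s'.real 3 i ≤ (1 + ε) * T.value := by
    intro T hT
    subst hX
    obtain ⟨T', hT'⟩ := hT.exists_clustering
      (X := ⟨n, d, k, U, k * d * (2 * a + 36), r, max 2 (k / ε), s.real 1⟩) hrow hk
    have hinj' : ∀ p < n, ∀ q < n, SumOfRadii.row d (s.real 1) p = SumOfRadii.row d (s.real 1) q →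
        p = q := fun p hp q hq e =>
      congrArg Fin.val (hinj ((hrow ⟨p, hp⟩).symm.trans (e.trans (hrow ⟨q, hq⟩))))
    obtain ⟨V, hV, hG⟩ := T'.exists_guess
      ⟨hn, hd, hk, le_max_left _ _, ha, hr, hr4, rfl⟩ hinj' hε (le_max_right _ _)
    obtain ⟨h1, h2⟩ := hpost.2 V hG
    exact ⟨h1, h2.trans (hT' ▸ hV)⟩
  refine ⟨t, s', hrun, ?_, ?_⟩
  · calc (t : ℝ) ≤ ((n ^ 3 * (2 ^ (k * d * (2 * a + 36))) ^ 60 : ℕ) : ℝ) :=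
          Nat.cast_le.2 (ht.trans (SumOfRadii.mainTime_le hn hd hk hr4))
      _ = 2 ^ (60 * ((k * d * (2 * a + 36) : ℕ) : ℝ)) * (n : ℝ) ^ 3 := by
          rw [mul_comm (60 : ℝ), Real.rpow_mul zero_le_two, Real.rpow_natCast,
            show (60 : ℝ) = (60 : ℕ) by norm_num, Real.rpow_natCast]
          push_cast
          ring
      _ ≤ _ := by
          have := SumOfRadii.length_le_log (k := k) (d := d) (le_max_left 2 (k / ε)) ha'
          refine mul_le_mul_of_nonneg_right ?_ (by positivity)
          exact Real.rpow_le_rpow_of_exponent_le one_le_two (by linarith)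
  · rcases hpost.1 with h0 | ⟨h1, hne, h0, hf⟩
    · exact .inr ⟨h0, fun T hT => by simp [(hcomplete T hT).1] at h0⟩
    · subst hX
      obtain ⟨S, hS, hSv, hval⟩ := hf.exists_solution hrow hne h0
      exact .inl ⟨h1, S, hS, hSv, fun T hT => hval.trans_le (hcomplete T hT).2⟩
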